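/- Let $F$ be a non-archimedean local field of characteristic $0$ with ring of integers $\mathfrak o$, maximal ideal $\mathfrak p$, prime element $\pi$, residue field of odd cardinality $q$, and absolute value normalized by $|\pi|=q^{-1}$. Fix $\delta\in\mathfrak o^\times\setminus(\mathfrak o^\times)^2$, an additive character $\psi:F\to\mathbb C^1$ of order $0$ (trivial on $\mathfrak o$, non-trivial on $\pi^{-1}\mathfrak o$), a character $\omega$ of $F^\times$ with $\omega^2=1$, an integer $n\ge 0$, and a symmetric matrix $B\in M_n(F)$ with $\det B\ne0$. Haar measures $dX$ on $\mathrm{Sym}_n(F)$ and $d\gamma$ on $M_n(F)$ are normalized by $\int_{\mathrm{Sym}_n(\mathfrak o)}dX=\int_{M_n(\mathfrak o)}d\gamma=1$. *The Siegel series.* Let $w_i=\begin{pmatrix}1_{n-i}&&&\\&0_i&&-1_i\\&&1_{n-i}&\\&1_i&&0_i\end{pmatrix}\in \mathrm{Sp}_n(F)$ for $0\le i\le n$, let $\Gamma=\{\begin{pmatrix}A&B'\\C&D\end{pmatrix}\in\mathrm{Sp}_n(\mathfrak o): C\equiv0\bmod\mathfrak p\}$, and for $s\in\mathbb C$ let $f_{0,s}$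 be the locally constant function on $\mathrm{Sp}_n(F)$ with $$f_{0,s}\!\left(\begin{pmatrix}A&*\\0&{}^t\!A^{-1}\end{pmatrix}g\right)=\omega(\det A)|\det A|^{s}f_{0,s}(g),\qquad f_{0,s}(gk)=\omega(\det D)f_{0,s}(g)\quad\Bigl(k=\begin{pmatrix}A&B'\\C&D\end{pmatrix}\in\Gamma\Bigr),$$ $f_{0,s}(w_0)=1$ and $f_{0,s}(w_i)=0$ for $1\le i\le n$. The series $$S_0(B,s)^\omega=\int_{\mathrm{Sym}_n(F)}f_{0,s}\!\left(w_n\begin{pmatrix}1&X\\0&1\end{pmatrix}\right)\psi(-\mathrm{tr}(BX))\,dX$$ is defined by this integral where it converges absolutely, and by meromorphic continuation to $s\in\mathbb C$ otherwise. *The orbit data.* Let $\Gamma_0=\{\gamma\in\mathrm{GL}_n(\mathfrak o):\gamma_{ij}\in\mathfrak p\ (i>j)\}$. Let $\Lambda_n$ be the set of $(\sigma,h,\varepsilon)\in\mathfrak S_n\times\mathbb Z^n\times\{1,\delta\}^n$ with $\sigma^2=1$, $h_{\sigma(i)}=h_i$ for all $i$, and $\varepsilon_i=1$ whenever $\sigma(i)\ne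 i$; let $S_{\sigma,h,\varepsilon}$ be the symmetric matrix with $(i,j)$ entry $\varepsilon_i\pi^{h_i}$ if $i=\sigma(j)$ and $0$ otherwise. For non-degenerate symmetric $Y,T\in M_n(F)$ put $$\mathscr G_{\Gamma_0}(Y,T)=\int_{\Gamma_0}\psi(-\mathrm{tr}(Y\,{}^t\gamma T\gamma))\,d\gamma,\qquad \alpha(\Gamma_0;Y)=\lim_{l\to\infty}q^{-ln(n-1)/2}N_l(\Gamma_0;Y),$$ where, with $m\ge0$ the least integer such that $\pi^mY$ is integral, $$N_l(\Gamma_0;Y)=q^{-mn^2}\,\#\{\gamma\in\Gamma_0\bmod\mathfrak p^{l+m}:\gamma Y\,{}^t\gamma\equiv Y\bmod\mathfrak p^l\}$$ (for integral $Y$ simply the number of solutions in $\Gamma_0\bmod\mathfrak p^l$). **Theorem.** The functions $f_{0,s}$ exist, the integral defining $S_0(B,s)^\omega$ converges absolutely on some right half-plane and has a meromorphic continuation to $\mathbb C$, the limits $\alpha(\Gamma_0;S_{\sigma,h,\varepsilon})$ exist and are positive for all $(\sigma,h,\varepsilon)\in\Lambda_n$ with all $h_i\le-1$, and $\mathscr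 G_{\Gamma_0}(S_{\sigma,h,\varepsilon},B)\neq0$ for only finitely many of these. For every $s\in\mathbb C$, $$S_0(B,s)^\omega=\sum_{\substack{(\sigma,h,\varepsilon)\in\Lambda_n\\ h_i\le-1\ (1\le i\le n)}}\omega(\det S_{\sigma,h,\varepsilon})\,|\det S_{\sigma,h,\varepsilon}|^{-s}\;\frac{\mathscr G_{\Gamma_0}(S_{\sigma,h,\varepsilon},B)}{\alpha(\Gamma_0;S_{\sigma,h,\varepsilon})},$$ where the left side is the integral itself whenever that converges absolutely. -/

import Mathlib

open MeasureTheory Filter Topology Matrix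
open scoped NormedField Valued

/-!
Throughout, a non-archimedean local field is a nontrivially normed field `F` whose distance is
ultrametric and whose topology is locally compact.  Its ring of integers is `𝒪[F] = {‖x‖ ≤ 1}`, its
maximal ideal is `{‖x‖ < 1}`, and the statement asks that the norm be normalized, i.e. that a prime
element have norm `q⁻¹`, where `q` is the number of elements of the residue field.
-/

namespace RamifiedSiegel

noncomputable section

/-- The cardinality `q` of the residue field of `F`. -/
def resCard (F : Type*) [NontriviallyNormedField F] [IsUltrametricDist F] : ℕ :=
  Nat.card 𝓀[F]

/-- The additive character `ψ` has order `0`: it is trivial on the ring of integers, but not on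
the inverse of the maximal ideal. -/
def HasOrderZero {F : Type*} [NontriviallyNormedField F] [IsUltrametricDist F]
    (ϖ : 𝒪[F]) (ψ : AddChar F Circle) : Prop :=
  (∀ x : 𝒪[F], ψ (x : F) = 1) ∧ ∃ x : 𝒪[F], ψ ((ϖ : F)⁻¹ * (x : F)) ≠ 1

/-! ### Symplectic group and the induced representation -/

/-- `Sp_n(F)`, with `2n × 2n` matrices written in `n × n` blocks. -/
abbrev Sp (n : ℕ) (F : Type*) [Field F] := Matrix.symplecticGroup (Fin n) F

/-- The blocks of `g = (A, B; C, D)`. -/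
def blockA {n : ℕ} {F : Type*} [Field F] (g : Sp n F) : Matrix (Fin n) (Fin n) F :=
  (g : Matrix (Fin n ⊕ Fin n) (Fin n ⊕ Fin n) F).toBlocks₁₁

def blockC {n : ℕ} {F : Type*} [Field F] (g : Sp n F) : Matrix (Fin n) (Fin n) F :=
  (g : Matrix (Fin n ⊕ Fin n) (Fin n ⊕ Fin n) F).toBlocks₂₁

def blockD {n : ℕ} {F : Type*} [Field F] (g : Sp n F) : Matrix (Fin n) (Fin n) F :=
  (g : Matrix (Fin n ⊕ Fin n) (Fin n ⊕ Fin n) F).toBlocks₂₂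

/-- The Siegel parabolic subgroup `P = {C = 0}`. -/
def siegelParabolic (n : ℕ) (F : Type*) [Field F] : Set (Sp n F) :=
  {g | blockC g = 0}

/-- The subgroup `Γ = {C ≡ 0 mod 𝔭}` of `Sp_n(𝔬)`. -/
def siegelGamma (n : ℕ) (F : Type*) [NontriviallyNormedField F] : Set (Sp n F) :=
  {g | (∀ i j, ‖(g : Matrix (Fin n ⊕ Fin n) (Fin n ⊕ Fin n) F) i j‖ ≤ 1) ∧
    ∀ i j, ‖blockC g i j‖ < 1}

/-- The diagonal idempotent matrix selecting the indices `j < n - i` (0-based). -/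
def lowIdem (n i : ℕ) (F : Type*) [Field F] : Matrix (Fin n) (Fin n) F :=
  Matrix.diagonal fun j => if (j : ℕ) + i < n then 1 else 0

/-- The diagonal idempotent matrix selecting the last `i` indices. -/
def highIdem (n i : ℕ) (F : Type*) [Field F] : Matrix (Fin n) (Fin n) F :=
  Matrix.diagonal fun j => if (j : ℕ) + i < n then 0 else 1

/-- The representatives `w_i` (`0 ≤ i ≤ n`) of `P \ Sp_n(F) / Γ`. In particular `w_0 = 1` and
`w_n = (0, -1; 1, 0)`. -/
def weyl (n i : ℕ) (F : Type*) [Field F] : Sp n F :=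
  ⟨Matrix.fromBlocks (lowIdem n i F) (-highIdem n i F) (highIdem n i F) (lowIdem n i F), by
    rw [SymplecticGroup.fromBlocks_mem_iff]
    refine ⟨?_, ?_, ?_⟩
    · simp only [lowIdem, highIdem, Matrix.diagonal_transpose, Matrix.diagonal_mul_diagonal]
      congr 1; funext j; split_ifs <;> simp
    · simp only [lowIdem, highIdem, Matrix.diagonal_transpose, Matrix.transpose_neg,
        Matrix.neg_mul, Matrix.mul_neg, Matrix.diagonal_mul_diagonal]
      congr 2; funext j; split_ifs <;> simp
    · simp only [lowIdem, highIdem, Matrix.diagonal_transpose, Matrix.mul_neg, sub_neg_eq_add,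
        Matrix.diagonal_mul_diagonal, Matrix.diagonal_add]
      rw [← Matrix.diagonal_one]
      congr 1; funext j; split_ifs <;> simp⟩

/-- Membership of `f` in `I_n(ω, s)^{Γ, ω}`: `f` is a smooth (locally constant) function on
`Sp_n(F)`, `f(pg) = ω(det A) |det A|^{s + (n+1)/2} f(g)` for `p = (A, *; 0, ᵗA⁻¹) ∈ P`, and
`f(gk) = ω(det D) f(g)` for `k = (A, B; C, D) ∈ Γ`. -/
structure IsInduced {n : ℕ} {F : Type*} [NontriviallyNormedField F]
    (ω : MulChar F ℂ) (s : ℂ) (f : Sp n F → ℂ) : Prop where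
  smooth : IsLocallyConstant f
  left : ∀ p ∈ siegelParabolic n F, ∀ g : Sp n F,
    f (p * g) = ω (blockA p).det * ((‖(blockA p).det‖ : ℝ) : ℂ) ^ (s + ((n : ℂ) + 1) / 2) * f g
  right : ∀ k ∈ siegelGamma n F, ∀ g : Sp n F, f (g * k) = ω (blockD k).det * f g

/-- `f` is the function `f_t` of `I_n(ω, s - (n+1)/2)^{Γ, ω}` with `f_t(w_i) = δ_{t,i}` for
`0 ≤ i ≤ n`. -/
def IsStandardSection {n : ℕ} {F : Type*} [NontriviallyNormedField F]
    (ω : MulChar F ℂ) (s : ℂ) (t : ℕ) (f : Sp n F → ℂ) : Prop :=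
  IsInduced ω (s - ((n : ℂ) + 1) / 2) f ∧ ∀ i ≤ n, f (weyl n i F) = if t = i then 1 else 0

/-! ### Haar measures -/

/-- The Haar measure on `F` giving the ring of integers volume `1`. -/
def fieldHaar (F : Type*) [NontriviallyNormedField F] [LocallyCompactSpace F]
    [MeasurableSpace F] [BorelSpace F] : Measure F :=
  haveI : ProperSpace F := ProperSpace.of_locallyCompactSpace F
  Measure.addHaarMeasure
    { carrier := Metric.closedBall (0 : F) 1
      isCompact' := isCompact_closedBall 0 1
      interior_nonempty' := ⟨0, mem_interior_iff_mem_nhds.mpr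
        (Metric.closedBall_mem_nhds 0 one_pos)⟩ }

instance matrixMeasurableSpace {n : ℕ} {F : Type*} [MeasurableSpace F] :
    MeasurableSpace (Matrix (Fin n) (Fin n) F) :=
  inferInstanceAs (MeasurableSpace (Fin n → Fin n → F))

/-- The Haar measure on `M_n(F)` giving `M_n(𝔬)` volume `1`: the product measure of the entries. -/
def matrixHaar (n : ℕ) (F : Type*) [NontriviallyNormedField F] [LocallyCompactSpace F]
    [MeasurableSpace F] [BorelSpace F] : Measure (Matrix (Fin n) (Fin n) F) :=
  (Measure.pi fun _ : Fin n => Measure.pi fun _ : Fin n => fieldHaar F :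
    Measure (Fin n → Fin n → F))

/-- `Sym_n(F)`, as a subtype of the square matrices. -/
abbrev SymMat (n : ℕ) (F : Type*) := {X : Matrix (Fin n) (Fin n) F // X.IsSymm}

/-- The symmetric matrix with prescribed entries on and above the diagonal. -/
def symOfUpper {n : ℕ} {F : Type*} (x : {p : Fin n × Fin n // p.1 ≤ p.2} → F) : SymMat n F :=
  ⟨Matrix.of fun i j => x ⟨(min i j, max i j), min_le_max⟩, by
    refine Matrix.IsSymm.ext fun i j => ?_
    simp only [Matrix.of_apply, min_comm, max_comm]⟩

/-- The Haar measure on `Sym_n(F)` giving `Sym_n(𝔬)` volume `1`: the product measure of the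
entries on and above the diagonal. -/
def symHaar (n : ℕ) (F : Type*) [NontriviallyNormedField F] [LocallyCompactSpace F]
    [MeasurableSpace F] [BorelSpace F] : Measure (SymMat n F) :=
  (Measure.pi fun _ : {p : Fin n × Fin n // p.1 ≤ p.2} => fieldHaar F).map symOfUpper

/-! ### The Siegel series -/

/-- The element `(1, X; 0, 1)` of `Sp_n(F)`. -/
def unipotent {n : ℕ} {F : Type*} [Field F] (X : SymMat n F) : Sp n F :=
  ⟨Matrix.fromBlocks 1 X.1 0 1, by
    rw [SymplecticGroup.fromBlocks_mem_iff]
    have h : X.1ᵀ = X.1 := X.2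
    simp [h]⟩

/-- The integrand `φ(w_n (1, X; 0, 1)) ψ(-tr(BX))` of the Siegel series. -/
def siegelIntegrand {n : ℕ} {F : Type*} [Field F] (ψ : AddChar F Circle)
    (B : Matrix (Fin n) (Fin n) F) (φ : Sp n F → ℂ) (X : SymMat n F) : ℂ :=
  φ (weyl n n F * unipotent X) * (ψ (-(B * X.1).trace) : ℂ)

/-- `Z` is the Siegel series attached to the family `φ_s`, as a meromorphic function of `s ∈ ℂ`:
on some right half-plane the integral converges absolutely and equals `Z`, and `Z` is meromorphic
on `ℂ` (in normal form, so that its values are determined everywhere). -/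
def IsSiegelSeries {n : ℕ} {F : Type*} [NontriviallyNormedField F] [LocallyCompactSpace F]
    [MeasurableSpace F] [BorelSpace F] (ψ : AddChar F Circle)
    (B : Matrix (Fin n) (Fin n) F) (φ : ℂ → Sp n F → ℂ) (Z : ℂ → ℂ) : Prop :=
  MeromorphicNFOn Z Set.univ ∧
    ∃ a : ℝ, ∀ s : ℂ, a < s.re →
      Integrable (siegelIntegrand ψ B (φ s)) (symHaar n F) ∧
        Z s = ∫ X, siegelIntegrand ψ B (φ s) X ∂(symHaar n F)

/-! ### The group `Γ₀`, orbit representatives, character sums and local densities -/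

/-- `Γ₀ = {γ ∈ GL_n(𝔬) : γ_{ij} ∈ 𝔭 for i > j}`, as a set of matrices over `F`. -/
def Gamma0 (n : ℕ) (F : Type*) [NontriviallyNormedField F] : Set (Matrix (Fin n) (Fin n) F) :=
  {γ | (∀ i j, ‖γ i j‖ ≤ 1) ∧ ‖γ.det‖ = 1 ∧ ∀ i j, j < i → ‖γ i j‖ < 1}

/-- The set `Λ_n` of all triples `(σ, h, ε)` in `𝔖_n × ℤⁿ × {1, δ}ⁿ` with `σ² = 1`,
`h_{σ(i)} = h_i`, and `ε_i = 1` if `σ(i) ≠ i`. -/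
def Lam (n : ℕ) {F : Type*} [Field F] (δ : F) :
    Set (Equiv.Perm (Fin n) × (Fin n → ℤ) × (Fin n → F)) :=
  {x | x.1 ^ 2 = 1 ∧ (∀ i, x.2.1 (x.1 i) = x.2.1 i) ∧ (∀ i, x.2.2 i = 1 ∨ x.2.2 i = δ) ∧
    ∀ i, x.1 i ≠ i → x.2.2 i = 1}

/-- The set of all `(σ, h, ε) ∈ Λ_n` with `h_i ≤ -1` for all `i`. -/
def LamNeg (n : ℕ) {F : Type*} [Field F] (δ : F) :
    Set (Equiv.Perm (Fin n) × (Fin n → ℤ) × (Fin n → F)) :=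
  {x | x ∈ Lam n δ ∧ ∀ i, x.2.1 i ≤ -1}

/-- The matrix `S_{σ,h,ε}`, with `(i, j)` entry `ε_i ϖ^{h_i}` if `i = σ(j)` and `0` otherwise. -/
def repS {n : ℕ} {F : Type*} [Field F] (ϖ : F)
    (x : Equiv.Perm (Fin n) × (Fin n → ℤ) × (Fin n → F)) : Matrix (Fin n) (Fin n) F :=
  Matrix.of fun i j => if i = x.1 j then x.2.2 i * ϖ ^ x.2.1 i else 0

/-- The character sum `𝒢_{Γ₀}(Y, T) = ∫_{Γ₀} ψ(-tr(Y ᵗγ T γ)) dγ`. -/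
def charSum {n : ℕ} {F : Type*} [NontriviallyNormedField F] [LocallyCompactSpace F]
    [MeasurableSpace F] [BorelSpace F] (ψ : AddChar F Circle)
    (Y T : Matrix (Fin n) (Fin n) F) : ℂ :=
  ∫ γ in Gamma0 n F, (ψ (-(Y * (γᵀ * T * γ)).trace) : ℂ) ∂(matrixHaar n F)

/-- The additive subgroup `𝔭^k M_n(𝔬)` of `M_n(F)`. -/
def congrLattice (n : ℕ) {F : Type*} [NontriviallyNormedField F] [IsUltrametricDist F]
    (ϖ : F) (k : ℕ) : AddSubgroup (Matrix (Fin n) (Fin n) F) where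
  carrier := {X | ∀ i j, ‖X i j‖ ≤ ‖ϖ‖ ^ k}
  zero_mem' := fun i j => by simp
  add_mem' := fun {X Y} hX hY i j =>
    (IsUltrametricDist.norm_add_le_max (X i j) (Y i j)).trans (max_le (hX i j) (hY i j))
  neg_mem' := fun {X} hX i j => by simpa using hX i j

/-- The least `m ≥ 0` such that `ϖ^m Y` has integral entries; it is `0` if `Y` is integral. -/
def denExp {n : ℕ} {F : Type*} [NontriviallyNormedField F] (ϖ : F)
    (Y : Matrix (Fin n) (Fin n) F) : ℕ :=
  sInf {m : ℕ | ∀ i j, ‖ϖ ^ m * Y i j‖ ≤ 1}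

/-- The number `N_l(Γ₀; Y)` of `γ ∈ Γ₀ mod 𝔭^l` with `γ Y ᵗγ ≡ Y mod 𝔭^l`.

If `Y` is integral then `m = denExp ϖ Y = 0` and this is literally the number of such residue
classes.  If `Y` has denominator `ϖ^m`, the congruence `γ Y ᵗγ ≡ Y mod 𝔭^l` depends on `γ` modulo
`𝔭^(l+m)` only, and each class modulo `𝔭^l` consists of `q^(m n²)` classes modulo `𝔭^(l+m)`; the
solutions are therefore counted modulo `𝔭^(l+m)`, each with weight `q^(-m n²)`. -/
def solCount {n : ℕ} {F : Type*} [NontriviallyNormedField F] [IsUltrametricDist F]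
    (ϖ : F) (Y : Matrix (Fin n) (Fin n) F) (l : ℕ) : ℝ :=
  ((((QuotientAddGroup.mk : Matrix (Fin n) (Fin n) F →
      Matrix (Fin n) (Fin n) F ⧸ congrLattice n ϖ (l + denExp ϖ Y)) ''
    {γ | γ ∈ Gamma0 n F ∧ γ * Y * γᵀ - Y ∈ congrLattice n ϖ l}).ncard : ℕ) : ℝ) /
    (resCard F : ℝ) ^ (denExp ϖ Y * n ^ 2)

/-- The sequence `q^{-l n(n-1)/2} N_l(Γ₀; Y)`; the exponent is `l` times `n choose 2`. -/
def densitySeq {n : ℕ} {F : Type*} [NontriviallyNormedField F] [IsUltrametricDist F]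
    (ϖ : F) (Y : Matrix (Fin n) (Fin n) F) (l : ℕ) : ℝ :=
  solCount ϖ Y l / (resCard F : ℝ) ^ (l * n.choose 2)

/-- The local density `α(Γ₀; Y) = lim_{l → ∞} q^{-l n(n-1)/2} N_l(Γ₀; Y)`. -/
def localDensity {n : ℕ} {F : Type*} [NontriviallyNormedField F] [IsUltrametricDist F]
    (ϖ : F) (Y : Matrix (Fin n) (Fin n) F) : ℝ :=
  limUnder atTop (densitySeq ϖ Y)

/-- The finite sum `∑ c_{σ,h,ε,ω}(s) 𝒢_{Γ₀}(S_{σ,h,ε}, B) / α(Γ₀; S_{σ,h,ε})` over all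
`(σ, h, ε) ∈ Λ_n` with all `h_i ≤ -1`, where `c_{σ,h,ε,ω}(s) = ω(det S) |det S|^{-s}`. -/
def orbitSum {n : ℕ} {F : Type*} [NontriviallyNormedField F] [IsUltrametricDist F]
    [LocallyCompactSpace F] [MeasurableSpace F] [BorelSpace F] (ϖ δ : F) (ψ : AddChar F Circle)
    (ω : MulChar F ℂ) (B : Matrix (Fin n) (Fin n) F) (s : ℂ) : ℂ :=
  ∑ᶠ x ∈ LamNeg n δ,
    ω (repS ϖ x).det * ((‖(repS ϖ x).det‖ : ℝ) : ℂ) ^ (-s) *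
      (charSum ψ (repS ϖ x) B / (localDensity ϖ (repS ϖ x) : ℂ))

end

end RamifiedSiegel

/-! Write n(X) for the unipotent element attached to X and m(γ) for the Levi element attached to γ.
For γ in GL_n(𝔬), w_n n(γ X ᵗγ) = m(ᵗγ⁻¹) w_n n(X) m(γ⁻¹), and the two factors ω(det γ) produced by
the left and right transformation laws cancel. So X ↦ f(w_n n(X)) is constant on Γ₀-orbits, and the
integral can be computed orbit by orbit.

Orbits. Every non-degenerate symmetric matrix is Γ₀-equivalent to exactly one S_{σ,h,ε}: existence
is a pivoting argument adapted to Γ₀ (`exists_gamma0Equiv_repS`), uniqueness a comparison of entries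
that tolerates a small error (`NearEquiv.rep_eq`). The tolerance also shows that each orbit is open,
with an explicit radius (`add_mem_orbit`).

Values. If all h_i ≤ -1, then S⁻¹ ≡ 0 mod 𝔭, w_n n(S) lies in PΓ, and f takes the value ω(det S)|det
S|^{-s} on the orbit. If i ≥ 1 of the exponents are non-negative, w_n n(S) lies in P w_i Γ and f
vanishes (`section_monomial`). Degenerate X give 0 by local constancy.

Volumes. By Fubini, Haar measure on an orbit is vol(orbit)/vol(Γ₀) times the image of Haar measure
on Γ₀. Applied to ψ(-tr(BX)) this produces 𝒢; applied to a small ball around S, whose preimage in Γ₀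
is the solution set of γ S ᵗγ ≡ S, it gives α = vol(Γ₀)/vol(orbit), the density sequence being
eventually constant (`densitySeq_eq`).

Finiteness and continuation. If some h_i is very negative, the phase oscillates along a small
lattice and 𝒢 vanishes (`charSum_eq_zero`). The integral converges absolutely for Re s > n(n+1)/2 by
comparison with a geometric series. The orbit sum is finite, hence entire, and the identity theorem
identifies it with the continuation. -/

set_option linter.unusedSectionVars false

/-! ### Arithmetic of the local field, expressed through the norm. -/

namespace RamifiedSiegel

/-- The elementary facts about a non-archimedean local field of odd residue characteristic with
uniformizer `ϖ`, non-square unit `δ` and residue cardinality `q`, in terms of the norm only. -/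
structure LocalFieldData {F : Type*} [NontriviallyNormedField F] (ϖ δ : F) (q : ℕ) : Prop where
  one_lt : 1 < q
  norm_unif : ‖ϖ‖ = (q : ℝ)⁻¹
  discrete : ∀ x : F, x ≠ 0 → ∃ k : ℤ, ‖x‖ = ‖ϖ‖ ^ k
  norm_two : ‖(2 : F)‖ = 1
  norm_nonsquare : ‖δ‖ = 1
  sqrt : ∀ a : F, ‖a‖ < 1 → ∃ r : F, ‖r - 1‖ < 1 ∧ r ^ 2 = 1 + a
  unit_class : ∀ u : F, ‖u‖ = 1 → ∃ v : F, ‖v‖ = 1 ∧ (v ^ 2 * u = 1 ∨ v ^ 2 * u = δ)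
  nonsquare : ∀ v : F, ‖v‖ = 1 → 1 ≤ ‖v ^ 2 - δ‖
  reps : ∃ R : Finset F, R.card = q ∧ (∀ r ∈ R, ‖r‖ ≤ 1) ∧
    (∀ x : F, ‖x‖ ≤ 1 → ∃ r ∈ R, ‖x - r‖ < 1) ∧ ∀ r ∈ R, ∀ r' ∈ R, ‖r - r'‖ < 1 → r = r'

namespace LocalFieldData

variable {F : Type*} [NontriviallyNormedField F] {ϖ δ : F} {q : ℕ}

theorem norm_pos (hF : LocalFieldData ϖ δ q) : 0 < ‖ϖ‖ := by
  have : (0 : ℝ) < q := by exact_mod_cast zero_lt_one.trans hF.one_lt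
  rw [hF.norm_unif]; positivity

theorem norm_lt_one (hF : LocalFieldData ϖ δ q) : ‖ϖ‖ < 1 := by
  rw [hF.norm_unif]; exact inv_lt_one_of_one_lt₀ (by exact_mod_cast hF.one_lt)

theorem ne_zero (hF : LocalFieldData ϖ δ q) : ϖ ≠ 0 := norm_pos_iff.mp hF.norm_pos

theorem norm_le_of_lt_one (hF : LocalFieldData ϖ δ q) {x : F} (hx : ‖x‖ < 1) : ‖x‖ ≤ ‖ϖ‖ := by
  rcases eq_or_ne x 0 with rfl | h0
  · simp
  obtain ⟨k, hk⟩ := hF.discrete x h0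
  have hk1 : 1 ≤ k := by
    by_contra! h
    exact absurd (one_le_zpow_of_nonpos₀ hF.norm_pos hF.norm_lt_one.le (by omega : k ≤ 0))
      (not_le.mpr (hk ▸ hx))
  rw [hk]
  exact (zpow_le_zpow_right_of_le_one₀ hF.norm_pos hF.norm_lt_one.le hk1).trans_eq (zpow_one _)

end LocalFieldData

section Ultrametric

variable {F : Type*} [NontriviallyNormedField F] [IsUltrametricDist F]

theorem norm_add_lt {x y : F} {c : ℝ} (hx : ‖x‖ < c) (hy : ‖y‖ < c) : ‖x + y‖ < c :=
  (IsUltrametricDist.norm_add_le_max x y).trans_lt (max_lt hx hy)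

theorem norm_add_le_of_le {x y : F} {c : ℝ} (hx : ‖x‖ ≤ c) (hy : ‖y‖ ≤ c) : ‖x + y‖ ≤ c :=
  (IsUltrametricDist.norm_add_le_max x y).trans (max_le hx hy)

theorem norm_sub_lt' {x y : F} {c : ℝ} (hx : ‖x‖ < c) (hy : ‖y‖ < c) : ‖x - y‖ < c := by
  rw [sub_eq_add_neg]; exact norm_add_lt hx (by rwa [norm_neg])

theorem norm_sub_le_of_le {x y : F} {c : ℝ} (hx : ‖x‖ ≤ c) (hy : ‖y‖ ≤ c) : ‖x - y‖ ≤ c := by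
  rw [sub_eq_add_neg]; exact norm_add_le_of_le hx (by rwa [norm_neg])

theorem norm_eq_of_sub_lt {x y : F} (h : ‖x - y‖ < ‖y‖) : ‖x‖ = ‖y‖ := by
  have := IsUltrametricDist.norm_add_eq_max_of_norm_ne_norm (x := x - y) (y := y) h.ne
  rw [sub_add_cancel, max_eq_right h.le] at this
  exact this

theorem norm_sum_le_of_le {ι : Type*} {s : Finset ι} {f : ι → F} {c : ℝ} (hc : 0 ≤ c)
    (h : ∀ i ∈ s, ‖f i‖ ≤ c) : ‖∑ i ∈ s, f i‖ ≤ c :=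
  IsUltrametricDist.norm_sum_le_of_forall_le_of_nonneg hc h

theorem norm_sum_lt_of_lt {ι : Type*} {s : Finset ι} {f : ι → F} {c : ℝ} (hc : 0 < c)
    (h : ∀ i ∈ s, ‖f i‖ < c) : ‖∑ i ∈ s, f i‖ < c := by
  classical
  induction s using Finset.induction_on with
  | empty => simpa using hc
  | insert a s ha ih =>
    rw [Finset.sum_insert ha]
    exact norm_add_lt (h a (by simp)) (ih fun i hi => h i (by simp [hi]))

/-- Hensel's lemma for squares near 1. With r = 1 + y the equation becomes y = (a - y²)/2; since 2
is a unit, the right side maps the ball of radius ‖a‖ to itself and contracts by ‖a‖. -/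
theorem exists_sqrt_of_norm_lt_one [CompleteSpace F] (h2 : ‖(2 : F)‖ = 1) {a : F} (ha : ‖a‖ < 1) :
    ∃ r : F, ‖r - 1‖ < 1 ∧ r ^ 2 = 1 + a := by
  have h20 : (2 : F) ≠ 0 := fun h => by simp [h] at h2
  set s : Set F := Metric.closedBall 0 ‖a‖ with hs
  have hsc : IsComplete s := Metric.isClosed_closedBall.isComplete
  have hmaps : Set.MapsTo (fun y : F => (a - y ^ 2) / 2) s s := by
    intro y hy
    simp only [hs, mem_closedBall_zero_iff] at hy ⊢
    rw [norm_div, h2, div_one]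
    refine norm_sub_le_of_le le_rfl ?_
    rw [norm_pow]
    nlinarith [norm_nonneg y]
  have hc : ContractingWith ‖a‖₊ (hmaps.restrict _ s s) := by
    refine ⟨by exact_mod_cast ha, LipschitzWith.of_dist_le_mul fun x y => ?_⟩
    have hx := x.2; have hy := y.2
    simp only [hs, mem_closedBall_zero_iff] at hx hy
    change dist ((a - x.1 ^ 2) / 2) ((a - y.1 ^ 2) / 2) ≤ ‖a‖ * dist x.1 y.1
    rw [dist_eq_norm, dist_eq_norm]
    have : (a - x.1 ^ 2) / 2 - (a - y.1 ^ 2) / 2 = -((x.1 + y.1) * (x.1 - y.1) / 2) := by ring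
    rw [this, norm_neg, norm_div, h2, div_one, norm_mul]
    exact mul_le_mul_of_nonneg_right (norm_add_le_of_le hx hy) (norm_nonneg _)
  obtain ⟨y, hy, hfix, -⟩ := hc.exists_fixedPoint' hsc hmaps (x := 0) (by simp [hs])
    (edist_ne_top _ _)
  refine ⟨1 + y, ?_, ?_⟩
  · simp only [hs, mem_closedBall_zero_iff] at hy
    simpa using hy.trans_lt ha
  · have h : (a - y ^ 2) / 2 = y := hfix
    field_simp at h
    linear_combination -h

end Ultrametric

section Construction

variable {F : Type*} [NontriviallyNormedField F] [IsUltrametricDist F]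

theorem residue_eq_zero_iff_norm {x : 𝒪[F]} : IsLocalRing.residue 𝒪[F] x = 0 ↔ ‖(x : F)‖ < 1 := by
  rw [IsLocalRing.residue_eq_zero_iff, IsLocalRing.mem_maximalIdeal, mem_nonunits_iff,
    Valued.integer.isUnit_iff_norm_eq_one]
  have h := Valued.integer.norm_le_one x
  exact ⟨fun h' => lt_of_le_of_ne h h', fun h' => h'.ne⟩

theorem localFieldData [LocallyCompactSpace F]
    (hq : Odd (resCard F)) (ϖ : 𝒪[F]) (hϖ : Irreducible ϖ)
    (hnorm : ‖(ϖ : F)‖ = ((resCard F : ℕ) : ℝ)⁻¹)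
    (δ : 𝒪[F]ˣ) (hδ : ¬ IsSquare δ) :
    LocalFieldData (ϖ : F) ((δ : 𝒪[F]) : F) (resCard F) := by
  have : ProperSpace F := ProperSpace.of_locallyCompactSpace F
  have hfin : Finite 𝓀[F] := Nat.finite_of_card_ne_zero (by
    have := hq.pos; exact this.ne')
  have hcomp : CompactSpace 𝒪[F] := by
    refine isCompact_iff_compactSpace.mp ?_
    have : ((𝒪[F] : Subring F) : Set F) = Metric.closedBall 0 1 := by
      ext x; simpa using Valued.integer.mem_iff
    rw [this]; exact isCompact_closedBall 0 1
  have : IsDiscreteValuationRing 𝒪[F] :=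
    have : (Valued.v : Valuation F NNReal).IsNontrivial :=
      inferInstanceAs (NormedField.valuation (K := F)).IsNontrivial
    Valued.integer.isDiscreteValuationRing_of_compactSpace
  have hlt : ‖(ϖ : F)‖ < 1 := Valued.integer.norm_irreducible_lt_one hϖ
  have hpos : 0 < ‖(ϖ : F)‖ := Valued.integer.norm_irreducible_pos hϖ
  have hres : ∀ {x : 𝒪[F]}, IsLocalRing.residue 𝒪[F] x = 0 ↔ ‖(x : F)‖ < 1 :=
    residue_eq_zero_iff_norm
  -- Odd residue cardinality excludes residue characteristic 2, which makes 2 a unit of 𝔬.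
  have hcast : (2 : 𝓀[F]) ≠ 0 := by
    have := Fintype.ofFinite 𝓀[F]
    have h : ringChar 𝓀[F] ≠ 2 := by
      intro h
      have := FiniteField.even_card_of_char_two h
      rw [← Nat.card_eq_fintype_card] at this
      exact Nat.not_even_iff_odd.mpr hq (Nat.even_iff.mpr this)
    exact Ring.two_ne_zero h
  have h2 : ‖(2 : F)‖ = 1 := by
    by_contra h
    have h' : ‖((2 : 𝒪[F]) : F)‖ < 1 := lt_of_le_of_ne (Valued.integer.norm_le_one 2) h
    rw [← hres, map_ofNat] at h'
    exact hcast h'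
  have hsq : ∀ a : F, ‖a‖ < 1 → ∃ r : F, ‖r - 1‖ < 1 ∧ r ^ 2 = 1 + a := fun a ha =>
    exists_sqrt_of_norm_lt_one h2 ha
  -- a unit close to the square of a unit is such a square
  have hclose : ∀ u v : F, ‖v‖ = 1 → ‖v ^ 2 - u‖ < 1 → ∃ w, ‖w‖ = 1 ∧ w ^ 2 = u := by
    intro u v hv huv
    have hv0 : v ≠ 0 := fun h => by simp [h] at hv
    obtain ⟨r, hr, hr2⟩ := hsq ((u - v ^ 2) / v ^ 2) (by
      rw [norm_div, norm_pow, hv, one_pow, div_one, norm_sub_rev]; exact huv)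
    refine ⟨v * r, ?_, ?_⟩
    · rw [norm_mul, hv, one_mul, norm_eq_of_sub_lt (y := 1) (by simpa using hr), norm_one]
    · rw [mul_pow, hr2]; field_simp; ring
  have hδn : ‖((δ : 𝒪[F]) : F)‖ = 1 := Valued.integer.norm_coe_unit δ
  have hns : ∀ v : F, ‖v‖ = 1 → 1 ≤ ‖v ^ 2 - ((δ : 𝒪[F]) : F)‖ := by
    intro v hv
    by_contra! h
    obtain ⟨w, hw, hw2⟩ := hclose _ v hv h
    have hwu : IsUnit (⟨w, Valued.integer.mem_iff.mpr hw.le⟩ : 𝒪[F]) :=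
      Valued.integer.isUnit_iff_norm_eq_one.mpr hw
    refine hδ ⟨hwu.unit, ?_⟩
    ext
    simp [← hw2, pow_two]
  refine ⟨?_, hnorm, ?_, h2, hδn, hsq, ?_, hns, ?_⟩
  · have : (1 : ℝ) < resCard F := by
      rw [hnorm] at hlt hpos
      rw [inv_pos] at hpos
      exact (inv_lt_one₀ hpos).mp hlt
    exact_mod_cast this
  · have key : ∀ x : F, x ≠ 0 → ‖x‖ ≤ 1 → ∃ k : ℤ, ‖x‖ = ‖(ϖ : F)‖ ^ k := by
      intro x hx hx1
      obtain ⟨k, u, hu⟩ := IsDiscreteValuationRing.eq_unit_mul_pow_irreducible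
        (x := (⟨x, Valued.integer.mem_iff.mpr hx1⟩ : 𝒪[F]))
        (by simpa [Subtype.ext_iff] using hx) hϖ
      refine ⟨k, ?_⟩
      have hu' : x = (u : 𝒪[F]) * (ϖ : F) ^ k := congrArg Subtype.val hu
      rw [hu', norm_mul, Valued.integer.norm_coe_unit, one_mul, norm_pow, zpow_natCast]
    intro x hx
    rcases le_total ‖x‖ 1 with h | h
    · exact key x hx h
    · obtain ⟨k, hk⟩ := key x⁻¹ (inv_ne_zero hx) (by rw [norm_inv]; exact inv_le_one_of_one_le₀ h)
      refine ⟨-k, ?_⟩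
      rw [_root_.zpow_neg, ← hk, norm_inv, inv_inv]
  · intro u hu
    have := Fintype.ofFinite 𝓀[F]
    let u' : 𝒪[F] := ⟨u, Valued.integer.mem_iff.mpr hu.le⟩
    have hu0 : IsLocalRing.residue 𝒪[F] u' ≠ 0 := fun h => (hres.mp h).ne hu
    have hδ0 : IsLocalRing.residue 𝒪[F] δ ≠ 0 := fun h => (hres.mp h).ne hδn
    have lift : ∀ z : 𝒪[F], ‖(z : F)‖ = 1 → IsSquare (IsLocalRing.residue 𝒪[F] z) →
        ∃ w : F, ‖w‖ = 1 ∧ w ^ 2 = z := by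
      rintro z hz ⟨y, hy⟩
      obtain ⟨y, rfl⟩ := IsLocalRing.residue_surjective y
      have hy' : ‖(y ^ 2 - z : F)‖ < 1 := by
        have : IsLocalRing.residue 𝒪[F] (y ^ 2 - z) = 0 := by rw [map_sub, map_pow, hy]; ring
        exact hres.mp this
      refine hclose z y ?_ hy'
      have h1 : ‖(y ^ 2 : F)‖ = 1 := by rw [norm_eq_of_sub_lt (y := (z : F)) (by rwa [hz]), hz]
      rw [norm_pow] at h1
      exact (pow_eq_one_iff_of_nonneg (norm_nonneg _) two_ne_zero).mp h1
    have hne : u ≠ 0 := fun h => by simp [h] at hu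
    by_cases hsu : IsSquare (IsLocalRing.residue 𝒪[F] u')
    · obtain ⟨w, hw, hw2⟩ := lift u' hu hsu
      have hw0 : w ≠ 0 := fun h => by simp [h] at hw
      refine ⟨w⁻¹, by simp [hw], Or.inl ?_⟩
      rw [← show w ^ 2 = u from hw2]; field_simp
    · have hsδ : ¬ IsSquare (IsLocalRing.residue 𝒪[F] δ) := by
        intro h
        obtain ⟨w, hw, hw2⟩ := lift δ hδn h
        have := hns w hw
        rw [hw2, sub_self, norm_zero] at this
        linarith
      -- In a finite field the product of two non-squares is a square, by multiplicativity of the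
      -- quadratic character; so δu lifts to a square and v = w/u turns u into δ.
      have hprod : IsSquare (IsLocalRing.residue 𝒪[F] ((δ : 𝒪[F]) * u')) := by
        classical
        rw [map_mul]
        by_contra h
        have h1 := quadraticChar_neg_one_iff_not_isSquare.mpr hsu
        have h2 := quadraticChar_neg_one_iff_not_isSquare.mpr hsδ
        have h3 := quadraticChar_neg_one_iff_not_isSquare.mpr h
        rw [map_mul, h1, h2] at h3
        norm_num at h3
      obtain ⟨w, hw, hw2⟩ := lift _ (by
        change ‖((δ : 𝒪[F]) : F) * u‖ = 1
        rw [norm_mul, hδn, hu, one_mul]) hprod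
      have hw2' : w ^ 2 = ((δ : 𝒪[F]) : F) * u := hw2
      refine ⟨w / u, by rw [norm_div, hw, hu, div_one], Or.inr ?_⟩
      rw [div_pow, hw2']; field_simp
  · classical
    have := Fintype.ofFinite 𝓀[F]
    let ρ : 𝓀[F] → 𝒪[F] := Function.surjInv IsLocalRing.residue_surjective
    have hρ : ∀ y, IsLocalRing.residue 𝒪[F] (ρ y) = y :=
      Function.surjInv_eq IsLocalRing.residue_surjective
    refine ⟨Finset.univ.image fun y => (ρ y : F), ?_, ?_, ?_, ?_⟩
    · rw [Finset.card_image_of_injective, Finset.card_univ, resCard, Nat.card_eq_fintype_card]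
      intro y z hyz
      rw [← hρ y, ← hρ z, Subtype.ext hyz]
    · intro r hr
      obtain ⟨y, -, rfl⟩ := Finset.mem_image.mp hr
      exact Valued.integer.norm_le_one (ρ y)
    · intro x hx
      refine ⟨_, Finset.mem_image_of_mem _ (Finset.mem_univ
        (IsLocalRing.residue 𝒪[F] ⟨x, Valued.integer.mem_iff.mpr hx⟩)), ?_⟩
      refine (hres (x := (⟨x, Valued.integer.mem_iff.mpr hx⟩ - ρ _))).mp ?_
      rw [map_sub, hρ, sub_self]
    · intro r hr r' hr' hrr
      obtain ⟨y, -, rfl⟩ := Finset.mem_image.mp hr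
      obtain ⟨z, -, rfl⟩ := Finset.mem_image.mp hr'
      have h : IsLocalRing.residue 𝒪[F] (ρ y - ρ z) = 0 := hres.mpr hrr
      rw [map_sub, hρ, hρ, sub_eq_zero] at h
      rw [h]

end Construction

section Character

variable {F : Type*} [NontriviallyNormedField F] [IsUltrametricDist F]

theorem HasOrderZero.eq_one {ϖ : 𝒪[F]} {ψ : AddChar F Circle} (hψ : HasOrderZero ϖ ψ) {x : F}
    (hx : ‖x‖ ≤ 1) : ψ x = 1 :=
  hψ.1 ⟨x, Valued.integer.mem_iff.mpr hx⟩

/-- Since ‖y‖ > 1 forces ‖y‖ ≥ ‖ϖ‖⁻¹, the quotient of a witness in 𝔭⁻¹ by y is still integral. This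
is the source of all cancellation in the character sums. -/
theorem HasOrderZero.exists_ne_one {ϖ : 𝒪[F]} {ψ : AddChar F Circle} (hψ : HasOrderZero ϖ ψ)
    {δ : F} {q : ℕ} (hF : LocalFieldData (ϖ : F) δ q) {y : F} (hy : 1 < ‖y‖) :
    ∃ x : F, ‖x‖ ≤ 1 ∧ ψ (y * x) ≠ 1 := by
  obtain ⟨z, hz⟩ := hψ.2
  have hy0 : y ≠ 0 := fun h => by simp [h] at hy; linarith
  have hpos := hF.norm_pos
  have hlt := hF.norm_lt_one
  refine ⟨y⁻¹ * ((ϖ : F)⁻¹ * z), ?_, by rwa [mul_inv_cancel_left₀ hy0]⟩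
  obtain ⟨k, hk⟩ := hF.discrete y hy0
  have hk0 : k < 0 := by
    by_contra! h
    rw [hk] at hy
    exact absurd (zpow_le_one₀ hpos hlt.le h) (not_le.mpr hy)
  rw [norm_mul, norm_mul, norm_inv, norm_inv, hk, ← _root_.zpow_neg, ← _root_.zpow_neg_one, ← mul_assoc,
    ← zpow_add₀ hpos.ne']
  refine mul_le_one₀ (zpow_le_one₀ hpos hlt.le (by omega)) (norm_nonneg _) ?_
  exact Valued.integer.norm_le_one z

end Character

end RamifiedSiegel

/-! ### Integral matrices and the group Γ₀. -/

namespace RamifiedSiegel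

section Integral

variable {F : Type*} [NontriviallyNormedField F] [IsUltrametricDist F] {n : ℕ}

/-- The entries of `M` have norm at most `c`. -/
def EntryLE (M : Matrix (Fin n) (Fin n) F) (c : ℝ) : Prop := ∀ i j, ‖M i j‖ ≤ c

/-- The entries of `M` have norm less than `c`. -/
def EntryLT (M : Matrix (Fin n) (Fin n) F) (c : ℝ) : Prop := ∀ i j, ‖M i j‖ < c

variable {M N γ η : Matrix (Fin n) (Fin n) F} {c d : ℝ}

theorem EntryLT.le (h : EntryLT M c) : EntryLE M c := fun i j => (h i j).le

theorem EntryLE.transpose (h : EntryLE M c) : EntryLE Mᵀ c := fun i j => h j i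

theorem EntryLT.transpose (h : EntryLT M c) : EntryLT Mᵀ c := fun i j => h j i

theorem EntryLE.mul (hd : 0 ≤ d) (hc : 0 ≤ c) (h : EntryLE M c) (h' : EntryLE N d) :
    EntryLE (M * N) (c * d) := fun i j => by
  rw [Matrix.mul_apply]
  refine norm_sum_le_of_le (by positivity) fun k _ => ?_
  rw [norm_mul]
  exact mul_le_mul (h i k) (h' k j) (norm_nonneg _) hc

theorem EntryLE.mul_one_right (hc : 0 ≤ c) (h : EntryLE M c) (h' : EntryLE N 1) :
    EntryLE (M * N) c := by
  simpa using EntryLE.mul zero_le_one hc h h'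

theorem EntryLE.mul_one_left (hc : 0 ≤ c) (h : EntryLE M 1) (h' : EntryLE N c) :
    EntryLE (M * N) c := by
  simpa using EntryLE.mul hc zero_le_one h h'

theorem EntryLT.mul_one_right (hc : 0 < c) (h : EntryLT M c) (h' : EntryLE N 1) :
    EntryLT (M * N) c := fun i j => by
  rw [Matrix.mul_apply]
  refine norm_sum_lt_of_lt hc fun k _ => ?_
  rw [norm_mul]
  exact (mul_le_of_le_one_right (norm_nonneg _) (h' k j)).trans_lt (h i k)

theorem EntryLT.mul_one_left (hc : 0 < c) (h : EntryLE M 1) (h' : EntryLT N c) :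
    EntryLT (M * N) c := fun i j => by
  rw [Matrix.mul_apply]
  refine norm_sum_lt_of_lt hc fun k _ => ?_
  rw [norm_mul]
  exact (mul_le_of_le_one_left (norm_nonneg _) (h i k)).trans_lt (h' k j)

theorem EntryLE.add (h : EntryLE M c) (h' : EntryLE N c) : EntryLE (M + N) c := fun i j =>
  norm_add_le_of_le (h i j) (h' i j)

theorem EntryLT.add (h : EntryLT M c) (h' : EntryLT N c) : EntryLT (M + N) c := fun i j =>
  norm_add_lt (h i j) (h' i j)

theorem EntryLE.neg (h : EntryLE M c) : EntryLE (-M) c := fun i j => by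
  rw [Matrix.neg_apply, norm_neg]; exact h i j

theorem EntryLT.neg (h : EntryLT M c) : EntryLT (-M) c := fun i j => by
  rw [Matrix.neg_apply, norm_neg]; exact h i j

theorem entryLE_one : EntryLE (1 : Matrix (Fin n) (Fin n) F) 1 := fun i j => by
  rw [Matrix.one_apply]; split_ifs <;> simp

theorem exists_entryLE (M : Matrix (Fin n) (Fin n) F) : ∃ c : ℝ, 0 < c ∧ EntryLE M c := by
  refine ⟨1 + ∑ i, ∑ j, ‖M i j‖, by positivity, fun i j => ?_⟩
  have h1 : ‖M i j‖ ≤ ∑ j, ‖M i j‖ :=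
    Finset.single_le_sum (f := fun j => ‖M i j‖) (fun _ _ => norm_nonneg _) (Finset.mem_univ j)
  have h2 : ∑ j, ‖M i j‖ ≤ ∑ i, ∑ j, ‖M i j‖ :=
    Finset.single_le_sum (f := fun i => ∑ j, ‖M i j‖)
      (fun _ _ => Finset.sum_nonneg fun _ _ => norm_nonneg _) (Finset.mem_univ i)
  linarith

theorem norm_det_le_one (h : EntryLE M 1) : ‖M.det‖ ≤ 1 := by
  rw [Matrix.det_apply]
  refine norm_sum_le_of_le zero_le_one fun σ _ => ?_
  rw [Units.smul_def, zsmul_eq_mul, norm_mul, norm_prod]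
  refine mul_le_one₀ ?_ (Finset.prod_nonneg fun _ _ => norm_nonneg _)
    (Finset.prod_le_one (fun _ _ => norm_nonneg _) fun i _ => h _ _)
  rcases Int.units_eq_one_or (Equiv.Perm.sign σ) with h | h <;> simp [h]

/-- A permutation other than the identity raises some index i, so its term contains the entry (σ i,
i) below the diagonal, which lies in 𝔭. -/
theorem norm_det_sub_prod_diag_lt_one (h : EntryLE M 1) (hl : ∀ i j, j < i → ‖M i j‖ < 1) :
    ‖M.det - ∏ i, M i i‖ < 1 := by
  rw [Matrix.det_apply, ← Finset.add_sum_erase _ _ (Finset.mem_univ (1 : Equiv.Perm (Fin n)))]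
  simp only [Equiv.Perm.sign_one, one_smul, Equiv.Perm.coe_one, id_eq, add_sub_cancel_left]
  refine norm_sum_lt_of_lt zero_lt_one fun σ hσ => ?_
  have hσ1 : σ ≠ 1 := Finset.ne_of_mem_erase hσ
  obtain ⟨i, hi⟩ : ∃ i, i < σ i := by
    by_contra! hle
    refine hσ1 (Equiv.ext fun i => ?_)
    induction i using WellFoundedLT.induction with
    | ind i ih =>
      by_contra hne
      have hlt : σ i < i := lt_of_le_of_ne (hle i) hne
      exact hlt.ne (σ.injective (ih _ hlt))
  rw [Units.smul_def, zsmul_eq_mul, norm_mul, norm_prod,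
    ← Finset.mul_prod_erase _ _ (Finset.mem_univ i)]
  have h1 : ‖((Equiv.Perm.sign σ : ℤ) : F)‖ ≤ 1 := by
    rcases Int.units_eq_one_or (Equiv.Perm.sign σ) with h | h <;> simp [h]
  have h2 : ∏ j ∈ Finset.univ.erase i, ‖M (σ j) j‖ ≤ 1 :=
    Finset.prod_le_one (fun _ _ => norm_nonneg _) fun i _ => h _ _
  have h3 : 0 ≤ ∏ j ∈ Finset.univ.erase i, ‖M (σ j) j‖ :=
    Finset.prod_nonneg fun _ _ => norm_nonneg _
  calc _ ≤ 1 * (‖M (σ i) i‖ * 1) := by gcongr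
    _ < 1 := by simpa using hl _ _ hi

theorem norm_prod_add_sub_prod_lt_one {ι : Type*} (s : Finset ι) (a e : ι → F)
    (ha : ∀ i, ‖a i‖ ≤ 1) (he : ∀ i, ‖e i‖ < 1) :
    ‖∏ i ∈ s, (a i + e i) - ∏ i ∈ s, a i‖ < 1 := by
  classical
  induction s using Finset.induction_on with
  | empty => simp
  | insert i s hi ih =>
    rw [Finset.prod_insert hi, Finset.prod_insert hi]
    have hp : ‖∏ i ∈ s, (a i + e i)‖ ≤ 1 := by
      rw [norm_prod]
      exact Finset.prod_le_one (fun _ _ => norm_nonneg _) fun i _ =>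
        norm_add_le_of_le (ha i) (he i).le
    have : (a i + e i) * ∏ i ∈ s, (a i + e i) - a i * ∏ i ∈ s, a i
        = e i * ∏ i ∈ s, (a i + e i) + a i * (∏ i ∈ s, (a i + e i) - ∏ i ∈ s, a i) := by ring
    rw [this]
    refine norm_add_lt ?_ ?_
    · rw [norm_mul]; exact (mul_le_of_le_one_right (norm_nonneg _) hp).trans_lt (he i)
    · rw [norm_mul]; exact (mul_le_of_le_one_left (norm_nonneg _) (ha i)).trans_lt ih

/-- The determinant is an integral polynomial and so respects congruence modulo 𝔭. This serves both
to keep perturbed matrices invertible and to compare values of `ω`. -/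
theorem norm_det_add_sub_det_lt_one (h : EntryLE M 1) (h' : EntryLT N 1) :
    ‖(M + N).det - M.det‖ < 1 := by
  rw [Matrix.det_apply, Matrix.det_apply, ← Finset.sum_sub_distrib]
  refine norm_sum_lt_of_lt zero_lt_one fun σ _ => ?_
  rw [← smul_sub, Units.smul_def, zsmul_eq_mul, norm_mul]
  have h1 : ‖((Equiv.Perm.sign σ : ℤ) : F)‖ ≤ 1 := by
    rcases Int.units_eq_one_or (Equiv.Perm.sign σ) with h | h <;> simp [h]
  refine (mul_le_of_le_one_left (norm_nonneg _) h1).trans_lt ?_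
  exact norm_prod_add_sub_prod_lt_one _ _ _ (fun i => h _ _) fun i => h' _ _

theorem EntryLE.inv (h : EntryLE M 1) (hdet : ‖M.det‖ = 1) : EntryLE M⁻¹ 1 := fun i j => by
  rw [Matrix.inv_def, Matrix.smul_apply, smul_eq_mul, norm_mul, Ring.inverse_eq_inv', norm_inv,
    hdet, inv_one, one_mul, Matrix.adjugate_apply]
  refine norm_det_le_one fun a b => ?_
  rw [Matrix.updateRow_apply]
  split_ifs
  · rw [Pi.single_apply]; split_ifs <;> simp
  · exact h a b

theorem isUnit_det_of_norm (hdet : ‖M.det‖ = 1) : IsUnit M.det :=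
  isUnit_iff_ne_zero.mpr fun h => by simp [h] at hdet

end Integral

section Gamma0

variable {F : Type*} [NontriviallyNormedField F] [IsUltrametricDist F] {n : ℕ}
  {M γ η : Matrix (Fin n) (Fin n) F}

/-- Modulo 𝔭 the matrix is upper triangular, so its determinant is a unit exactly when every
diagonal entry is. -/
theorem mem_Gamma0_iff : γ ∈ Gamma0 n F ↔
    EntryLE γ 1 ∧ (∀ i, ‖γ i i‖ = 1) ∧ ∀ i j, j < i → ‖γ i j‖ < 1 := by
  constructor
  · rintro ⟨h1, h2, h3⟩
    refine ⟨h1, fun i => ?_, h3⟩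
    have hp : ‖∏ i, γ i i‖ = 1 := by
      rw [← h2]
      refine norm_eq_of_sub_lt ?_
      rw [h2, norm_sub_rev]
      exact norm_det_sub_prod_diag_lt_one h1 h3
    rw [norm_prod, ← Finset.mul_prod_erase _ _ (Finset.mem_univ i)] at hp
    refine le_antisymm (h1 i i) ?_
    rw [← hp]
    exact mul_le_of_le_one_right (norm_nonneg _)
      (Finset.prod_le_one (fun _ _ => norm_nonneg _) fun i _ => h1 _ _)
  · rintro ⟨h1, h2, h3⟩
    refine ⟨h1, ?_, h3⟩
    have hp : ‖∏ i, γ i i‖ = 1 := by rw [norm_prod]; exact Finset.prod_eq_one fun i _ => h2 i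
    rw [← hp]
    refine norm_eq_of_sub_lt ?_
    rw [hp]
    exact norm_det_sub_prod_diag_lt_one h1 h3

theorem one_mem_Gamma0 : (1 : Matrix (Fin n) (Fin n) F) ∈ Gamma0 n F :=
  ⟨entryLE_one, by simp, fun i j h => by simp [h.ne']⟩

theorem mul_mem_Gamma0 (hγ : γ ∈ Gamma0 n F) (hη : η ∈ Gamma0 n F) : γ * η ∈ Gamma0 n F := by
  refine ⟨EntryLE.mul_one_left zero_le_one hγ.1 hη.1, ?_, fun i j hij => ?_⟩
  · rw [Matrix.det_mul, norm_mul, hγ.2.1, hη.2.1, one_mul]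
  · rw [Matrix.mul_apply]
    refine norm_sum_lt_of_lt zero_lt_one fun k _ => ?_
    rw [norm_mul]
    rcases lt_or_ge k i with h | h
    · exact (mul_le_of_le_one_right (norm_nonneg _) (hη.1 k j)).trans_lt (hγ.2.2 i k h)
    · exact (mul_le_of_le_one_left (norm_nonneg _) (hγ.1 i k)).trans_lt
        (hη.2.2 k j (hij.trans_le h))

theorem inv_mem_Gamma0 (hγ : γ ∈ Gamma0 n F) : γ⁻¹ ∈ Gamma0 n F := by
  have hu := isUnit_det_of_norm hγ.2.1
  have hint : EntryLE γ⁻¹ 1 := EntryLE.inv hγ.1 hγ.2.1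
  have hdiag := (mem_Gamma0_iff.mp hγ).2.1
  refine ⟨hint, ?_, fun i j => ?_⟩
  · rw [Matrix.det_nonsing_inv, Ring.inverse_eq_inv', norm_inv, hγ.2.1, inv_one]
  -- Induction on the column: the (i, j) entry of γ⁻¹γ = 1 is solved for γ⁻¹ i j · γ j j. Terms with
  -- k < j are small by induction, those with k > j because γ k j is below the diagonal.
  · induction j using WellFoundedLT.induction with
    | ind j ih =>
      intro hij
      have h0 : (γ⁻¹ * γ) i j = 0 := by
        rw [Matrix.nonsing_inv_mul _ hu, Matrix.one_apply_ne hij.ne']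
      rw [Matrix.mul_apply, ← Finset.add_sum_erase _ _ (Finset.mem_univ j)] at h0
      have h1 : ‖γ⁻¹ i j * γ j j‖ < 1 := by
        rw [eq_neg_of_add_eq_zero_left h0, norm_neg]
        refine norm_sum_lt_of_lt zero_lt_one fun k hk => ?_
        rw [norm_mul]
        rcases lt_or_gt_of_ne (Finset.ne_of_mem_erase hk) with h | h
        · exact (mul_le_of_le_one_right (norm_nonneg _) (hγ.1 k j)).trans_lt
            (ih k h (h.trans hij))
        · exact (mul_le_of_le_one_left (norm_nonneg _) (hint i k)).trans_lt (hγ.2.2 k j h)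
      rwa [norm_mul, hdiag, mul_one] at h1

theorem add_mem_Gamma0 (hγ : γ ∈ Gamma0 n F) (hM : EntryLT M 1) : γ + M ∈ Gamma0 n F := by
  have h := mem_Gamma0_iff.mp hγ
  refine mem_Gamma0_iff.mpr ⟨h.1.add hM.le, fun i => ?_, fun i j hij => ?_⟩
  · rw [← h.2.1 i]
    refine norm_eq_of_sub_lt ?_
    rw [Matrix.add_apply, add_sub_cancel_left, h.2.1 i]
    exact hM i i
  · exact norm_add_lt (h.2.2 i j hij) (hM i j)

/-- Symmetric matrices in the same `Γ₀`-orbit. -/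
def Gamma0Equiv (X Y : Matrix (Fin n) (Fin n) F) : Prop := ∃ γ ∈ Gamma0 n F, Y = γ * X * γᵀ

theorem Gamma0Equiv.trans {X Y Z : Matrix (Fin n) (Fin n) F} (h : Gamma0Equiv X Y)
    (h' : Gamma0Equiv Y Z) : Gamma0Equiv X Z := by
  obtain ⟨γ, hγ, rfl⟩ := h
  obtain ⟨η, hη, rfl⟩ := h'
  exact ⟨η * γ, mul_mem_Gamma0 hη hγ, by simp only [Matrix.transpose_mul, Matrix.mul_assoc]⟩

theorem inv_mul_mul_inv_transpose (hγ : γ ∈ Gamma0 n F) (X : Matrix (Fin n) (Fin n) F) :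
    γ⁻¹ * (γ * X * γᵀ) * γ⁻¹ᵀ = X := by
  have hu := isUnit_det_of_norm hγ.2.1
  rw [Matrix.mul_assoc γ X, Matrix.nonsing_inv_mul_cancel_left _ _ hu, Matrix.mul_assoc,
    ← Matrix.transpose_mul, Matrix.nonsing_inv_mul _ hu, Matrix.transpose_one, Matrix.mul_one]

theorem Gamma0Equiv.symm {X Y : Matrix (Fin n) (Fin n) F} (h : Gamma0Equiv X Y) :
    Gamma0Equiv Y X := by
  obtain ⟨γ, hγ, rfl⟩ := h
  exact ⟨γ⁻¹, inv_mem_Gamma0 hγ, (inv_mul_mul_inv_transpose hγ X).symm⟩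

theorem Gamma0Equiv.norm_det {X Y : Matrix (Fin n) (Fin n) F} (h : Gamma0Equiv X Y) :
    ‖Y.det‖ = ‖X.det‖ := by
  obtain ⟨γ, hγ, rfl⟩ := h
  simp [hγ.2.1]

theorem Gamma0Equiv.isSymm {X Y : Matrix (Fin n) (Fin n) F} (h : Gamma0Equiv X Y)
    (hX : X.IsSymm) : Y.IsSymm := by
  obtain ⟨γ, hγ, rfl⟩ := h
  rw [Matrix.IsSymm, Matrix.transpose_mul, Matrix.transpose_mul, Matrix.transpose_transpose, hX.eq,
    Matrix.mul_assoc]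

end Gamma0

end RamifiedSiegel

/-! ### Reduction of symmetric matrices to monomial form under Γ₀. -/

namespace RamifiedSiegel

section Reduction

variable {F : Type*} [NontriviallyNormedField F] [IsUltrametricDist F] {n : ℕ}
  {X : Matrix (Fin n) (Fin n) F} {ϖ δ : F} {q : ℕ}

/-- The effect on a symmetric matrix of adding `c k` times row `i` to row `k` for all `k`, and
likewise for the columns. -/
def congrOp (c : Fin n → F) (i : Fin n) (X : Matrix (Fin n) (Fin n) F) :
    Matrix (Fin n) (Fin n) F :=
  Matrix.of fun k l => X k l + c k * X i l + c l * X k i + c k * c l * X i i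

theorem congrOp_apply (c : Fin n → F) (i : Fin n) (X : Matrix (Fin n) (Fin n) F) (k l : Fin n) :
    congrOp c i X k l = X k l + c k * X i l + c l * X k i + c k * c l * X i i := rfl

/-- Row i may be added to earlier rows with any integral coefficient, but to later rows only with a
coefficient in 𝔭. This asymmetry dictates the choice of pivots below. -/
theorem gamma0Equiv_congrOp {c : Fin n → F} {i : Fin n} (h1 : ∀ k, ‖c k‖ ≤ 1)
    (h2 : ‖1 + c i‖ = 1) (h3 : ∀ k, i < k → ‖c k‖ < 1) (X : Matrix (Fin n) (Fin n) F) :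
    Gamma0Equiv X (congrOp c i X) := by
  let N : Matrix (Fin n) (Fin n) F := Matrix.of fun k l => if l = i then c k else 0
  refine ⟨1 + N, mem_Gamma0_iff.mpr ⟨fun k l => ?_, fun k => ?_, fun k l hkl => ?_⟩, ?_⟩
  · refine norm_add_le_of_le (entryLE_one k l) ?_
    simp only [N, Matrix.of_apply]
    split_ifs
    · exact h1 k
    · simp
  · simp only [N, Matrix.of_apply, Matrix.add_apply, Matrix.one_apply_eq]
    split_ifs with h
    · rwa [h]
    · simp
  · simp only [N, Matrix.of_apply, Matrix.add_apply, Matrix.one_apply_ne hkl.ne', zero_add]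
    split_ifs with h
    · exact h3 k (h ▸ hkl)
    · simp
  · have hN : ∀ (Y : Matrix (Fin n) (Fin n) F) k l, (N * Y) k l = c k * Y i l := by
      intro Y k l; simp [N, Matrix.mul_apply]
    have hN' : ∀ (Y : Matrix (Fin n) (Fin n) F) k l, (Y * Nᵀ) k l = c l * Y k i := by
      intro Y k l; simp [N, Matrix.mul_apply, mul_comm]
    ext k l
    rw [Matrix.transpose_add, Matrix.transpose_one, Matrix.add_mul, Matrix.one_mul, Matrix.mul_add,
      Matrix.mul_one, Matrix.add_apply, hN', Matrix.add_apply, Matrix.add_apply, hN, hN,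
      congrOp_apply]
    ring

/-- `X` agrees with the representative of `x` on the rows and columns in `D`, and the involution
of `x` is trivial off `D`. -/
structure PartlyReduced (ϖ δ : F) (X : Matrix (Fin n) (Fin n) F) (D : Finset (Fin n))
    (x : Equiv.Perm (Fin n) × (Fin n → ℤ) × (Fin n → F)) : Prop where
  symm : ∀ k l, X k l = X l k
  mem : x ∈ Lam n δ
  fix : ∀ k ∉ D, x.1 k = k
  eq : ∀ k l, k ∈ D → X k l = repS ϖ x k l

namespace PartlyReduced

variable {D : Finset (Fin n)} {x : Equiv.Perm (Fin n) × (Fin n → ℤ) × (Fin n → F)}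

theorem cross (h : PartlyReduced ϖ δ X D x) {k l : Fin n} (hk : k ∈ D) (hl : l ∉ D) :
    X k l = 0 := by
  rw [h.eq k l hk, repS, Matrix.of_apply, h.fix l hl, if_neg]
  rintro rfl; exact hl hk

theorem congrOp (h : PartlyReduced ϖ δ X D x) {c : Fin n → F} {i : Fin n} (hi : i ∉ D)
    (hc : ∀ k ∈ D, c k = 0) : PartlyReduced ϖ δ (congrOp c i X) D x where
  symm k l := by
    rw [congrOp_apply, congrOp_apply, h.symm k l, h.symm k i, h.symm l i]; ring
  mem := h.mem
  fix := h.fix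
  eq k l hk := by
    rw [congrOp_apply, hc k hk, h.cross hk hi, h.eq k l hk]; ring

end PartlyReduced

/-- Scaling a row and its column by a unit v multiplies the diagonal entry by v², so only the square
class of its unit part survives. -/
theorem LocalFieldData.exists_unit_sq_mul (hF : LocalFieldData ϖ δ q) {a : F} (ha : a ≠ 0) :
    ∃ v : F, ‖v‖ = 1 ∧ ∃ h : ℤ, ∃ ε : F, (ε = 1 ∨ ε = δ) ∧ v ^ 2 * a = ε * ϖ ^ h := by
  obtain ⟨h, hh⟩ := hF.discrete a ha
  have hϖ := hF.ne_zero
  obtain ⟨v, hv, hv'⟩ := hF.unit_class (a / ϖ ^ h) (by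
    rw [norm_div, norm_zpow, hh, div_self (zpow_ne_zero _ hF.norm_pos.ne')])
  have hz : ϖ ^ h ≠ 0 := zpow_ne_zero _ hϖ
  refine ⟨v, hv, h, v ^ 2 * (a / ϖ ^ h), hv', ?_⟩
  field_simp

/-- Completing a partly reduced matrix by a `1 × 1` block. -/
theorem PartlyReduced.exists_insert (hF : LocalFieldData ϖ δ q) {D : Finset (Fin n)}
    {x : Equiv.Perm (Fin n) × (Fin n → ℤ) × (Fin n → F)} (h : PartlyReduced ϖ δ X D x)
    {i : Fin n} (hi : i ∉ D) (hii : X i i ≠ 0) (hmax : ∀ k ∉ D, ‖X k i‖ ≤ ‖X i i‖)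
    (hlt : ∀ k ∉ D, i < k → ‖X k i‖ < ‖X i i‖) :
    ∃ Y x', Gamma0Equiv X Y ∧ PartlyReduced ϖ δ Y (insert i D) x' := by
  obtain ⟨v, hv, e, ε, hε, hve⟩ := hF.exists_unit_sq_mul hii
  have hpos : 0 < ‖X i i‖ := norm_pos_iff.mpr hii
  -- The coefficient v - 1 at i scales row i by v; the others clear column i. The resulting
  -- off-diagonal entry in row i is v (X i l + c l · X i i) = 0.
  let c : Fin n → F := fun k => if k = i then v - 1 else -(X k i / X i i)
  have hcD : ∀ k ∈ D, c k = 0 := by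
    intro k hk
    have hki : k ≠ i := by rintro rfl; exact hi hk
    simp [c, hki, h.cross hk hi]
  have hci : c i = v - 1 := by simp [c]
  have hc : ∀ k, k ≠ i → c k = -(X k i / X i i) := fun k hk => by simp [c, hk]
  have h' := h.congrOp hi hcD
  have hrow : ∀ l, RamifiedSiegel.congrOp c i X i l = if l = i then ε * ϖ ^ e else 0 := by
    intro l
    rw [congrOp_apply, hci]
    split_ifs with hl
    · rw [hl, hci, ← hve]; ring
    · rw [hc l hl, h.symm i l]; field_simp; ring
  refine ⟨_, (x.1, Function.update x.2.1 i e, Function.update x.2.2 i ε),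
    gamma0Equiv_congrOp ?_ ?_ ?_ X, h'.symm, ⟨h.mem.1, ?_, ?_, ?_⟩, ?_, ?_⟩
  · intro k
    by_cases hk : k = i
    · rw [hk, hci]; exact norm_sub_le_of_le hv.le (by simp)
    · by_cases hkD : k ∈ D
      · simp [hcD k hkD]
      · rw [hc k hk, norm_neg, norm_div]; exact div_le_one_of_le₀ (hmax k hkD) hpos.le
  · rw [hci]; simpa using hv
  · intro k hk
    by_cases hkD : k ∈ D
    · simp [hcD k hkD]
    · rw [hc k hk.ne', norm_neg, norm_div, div_lt_one hpos]; exact hlt k hkD hk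
  · intro k
    have hfi := h.fix i hi
    by_cases hk : k = i
    · simp [hk, hfi]
    · have : x.1 k ≠ i := fun hk' => hk (x.1.injective (hk'.trans hfi.symm))
      simp [Function.update_of_ne, hk, this, h.mem.2.1 k]
  · intro k
    by_cases hk : k = i
    · simpa [hk] using hε
    · simpa [Function.update_of_ne, hk] using h.mem.2.2.1 k
  · intro k hk
    have hki : k ≠ i := by rintro rfl; exact hk (h.fix k hi)
    simpa [Function.update_of_ne, hki] using h.mem.2.2.2 k hk
  · intro k hk
    exact h.fix k fun hk' => hk (Finset.mem_insert_of_mem hk')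
  · intro k l hk
    by_cases hki : k = i
    · subst hki
      rw [hrow, repS, Matrix.of_apply]
      have : k = x.1 l ↔ l = k := by
        constructor
        · intro hk'; exact x.1.injective (hk'.symm.trans (h.fix k hi).symm)
        · rintro rfl; exact (h.fix _ hi).symm
      simp [this]
    · have hkD : k ∈ D := by simpa [hki] using hk
      rw [h'.eq k l hkD]
      simp [repS, Function.update_of_ne, hki]

/-- The situation of a `2 × 2` pivot in rows `j < i`. -/
structure PairPivot (X : Matrix (Fin n) (Fin n) F) (D : Finset (Fin n)) (i j : Fin n) (m : ℝ) :
    Prop where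
  lt : j < i
  notMem_i : i ∉ D
  notMem_j : j ∉ D
  pos : 0 < m
  le : ∀ k ∉ D, ∀ l ∉ D, ‖X k l‖ ≤ m
  below : ∀ k ∉ D, i < k → ∀ l ∉ D, ‖X k l‖ < m
  right : ∀ l ∉ D, j < l → ‖X i l‖ < m
  pivot : ‖X i j‖ = m

namespace PairPivot

variable {D : Finset (Fin n)} {i j : Fin n} {m : ℝ}

/-- The coefficient t is a root of X j j + 2t X i j + t² X i i = 0. Its normalized discriminant 1 -
X j j X i i / (X i j)² lies in 1 + 𝔭 because ‖X i i‖ < m, so it has a square root r near 1.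
Rationalizing the root gives a formula with no division by X i i, visibly integral because 1 + r is
a unit. An integral t is allowed since j < i. -/
theorem exists_clear_upper (hF : LocalFieldData ϖ δ q) (h : PairPivot X D i j m)
    (hs : ∀ k l, X k l = X l k) :
    ∃ t : F, ‖t‖ ≤ 1 ∧ PairPivot (congrOp (Pi.single j t) i X) D i j m ∧
      congrOp (Pi.single j t) i X j j = 0 := by
  have hb : X i j ≠ 0 := norm_pos_iff.mp (h.pivot ▸ h.pos)
  have hd : ‖X i i‖ < m := h.right i h.notMem_i h.lt
  have ha : ‖X j j‖ ≤ m := h.le j h.notMem_j j h.notMem_j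
  obtain ⟨r, hr, hr2⟩ := hF.sqrt (-(X j j * X i i / X i j ^ 2)) (by
    rw [norm_neg, norm_div, norm_mul, norm_pow, h.pivot, div_lt_one (pow_pos h.pos 2), pow_two]
    exact mul_lt_mul_of_nonneg_of_pos' ha hd (norm_nonneg _) h.pos)
  have hr1 : ‖1 + r‖ = 1 := by
    rw [← hF.norm_two]
    refine norm_eq_of_sub_lt ?_
    rw [hF.norm_two]
    convert hr using 2; ring
  have hr0 : 1 + r ≠ 0 := fun h0 => by simp [h0] at hr1
  refine ⟨-(X j j / (X i j * (1 + r))), ?_, ?_, ?_⟩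
  · rw [norm_neg, norm_div, norm_mul, hr1, mul_one, h.pivot]
    exact div_le_one_of_le₀ ha h.pos.le
  · have ht : ‖-(X j j / (X i j * (1 + r)))‖ ≤ 1 := by
      rw [norm_neg, norm_div, norm_mul, hr1, mul_one, h.pivot]
      exact div_le_one_of_le₀ ha h.pos.le
    set t := -(X j j / (X i j * (1 + r)))
    have hc : ∀ k, ‖(Pi.single j t : Fin n → F) k‖ ≤ 1 := by
      intro k; rw [Pi.single_apply]; split_ifs
      · exact ht
      · simp
    have hmul : ∀ (a b : F), ‖a‖ ≤ 1 → ‖b‖ ≤ m → ‖a * b‖ ≤ m := fun a b ha hb => by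
      rw [norm_mul]; exact (mul_le_of_le_one_left (norm_nonneg _) ha).trans hb
    have hmul' : ∀ (a b : F), ‖a‖ ≤ 1 → ‖b‖ < m → ‖a * b‖ < m := fun a b ha hb => by
      rw [norm_mul]; exact (mul_le_of_le_one_left (norm_nonneg _) ha).trans_lt hb
    refine ⟨h.lt, h.notMem_i, h.notMem_j, h.pos, ?_, ?_, ?_, ?_⟩
    · intro k hk l hl
      rw [congrOp_apply, mul_assoc]
      exact norm_add_le_of_le (norm_add_le_of_le (norm_add_le_of_le (h.le k hk l hl)
        (hmul _ _ (hc k) (h.le _ h.notMem_i _ hl))) (hmul _ _ (hc l) (h.le _ hk _ h.notMem_i)))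
        (hmul _ _ (hc k) (hmul _ _ (hc l) hd.le))
    · intro k hk hik l hl
      rw [congrOp_apply, Pi.single_eq_of_ne (h.lt.trans hik).ne', zero_mul, zero_mul, zero_mul,
        add_zero, add_zero]
      exact norm_add_lt (h.below k hk hik l hl) (hmul' _ _ (hc l) (h.below k hk hik i h.notMem_i))
    · intro l hl hjl
      rw [congrOp_apply, Pi.single_eq_of_ne h.lt.ne', Pi.single_eq_of_ne hjl.ne']
      simpa using h.right l hl hjl
    · rw [congrOp_apply, Pi.single_eq_of_ne h.lt.ne', ← h.pivot]
      refine norm_eq_of_sub_lt ?_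
      rw [h.pivot, zero_mul, zero_mul, zero_mul, add_zero, add_zero, add_sub_cancel_left]
      exact hmul' _ _ (hc j) hd
  · rw [congrOp_apply, Pi.single_eq_same, hs j i]
    have hr2' : X j j * X i i = (1 - r ^ 2) * X i j ^ 2 := by
      rw [hr2]; field_simp; ring
    field_simp
    linear_combination (X j j) * hr2'

/-- With X j j = 0 the equation for u is linear, X i i + 2u X i j = 0. Its solution lies in 𝔭
because ‖X i i‖ < m, as is required for adding row j to the later row i. -/
theorem exists_clear_lower (hF : LocalFieldData ϖ δ q) (h : PairPivot X D i j m)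
    (hs : ∀ k l, X k l = X l k) (hjj : X j j = 0) :
    ∃ u : F, ‖u‖ < 1 ∧ PairPivot (congrOp (Pi.single i u) j X) D i j m ∧
      congrOp (Pi.single i u) j X j j = 0 ∧ congrOp (Pi.single i u) j X i i = 0 := by
  have hb : X i j ≠ 0 := norm_pos_iff.mp (h.pivot ▸ h.pos)
  have hd : ‖X i i‖ < m := h.right i h.notMem_i h.lt
  have h20 : (2 : F) ≠ 0 := fun h0 => by simpa [h0] using hF.norm_two
  have hu : ‖-(X i i / (2 * X i j))‖ < 1 := by
    rw [norm_neg, norm_div, norm_mul, hF.norm_two, one_mul, h.pivot]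
    exact (div_lt_one h.pos).mpr hd
  refine ⟨_, hu, ?_, ?_, ?_⟩
  · set u := -(X i i / (2 * X i j))
    have hc : ∀ k, ‖(Pi.single i u : Fin n → F) k‖ < 1 := by
      intro k; rw [Pi.single_apply]; split_ifs
      · exact hu
      · simp
    have hmul' : ∀ (a b : F), ‖a‖ < 1 → ‖b‖ ≤ m → ‖a * b‖ < m := fun a b ha hb => by
      rw [norm_mul]
      calc ‖a‖ * ‖b‖ ≤ ‖a‖ * m := by gcongr
        _ < 1 * m := mul_lt_mul_of_pos_right ha h.pos
        _ = m := one_mul m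
    refine ⟨h.lt, h.notMem_i, h.notMem_j, h.pos, ?_, ?_, ?_, ?_⟩
    · intro k hk l hl
      rw [congrOp_apply, hjj, mul_zero, add_zero]
      exact norm_add_le_of_le (norm_add_le_of_le (h.le k hk l hl)
        (hmul' _ _ (hc k) (h.le _ h.notMem_j _ hl)).le)
        (hmul' _ _ (hc l) (h.le _ hk _ h.notMem_j)).le
    · intro k hk hik l hl
      rw [congrOp_apply, hjj, mul_zero, add_zero]
      exact norm_add_lt (norm_add_lt (h.below k hk hik l hl)
        (hmul' _ _ (hc k) (h.le _ h.notMem_j _ hl)))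
        (hmul' _ _ (hc l) (h.le _ hk _ h.notMem_j))
    · intro l hl hjl
      rw [congrOp_apply, hjj, mul_zero, add_zero]
      exact norm_add_lt (norm_add_lt (h.right l hl hjl)
        (hmul' _ _ (hc i) (h.le _ h.notMem_j _ hl)))
        (hmul' _ _ (hc l) (h.le _ h.notMem_i _ h.notMem_j))
    · rw [congrOp_apply, hjj, Pi.single_eq_of_ne h.lt.ne]
      simpa using h.pivot
  · rw [congrOp_apply, hjj, Pi.single_eq_of_ne h.lt.ne]; ring
  · rw [congrOp_apply, hjj, Pi.single_eq_same, hs j i]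
    field_simp; ring

end PairPivot

/-- Completing a partly reduced matrix by a `2 × 2` block. -/
theorem PartlyReduced.exists_insert_pair (hF : LocalFieldData ϖ δ q) {D : Finset (Fin n)}
    {x : Equiv.Perm (Fin n) × (Fin n → ℤ) × (Fin n → F)} (h : PartlyReduced ϖ δ X D x)
    {i j : Fin n} {m : ℝ} (hp : PairPivot X D i j m) (hjj : X j j = 0) (hii : X i i = 0) :
    ∃ Y x', Gamma0Equiv X Y ∧ PartlyReduced ϖ δ Y (insert i (insert j D)) x' := by
  have hi := hp.notMem_i
  have hj := hp.notMem_j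
  have hij : i ≠ j := hp.lt.ne'
  have hb : X i j ≠ 0 := norm_pos_iff.mp (hp.pivot ▸ hp.pos)
  obtain ⟨e, he⟩ := hF.discrete _ hb
  have hϖe : ϖ ^ e ≠ 0 := zpow_ne_zero _ hF.ne_zero
  set v : F := ϖ ^ e / X i j with hv
  have hv1 : ‖v‖ = 1 := by
    rw [hv, norm_div, norm_zpow, he, div_self (zpow_ne_zero _ hF.norm_pos.ne')]
  -- First operation: multiples of row i clear column j outside the block. Column i is not
  -- disturbed, because X i i = 0.
  let c : Fin n → F := fun k => if k = i ∨ k = j then 0 else -(X k j / X i j)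
  have hcD : ∀ k ∈ D, c k = 0 := fun k hk => by simp [c, h.cross hk hj]
  have hci : c i = 0 := by simp [c]
  have hcj : c j = 0 := by simp [c]
  have e1 : Gamma0Equiv X (RamifiedSiegel.congrOp c i X) := by
    refine gamma0Equiv_congrOp (fun k => ?_) (by simp [hci]) (fun k hk => ?_) X
    · by_cases hkD : k ∈ D
      · simp [hcD k hkD]
      · simp only [c]; split_ifs
        · simp
        · rw [norm_neg, norm_div, hp.pivot]
          exact div_le_one_of_le₀ (hp.le k hkD j hj) hp.pos.le
    · by_cases hkD : k ∈ D
      · simp [hcD k hkD]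
      · simp only [c]; split_ifs
        · simp
        · rw [norm_neg, norm_div, hp.pivot, div_lt_one hp.pos]
          exact hp.below k hkD hk j hj
  have h1 := h.congrOp hi hcD
  set Y := RamifiedSiegel.congrOp c i X with hY
  have hYi : ∀ k, Y k i = X k i := fun k => by
    rw [hY, congrOp_apply, hci, hii]; ring
  have hYj : ∀ k, Y k j = if k = i then X i j else 0 := fun k => by
    rw [hY, congrOp_apply, hcj, hii]
    by_cases hk : k = i
    · simp [hk, hci]
    · rw [if_neg hk]
      by_cases hk' : k = j
      · simp [hk', hjj, hcj]
      · simp only [c, hk, hk', or_self, if_false]; field_simp; ring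
  -- Second operation: multiples of row j clear column i, and row j is scaled by v so that the pivot
  -- becomes the power of ϖ. For k > j the coefficient must lie in 𝔭, which is what `hp.right`
  -- provides.
  let d : Fin n → F := fun k =>
    if k = j then v - 1 else if k = i then 0 else -(X k i / X i j)
  have hdD : ∀ k ∈ D, d k = 0 := fun k hk => by
    have : k ≠ j := by rintro rfl; exact hj hk
    simp [d, h.cross hk hi, this]
  have hdj : d j = v - 1 := by simp [d]
  have hdi : d i = 0 := by simp [d, hij]
  have e2 : Gamma0Equiv Y (RamifiedSiegel.congrOp d j Y) := by
    refine gamma0Equiv_congrOp (fun k => ?_) (by simpa [hdj] using hv1) (fun k hk => ?_) Y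
    · by_cases hkD : k ∈ D
      · simp [hdD k hkD]
      · simp only [d]; split_ifs
        · exact norm_sub_le_of_le hv1.le (by simp)
        · simp
        · rw [norm_neg, norm_div, hp.pivot]
          exact div_le_one_of_le₀ (hp.le k hkD i hi) hp.pos.le
    · by_cases hkD : k ∈ D
      · simp [hdD k hkD]
      · simp only [d, hk.ne', if_false]; split_ifs
        · simp
        · rw [norm_neg, norm_div, hp.pivot, div_lt_one hp.pos, h.symm k i]
          exact hp.right k hkD hk
  have h2 := h1.congrOp hj hdD
  set Z := RamifiedSiegel.congrOp d j Y with hZ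
  have hZj : ∀ k, Z j k = if k = i then ϖ ^ e else 0 := fun k => by
    rw [hZ, congrOp_apply, hdj, h1.symm j k, hYj, hYj, if_neg hij.symm]
    split_ifs
    · rw [hv]; field_simp; ring
    · ring
  have hZi : ∀ k, Z i k = if k = j then ϖ ^ e else 0 := fun k => by
    rw [hZ, congrOp_apply, hdi, h1.symm i k, hYi, hYj, hYj, if_pos rfl, if_neg hij.symm]
    by_cases hk : k = j
    · rw [if_pos hk, hk, hdj, h.symm j i, hv]; field_simp; ring
    · rw [if_neg hk]
      by_cases hk' : k = i
      · rw [hk', hii, hdi]; ring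
      · simp only [d, hk, hk', if_false]; field_simp; ring
  have hσi := h.fix i hi
  have hσj := h.fix j hj
  have hne : ∀ k, k ≠ i → k ≠ j → x.1 k ≠ i ∧ x.1 k ≠ j := fun k hki hkj =>
    ⟨fun hk => hki (x.1.injective (hk.trans hσi.symm)),
      fun hk => hkj (x.1.injective (hk.trans hσj.symm))⟩
  -- Both i and j are fixed by the old involution, so the product is again an involution and now
  -- exchanges them.
  let σ : Equiv.Perm (Fin n) := x.1 * Equiv.swap i j
  have hs_i : σ i = j := by simp [σ, hσj]
  have hs_j : σ j = i := by simp [σ, hσi]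
  have hs_k : ∀ k, k ≠ i → k ≠ j → σ k = x.1 k := fun k hki hkj => by
    simp [σ, Equiv.swap_apply_of_ne_of_ne hki hkj]
  have hinv : ∀ k, x.1 (x.1 k) = k := fun k => by
    have := congrArg (fun τ : Equiv.Perm (Fin n) => τ k) h.mem.1
    simpa [pow_two] using this
  refine ⟨Z, (σ, fun k => if k = i ∨ k = j then e else x.2.1 k,
    fun k => if k = i ∨ k = j then 1 else x.2.2 k), e1.trans e2, h2.symm, ⟨?_, ?_, ?_, ?_⟩,
    ?_, ?_⟩
  · ext k
    rw [pow_two, Equiv.Perm.mul_apply, Equiv.Perm.one_apply]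
    by_cases hki : k = i
    · rw [hki, hs_i, hs_j]
    by_cases hkj : k = j
    · rw [hkj, hs_j, hs_i]
    rw [hs_k k hki hkj, hs_k _ (hne k hki hkj).1 (hne k hki hkj).2, hinv]
  · intro k
    dsimp only
    by_cases hki : k = i
    · simp [hki, hs_i]
    by_cases hkj : k = j
    · simp [hkj, hs_j]
    simp [hs_k k hki hkj, hne k hki hkj, hki, hkj, h.mem.2.1 k]
  · intro k
    dsimp only
    split_ifs
    · exact Or.inl rfl
    · exact h.mem.2.2.1 k
  · intro k hk
    dsimp only at hk ⊢
    split_ifs with hk'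
    · rfl
    · push Not at hk'
      rw [hs_k k hk'.1 hk'.2] at hk
      exact h.mem.2.2.2 k hk
  · intro k hk
    simp only [Finset.mem_insert, not_or] at hk
    rw [hs_k k hk.1 hk.2.1]
    exact h.fix k hk.2.2
  · intro k l hk
    rw [repS, Matrix.of_apply]
    by_cases hki : k = i
    · have : i = σ l ↔ l = j := by rw [← hs_j, σ.injective.eq_iff]; exact eq_comm
      simp [hki, hZi, this]
    by_cases hkj : k = j
    · have : j = σ l ↔ l = i := by rw [← hs_i, σ.injective.eq_iff]; exact eq_comm
      simp [hkj, hZj, this]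
    have hkD : k ∈ D := by simpa [hki, hkj] using hk
    rw [h2.eq k l hkD, repS, Matrix.of_apply]
    have : k = σ l ↔ k = x.1 l := by
      by_cases hli : l = i
      · simp [hli, hs_i, hσi, hki, hkj]
      by_cases hlj : l = j
      · simp [hlj, hs_j, hσj, hki, hkj]
      rw [hs_k l hli hlj]
    simp [this, hki, hkj]

/-- Among the remaining entries of maximal norm the pivot is taken in the lowest row i, and
rightmost in that row. These extremal choices make exactly the coefficients that must lie in 𝔭
small. A diagonal pivot splits off a 1 × 1 block, any other a 2 × 2 block. -/
theorem PartlyReduced.exists_larger (hF : LocalFieldData ϖ δ q) {D : Finset (Fin n)}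
    {x : Equiv.Perm (Fin n) × (Fin n → ℤ) × (Fin n → F)} (h : PartlyReduced ϖ δ X D x)
    (hdet : X.det ≠ 0) (hD : D ≠ Finset.univ) :
    ∃ Y D' x', Gamma0Equiv X Y ∧ D.card < D'.card ∧ PartlyReduced ϖ δ Y D' x' := by
  classical
  obtain ⟨a, ha⟩ : ∃ a, a ∉ D := by
    by_contra! hall; exact hD (Finset.eq_univ_iff_forall.mpr hall)
  obtain ⟨b, hb⟩ : ∃ b, X a b ≠ 0 := by
    by_contra! hz; exact hdet (Matrix.det_eq_zero_of_row_eq_zero a hz)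
  have hbD : b ∉ D := fun hbD => hb (by rw [h.symm]; exact h.cross hbD ha)
  obtain ⟨p, hp, hpmax⟩ := Finset.exists_max_image (Dᶜ ×ˢ Dᶜ) (fun p => ‖X p.1 p.2‖)
    ⟨(a, b), by simp [ha, hbD]⟩
  simp only [Finset.mem_product, Finset.mem_compl] at hp hpmax
  set m := ‖X p.1 p.2‖ with hm
  have hmpos : 0 < m := (norm_pos_iff.mpr hb).trans_le (hpmax (a, b) ⟨ha, hbD⟩)
  have hle : ∀ k ∉ D, ∀ l ∉ D, ‖X k l‖ ≤ m := fun k hk l hl => hpmax (k, l) ⟨hk, hl⟩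
  obtain ⟨i, hi, himax⟩ := Finset.exists_max_image
    (Finset.univ.filter fun k => k ∉ D ∧ ∃ l ∉ D, ‖X k l‖ = m) id
    ⟨p.1, by simpa using ⟨hp.1, p.2, hp.2, rfl⟩⟩
  simp only [Finset.mem_filter, Finset.mem_univ, true_and, id] at hi himax
  obtain ⟨hiD, l₀, hl₀D, hl₀⟩ := hi
  obtain ⟨j, hj, hjmax⟩ := Finset.exists_max_image
    (Finset.univ.filter fun l => l ∉ D ∧ ‖X i l‖ = m) id ⟨l₀, by simpa using ⟨hl₀D, hl₀⟩⟩
  simp only [Finset.mem_filter, Finset.mem_univ, true_and, id] at hj hjmax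
  obtain ⟨hjD, hij⟩ := hj
  have hbelow : ∀ k ∉ D, i < k → ∀ l ∉ D, ‖X k l‖ < m := fun k hk hik l hl =>
    lt_of_le_of_ne (hle k hk l hl) fun he => not_le.mpr hik (himax k ⟨hk, l, hl, he⟩)
  have hright : ∀ l ∉ D, j < l → ‖X i l‖ < m := fun l hl hjl =>
    lt_of_le_of_ne (hle i hiD l hl) fun he => not_le.mpr hjl (hjmax l ⟨hl, he⟩)
  -- By symmetry the entry (j, i) is also maximal, so row j competes with row i.
  have hji : j ≤ i := himax j ⟨hjD, i, hiD, by rw [h.symm, hij]⟩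
  rcases hji.eq_or_lt with rfl | hlt
  · obtain ⟨Y, x', hY, hx'⟩ := h.exists_insert hF hiD (norm_pos_iff.mp (hij ▸ hmpos))
      (fun k hk => hij ▸ hle k hk _ hiD) (fun k hk hk' => hij ▸ hbelow k hk hk' _ hiD)
    exact ⟨Y, _, x', hY, by simp [hiD], hx'⟩
  · have hP : PairPivot X D i j m := ⟨hlt, hiD, hjD, hmpos, hle, hbelow, hright, hij⟩
    obtain ⟨t, ht, hP1, hjj1⟩ := hP.exists_clear_upper hF h.symm
    have hX1 := gamma0Equiv_congrOp (c := Pi.single j t) (i := i)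
      (fun k => by rw [Pi.single_apply]; split_ifs <;> simp [ht])
      (by simp [Pi.single_eq_of_ne hlt.ne'])
      (fun k hk => by simp [Pi.single_eq_of_ne (hlt.trans hk).ne']) X
    have h1 := h.congrOp (c := Pi.single j t) hiD
      (fun k hk => Pi.single_eq_of_ne (by rintro rfl; exact hjD hk) _)
    obtain ⟨u, hu, hP2, hjj2, hii2⟩ := hP1.exists_clear_lower hF h1.symm hjj1
    have hX2 := gamma0Equiv_congrOp (c := Pi.single i u) (i := j)
      (fun k => by rw [Pi.single_apply]; split_ifs <;> simp [hu.le])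
      (by simp [Pi.single_eq_of_ne hlt.ne])
      (fun k hk => by rw [Pi.single_apply]; split_ifs <;> simp [hu])
      (RamifiedSiegel.congrOp (Pi.single j t) i X)
    have h2 := h1.congrOp (c := Pi.single i u) hjD
      (fun k hk => Pi.single_eq_of_ne (by rintro rfl; exact hiD hk) _)
    obtain ⟨Y, x', hY, hx'⟩ := h2.exists_insert_pair hF hP2 hjj2 hii2
    refine ⟨Y, _, x', (hX1.trans hX2).trans hY, ?_, hx'⟩
    rw [Finset.card_insert_of_notMem (by simp [hlt.ne', hiD]), Finset.card_insert_of_notMem hjD]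
    omega

/-- Every non-degenerate symmetric matrix is `Γ₀`-equivalent to a standard representative. -/
theorem exists_gamma0Equiv_repS (hF : LocalFieldData ϖ δ q) (hX : X.IsSymm) (hdet : X.det ≠ 0) :
    ∃ x ∈ Lam n δ, Gamma0Equiv X (repS ϖ x) := by
  -- Induction on a bound r for the number of indices not yet reduced.
  have key : ∀ (r : ℕ) (X : Matrix (Fin n) (Fin n) F) (D : Finset (Fin n)) x,
      PartlyReduced ϖ δ X D x → X.det ≠ 0 → n ≤ D.card + r →
      ∃ x ∈ Lam n δ, Gamma0Equiv X (repS ϖ x) := by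
    intro r
    induction r with
    | zero =>
      intro X D x h hdet hr
      have hD : D = Finset.univ := by
        rw [← Finset.card_eq_iff_eq_univ, Fintype.card_fin]
        have := Finset.card_le_univ D
        rw [Fintype.card_fin] at this
        omega
      refine ⟨x, h.mem, 1, one_mem_Gamma0, ?_⟩
      ext k l
      rw [Matrix.one_mul, Matrix.transpose_one, Matrix.mul_one, h.eq k l (by simp [hD])]
    | succ r ih =>
      intro X D x h hdet hr
      by_cases hD : D = Finset.univ
      · exact ih X D x h hdet (by simp [hD])
      · obtain ⟨Y, D', x', hXY, hcard, hY⟩ := h.exists_larger hF hdet hD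
        obtain ⟨y, hy, hYy⟩ := ih Y D' x' hY
          (norm_ne_zero_iff.mp (by rw [hXY.norm_det]; exact norm_ne_zero_iff.mpr hdet)) (by omega)
        exact ⟨y, hy, hXY.trans hYy⟩
  refine key n X ∅ (1, fun _ => 0, fun _ => 1) ⟨fun k l => ?_, ?_, ?_, ?_⟩ hdet (by simp)
  · exact (congrFun (congrFun hX.eq k) l).symm
  · exact ⟨by simp, by simp, by simp, by simp⟩
  · simp
  · simp

end Reduction

end RamifiedSiegel

/-! ### Uniqueness of the representatives and openness of the orbits. -/

namespace RamifiedSiegel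

section Representatives

variable {F : Type*} [NontriviallyNormedField F] [IsUltrametricDist F] {n : ℕ}
  {X : Matrix (Fin n) (Fin n) F} {ϖ δ : F} {q : ℕ}
  {x y : Equiv.Perm (Fin n) × (Fin n → ℤ) × (Fin n → F)}

theorem Lam.involutive (hx : x ∈ Lam n δ) (k : Fin n) : x.1 (x.1 k) = k := by
  have := congrArg (fun τ : Equiv.Perm (Fin n) => τ k) hx.1
  simpa [pow_two] using this

theorem Lam.norm_sign (hF : LocalFieldData ϖ δ q) (hx : x ∈ Lam n δ) (k : Fin n) :
    ‖x.2.2 k‖ = 1 := by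
  rcases hx.2.2.1 k with h | h
  · simp [h]
  · rw [h, hF.norm_nonsquare]

theorem Lam.norm_coeff (hF : LocalFieldData ϖ δ q) (hx : x ∈ Lam n δ) (k : Fin n) :
    ‖x.2.2 k * ϖ ^ x.2.1 k‖ = ‖ϖ‖ ^ x.2.1 k := by
  rw [norm_mul, Lam.norm_sign hF hx, one_mul, norm_zpow]

/-- The permutation matrix with entry `1` at `(σ j, j)`. -/
def permMat (F : Type*) [Field F] (σ : Equiv.Perm (Fin n)) : Matrix (Fin n) (Fin n) F :=
  (1 : Matrix (Fin n) (Fin n) F).submatrix id σ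

theorem norm_det_permMat (σ : Equiv.Perm (Fin n)) : ‖(permMat F σ).det‖ = 1 := by
  rw [permMat, Matrix.det_permute']
  rcases Int.units_eq_one_or (Equiv.Perm.sign σ) with h | h <;> simp [h]

theorem entryLE_permMat (σ : Equiv.Perm (Fin n)) : EntryLE (permMat F σ) 1 := fun i j =>
  entryLE_one i (σ j)

theorem repS_eq_diagonal_mul (ϖ : F) (x : Equiv.Perm (Fin n) × (Fin n → ℤ) × (Fin n → F)) :
    repS ϖ x = Matrix.diagonal (fun i => x.2.2 i * ϖ ^ x.2.1 i) * permMat F x.1 := by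
  ext i j
  rw [Matrix.diagonal_mul, repS, Matrix.of_apply, permMat, Matrix.submatrix_apply, id,
    Matrix.one_apply]
  split_ifs <;> simp

theorem norm_det_repS (hF : LocalFieldData ϖ δ q) (hx : x ∈ Lam n δ) :
    ‖(repS ϖ x).det‖ = ∏ i, ‖ϖ‖ ^ x.2.1 i := by
  rw [repS_eq_diagonal_mul, Matrix.det_mul, norm_mul, norm_det_permMat, mul_one,
    Matrix.det_diagonal, norm_prod]
  exact Finset.prod_congr rfl fun i _ => Lam.norm_coeff hF hx i

theorem det_repS_ne_zero (hF : LocalFieldData ϖ δ q) (hx : x ∈ Lam n δ) :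
    (repS ϖ x).det ≠ 0 := by
  rw [← norm_ne_zero_iff, norm_det_repS hF hx]
  exact Finset.prod_ne_zero_iff.mpr fun i _ => zpow_ne_zero _ hF.norm_pos.ne'

/-- Extracting the diagonal factor leaves a permutation matrix plus a matrix with entries in 𝔭,
whose determinant is a unit. -/
theorem det_repS_add_ne_zero (hF : LocalFieldData ϖ δ q) (hx : x ∈ Lam n δ)
    {Z : Matrix (Fin n) (Fin n) F} (hZ : ∀ a, EntryLT Z (‖ϖ‖ ^ x.2.1 a)) :
    (repS ϖ x + Z).det ≠ 0 := by
  set d : Fin n → F := fun i => x.2.2 i * ϖ ^ x.2.1 i with hd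
  have hdn : ∀ i, ‖d i‖ = ‖ϖ‖ ^ x.2.1 i := fun i => Lam.norm_coeff hF hx i
  have hpos : ∀ i, 0 < ‖d i‖ := fun i => by rw [hdn]; exact zpow_pos hF.norm_pos _
  have hd0 : ∀ i, d i ≠ 0 := fun i => norm_pos_iff.mp (hpos i)
  have hfac : repS ϖ x + Z = Matrix.diagonal d * (permMat F x.1 +
      Matrix.of fun i j => (d i)⁻¹ * Z i j) := by
    rw [Matrix.mul_add, ← repS_eq_diagonal_mul]
    congr 1
    ext i j
    rw [Matrix.diagonal_mul, Matrix.of_apply, mul_inv_cancel_left₀ (hd0 i)]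
  rw [hfac, Matrix.det_mul, Matrix.det_diagonal]
  refine mul_ne_zero (Finset.prod_ne_zero_iff.mpr fun i _ => hd0 i) ?_
  have h1 := norm_det_add_sub_det_lt_one (entryLE_permMat (F := F) x.1)
    (N := Matrix.of fun i j => (d i)⁻¹ * Z i j) (fun i j => by
      rw [Matrix.of_apply, norm_mul, norm_inv, inv_mul_lt_iff₀ (hpos i), mul_one, hdn]
      exact hZ i i j)
  rw [← norm_det_permMat (F := F) x.1] at h1
  rw [← norm_ne_zero_iff, norm_eq_of_sub_lt h1, norm_det_permMat]
  exact one_ne_zero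

theorem isSymm_repS (hx : x ∈ Lam n δ) : (repS ϖ x).IsSymm := by
  refine Matrix.IsSymm.ext fun i j => ?_
  rw [repS, Matrix.of_apply, Matrix.of_apply]
  have : i = x.1 j ↔ j = x.1 i :=
    ⟨fun h => by rw [h, Lam.involutive hx], fun h => by rw [h, Lam.involutive hx]⟩
  by_cases h : i = x.1 j
  · rw [if_pos h, if_pos (this.mp h)]
    have hj : j = x.1 i := this.mp h
    by_cases hij : i = j
    · rw [hij]
    · have h1 : x.2.2 i = 1 := hx.2.2.2 i (by rw [← hj]; exact Ne.symm hij)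
      have h2 : x.2.2 j = 1 := hx.2.2.2 j (by rw [← h]; exact hij)
      rw [h1, h2, hj, hx.2.1 i]
  · rw [if_neg h, if_neg (fun h' => h (this.mpr h'))]

theorem mul_repS_apply (M : Matrix (Fin n) (Fin n) F) (ϖ : F)
    (x : Equiv.Perm (Fin n) × (Fin n → ℤ) × (Fin n → F)) (i l : Fin n) :
    (M * repS ϖ x) i l = M i (x.1 l) * (x.2.2 (x.1 l) * ϖ ^ x.2.1 (x.1 l)) := by
  simp [Matrix.mul_apply, repS]

theorem repS_mul_apply (hx : x ∈ Lam n δ) (M : Matrix (Fin n) (Fin n) F) (i l : Fin n) :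
    (repS ϖ x * M) i l = x.2.2 i * ϖ ^ x.2.1 i * M (x.1 i) l := by
  have : ∀ j, i = x.1 j ↔ x.1 i = j := fun j =>
    ⟨fun h => by rw [h, Lam.involutive hx], fun h => by rw [← h, Lam.involutive hx]⟩
  simp [Matrix.mul_apply, repS, this]

/-- Two representatives which are `Γ₀`-equivalent up to a small error. -/
structure NearEquiv (ϖ : F) (x y : Equiv.Perm (Fin n) × (Fin n → ℤ) × (Fin n → F))
    (γ Z : Matrix (Fin n) (Fin n) F) : Prop where
  mem : γ ∈ Gamma0 n F
  eq : repS ϖ y = γ * repS ϖ x * γᵀ + Z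
  small : ∀ a, EntryLT Z (‖ϖ‖ ^ x.2.1 a)

namespace NearEquiv

variable {γ Z : Matrix (Fin n) (Fin n) F}

/-- Multiplying the near-equivalence on the right by ᵗγ⁻¹ gives γ S_x = (S_y - Z) ᵗγ⁻¹. As S_x and
S_y are monomial, this compares single entries of γ and γ⁻¹, up to an error controlled by
`error_lt`. -/
theorem entry (h : NearEquiv ϖ x y γ Z) (hx : x ∈ Lam n δ) (hy : y ∈ Lam n δ) (i k : Fin n) :
    γ i k * (x.2.2 k * ϖ ^ x.2.1 k) =
      y.2.2 i * ϖ ^ y.2.1 i * γ⁻¹ (x.1 k) (y.1 i) - (Z * γ⁻¹ᵀ) i (x.1 k) := by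
  have hu := isUnit_det_of_norm h.mem.2.1
  have h1 : γ * repS ϖ x = repS ϖ y * γ⁻¹ᵀ - Z * γ⁻¹ᵀ := by
    rw [h.eq, Matrix.add_mul, add_sub_cancel_right, Matrix.mul_assoc, ← Matrix.transpose_mul,
      Matrix.nonsing_inv_mul _ hu, Matrix.transpose_one, Matrix.mul_one]
  have h2 := congrFun (congrFun h1 i) (x.1 k)
  rw [mul_repS_apply, Matrix.sub_apply, repS_mul_apply hy, Lam.involutive hx,
    Matrix.transpose_apply] at h2
  exact h2

theorem error_lt (hF : LocalFieldData ϖ δ q) (h : NearEquiv ϖ x y γ Z) (a i j : Fin n) :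
    ‖(Z * γ⁻¹ᵀ) i j‖ < ‖ϖ‖ ^ x.2.1 a :=
  EntryLT.mul_one_right (zpow_pos hF.norm_pos _) (h.small a)
    (EntryLE.transpose (inv_mem_Gamma0 h.mem).1) i j

/-- The entry relation at i = k = a, where γ a a is a unit and the error is strictly smaller than
the main term. It yields one inequality between exponents; the inverse near-equivalence yields the
other. -/
theorem norm_diag (hF : LocalFieldData ϖ δ q) (h : NearEquiv ϖ x y γ Z) (hx : x ∈ Lam n δ)
    (hy : y ∈ Lam n δ) (a : Fin n) :
    ‖ϖ‖ ^ x.2.1 a = ‖ϖ‖ ^ y.2.1 a * ‖γ⁻¹ (x.1 a) (y.1 a)‖ := by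
  have h1 := h.entry hx hy a a
  have hn : ‖γ a a * (x.2.2 a * ϖ ^ x.2.1 a)‖ = ‖ϖ‖ ^ x.2.1 a := by
    rw [norm_mul, (mem_Gamma0_iff.mp h.mem).2.1 a, one_mul, Lam.norm_coeff hF hx]
  rw [← Lam.norm_coeff hF hy, ← norm_mul, ← hn]
  refine (norm_eq_of_sub_lt ?_).symm
  rw [hn, h1, sub_sub_cancel]
  exact h.error_lt hF a _ _

theorem exponent_le (hF : LocalFieldData ϖ δ q) (h : NearEquiv ϖ x y γ Z) (hx : x ∈ Lam n δ)
    (hy : y ∈ Lam n δ) (a : Fin n) : ‖ϖ‖ ^ x.2.1 a ≤ ‖ϖ‖ ^ y.2.1 a := by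
  rw [h.norm_diag hF hx hy]
  exact mul_le_of_le_one_right (zpow_pos hF.norm_pos _).le ((inv_mem_Gamma0 h.mem).1 _ _)

theorem symm (hF : LocalFieldData ϖ δ q) (h : NearEquiv ϖ x y γ Z) (hx : x ∈ Lam n δ)
    (hy : y ∈ Lam n δ) : NearEquiv ϖ y x γ⁻¹ (-(γ⁻¹ * Z * γ⁻¹ᵀ)) where
  mem := inv_mem_Gamma0 h.mem
  eq := by
    rw [h.eq, Matrix.mul_add, Matrix.add_mul, inv_mul_mul_inv_transpose h.mem,
      add_neg_cancel_right]
  small a := by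
    refine fun i j => lt_of_lt_of_le ?_ (h.exponent_le hF hx hy a)
    exact (EntryLT.mul_one_right (zpow_pos hF.norm_pos _) (EntryLT.mul_one_left
      (zpow_pos hF.norm_pos _) (inv_mem_Gamma0 h.mem).1 (h.small a))
      (EntryLE.transpose (inv_mem_Gamma0 h.mem).1)).neg i j

theorem exponent_eq (hF : LocalFieldData ϖ δ q) (h : NearEquiv ϖ x y γ Z) (hx : x ∈ Lam n δ)
    (hy : y ∈ Lam n δ) (a : Fin n) : x.2.1 a = y.2.1 a :=
  (zpow_right_injective₀ hF.norm_pos hF.norm_lt_one.ne)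
    (le_antisymm (h.exponent_le hF hx hy a) ((h.symm hF hx hy).exponent_le hF hy hx a))

/-- If y.1 a < x.1 a, the entry of γ⁻¹ occurring in `norm_diag` lies below the diagonal, hence in 𝔭,
which contradicts equality of the exponents. -/
theorem perm_le (hF : LocalFieldData ϖ δ q) (h : NearEquiv ϖ x y γ Z) (hx : x ∈ Lam n δ)
    (hy : y ∈ Lam n δ) (a : Fin n) : x.1 a ≤ y.1 a := by
  by_contra! hlt
  have h1 := h.norm_diag hF hx hy a
  rw [h.exponent_eq hF hx hy a] at h1
  have h2 := (inv_mem_Gamma0 h.mem).2.2 _ _ hlt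
  exact absurd h1 (mul_lt_of_lt_one_right (zpow_pos hF.norm_pos _) h2).ne'

theorem perm_eq (hF : LocalFieldData ϖ δ q) (h : NearEquiv ϖ x y γ Z) (hx : x ∈ Lam n δ)
    (hy : y ∈ Lam n δ) : x.1 = y.1 :=
  Equiv.ext fun a => le_antisymm (h.perm_le hF hx hy a) ((h.symm hF hx hy).perm_le hF hy hx a)

/-- In the (a, a) entry of γ S_x ᵗγ the term l = a gives γ_aa² ε_a. For l < a the factor γ a l is in
𝔭; for l > a the other factor is small, since by `entry` it involves γ⁻¹ l a, below the diagonal. -/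
theorem norm_sign_sub_lt (hF : LocalFieldData ϖ δ q) (h : NearEquiv ϖ x y γ Z)
    (hx : x ∈ Lam n δ) (hy : y ∈ Lam n δ) {a : Fin n} (ha : x.1 a = a) :
    ‖y.2.2 a - γ a a ^ 2 * x.2.2 a‖ < 1 := by
  have hpos : 0 < ‖ϖ‖ ^ x.2.1 a := zpow_pos hF.norm_pos _
  have hya : y.1 a = a := by rw [← h.perm_eq hF hx hy, ha]
  have hent : ∀ l, γ a (x.1 l) * (x.2.2 (x.1 l) * ϖ ^ x.2.1 (x.1 l)) =
      y.2.2 a * ϖ ^ x.2.1 a * γ⁻¹ l a - (Z * γ⁻¹ᵀ) a l := fun l => by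
    have := h.entry hx hy a (x.1 l)
    rwa [Lam.involutive hx, hya, ← h.exponent_eq hF hx hy a] at this
  have hco : ‖y.2.2 a * ϖ ^ x.2.1 a‖ = ‖ϖ‖ ^ x.2.1 a := by
    rw [norm_mul, Lam.norm_sign hF hy, one_mul, norm_zpow]
  have hle : ∀ l, ‖γ a (x.1 l) * (x.2.2 (x.1 l) * ϖ ^ x.2.1 (x.1 l))‖ ≤ ‖ϖ‖ ^ x.2.1 a :=
    fun l => by
      rw [hent]
      refine norm_sub_le_of_le ?_ (h.error_lt hF a _ _).le
      rw [norm_mul, hco]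
      exact mul_le_of_le_one_right hpos.le ((inv_mem_Gamma0 h.mem).1 _ _)
  have hlt : ∀ l, a < l →
      ‖γ a (x.1 l) * (x.2.2 (x.1 l) * ϖ ^ x.2.1 (x.1 l))‖ < ‖ϖ‖ ^ x.2.1 a := fun l hl => by
    rw [hent]
    refine norm_sub_lt' ?_ (h.error_lt hF a _ _)
    rw [norm_mul, hco]
    exact mul_lt_of_lt_one_right hpos ((inv_mem_Gamma0 h.mem).2.2 _ _ hl)
  have hdiag : y.2.2 a * ϖ ^ x.2.1 a =
      ∑ l, γ a (x.1 l) * (x.2.2 (x.1 l) * ϖ ^ x.2.1 (x.1 l)) * γ a l + Z a a := by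
    have h1 := congrFun (congrFun h.eq a) a
    rw [Matrix.add_apply, Matrix.mul_apply, repS, Matrix.of_apply, hya, if_pos rfl,
      ← h.exponent_eq hF hx hy a] at h1
    rw [h1]
    congr 1
    exact Finset.sum_congr rfl fun l _ => by rw [mul_repS_apply, Matrix.transpose_apply]
  rw [← Finset.add_sum_erase _ _ (Finset.mem_univ a), ha] at hdiag
  have hϖ : ϖ ^ x.2.1 a ≠ 0 := zpow_ne_zero _ hF.ne_zero
  have hfin : (y.2.2 a - γ a a ^ 2 * x.2.2 a) * ϖ ^ x.2.1 a =
      ∑ l ∈ Finset.univ.erase a, γ a (x.1 l) * (x.2.2 (x.1 l) * ϖ ^ x.2.1 (x.1 l)) * γ a l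
        + Z a a := by
    linear_combination hdiag
  have hn : ‖(y.2.2 a - γ a a ^ 2 * x.2.2 a) * ϖ ^ x.2.1 a‖ < ‖ϖ‖ ^ x.2.1 a := by
    rw [hfin]
    refine norm_add_lt (norm_sum_lt_of_lt hpos fun l hl => ?_) (h.small a a a)
    rw [norm_mul]
    rcases lt_or_gt_of_ne (Finset.ne_of_mem_erase hl) with h' | h'
    · calc _ ≤ ‖ϖ‖ ^ x.2.1 a * ‖γ a l‖ := by gcongr; exact hle l
        _ < ‖ϖ‖ ^ x.2.1 a := mul_lt_of_lt_one_right hpos (h.mem.2.2 _ _ h')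
    · exact (mul_le_of_le_one_right (norm_nonneg _) (h.mem.1 _ _)).trans_lt (hlt l h')
  rw [norm_mul, norm_zpow] at hn
  exact (mul_lt_iff_lt_one_left hpos).mp hn

/-- Nearly equivalent representatives are equal. -/
theorem rep_eq (hF : LocalFieldData ϖ δ q) (h : NearEquiv ϖ x y γ Z) (hx : x ∈ Lam n δ)
    (hy : y ∈ Lam n δ) : x = y := by
  have hσ := h.perm_eq hF hx hy
  refine Prod.ext hσ (Prod.ext (funext (h.exponent_eq hF hx hy)) (funext fun a => ?_))
  by_cases ha : x.1 a = a
  · have hs := h.norm_sign_sub_lt hF hx hy ha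
    have hγ := (mem_Gamma0_iff.mp h.mem).2.1 a
    have hγ0 : γ a a ≠ 0 := norm_ne_zero_iff.mp (by rw [hγ]; exact one_ne_zero)
    -- If the signs differed, δ would be congruent modulo 𝔭 to the square of γ a a or of its
    -- inverse.
    rcases hx.2.2.1 a with h1 | h1 <;> rcases hy.2.2.1 a with h2 | h2
    · rw [h1, h2]
    · rw [h1, h2, mul_one, norm_sub_rev] at hs
      exact absurd hs (not_lt.mpr (hF.nonsquare _ hγ))
    · rw [h1, h2] at hs
      have h3 : (γ a a)⁻¹ ^ 2 - δ = (γ a a)⁻¹ ^ 2 * (1 - γ a a ^ 2 * δ) := by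
        field_simp
      have h4 := hF.nonsquare (γ a a)⁻¹ (by rw [norm_inv, hγ, inv_one])
      rw [h3, norm_mul, norm_pow, norm_inv, hγ, inv_one, one_pow, one_mul] at h4
      exact absurd hs (not_lt.mpr h4)
    · rw [h1, h2]
  · rw [hx.2.2.2 a ha, hy.2.2.2 a (by rwa [← hσ])]

end NearEquiv

/-- The `Γ₀`-orbit of a representative. -/
def orbit (ϖ : F) (x : Equiv.Perm (Fin n) × (Fin n → ℤ) × (Fin n → F)) :
    Set (Matrix (Fin n) (Fin n) F) := {X | Gamma0Equiv (repS ϖ x) X}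

theorem orbit_unique (hF : LocalFieldData ϖ δ q) (hx : x ∈ Lam n δ) (hy : y ∈ Lam n δ)
    (h : X ∈ orbit ϖ x) (h' : X ∈ orbit ϖ y) : x = y := by
  obtain ⟨γ, hγ, heq⟩ := h.trans h'.symm
  refine NearEquiv.rep_eq (γ := γ) (Z := 0) hF ⟨hγ, by rw [heq, add_zero], fun a i j => ?_⟩ hx hy
  simpa using zpow_pos hF.norm_pos (x.2.1 a)

/-- Transporting X to S turns the perturbation into S + Z' with Z' equally small. This matrix is
non-degenerate, so it is equivalent to some S_y; then S_x and S_y are nearly equivalent and hence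
equal. -/
theorem add_mem_orbit (hF : LocalFieldData ϖ δ q) (hx : x ∈ Lam n δ) (h : X ∈ orbit ϖ x)
    {Z : Matrix (Fin n) (Fin n) F} (hZs : Z.IsSymm) (hZ : ∀ a, EntryLT Z (‖ϖ‖ ^ x.2.1 a)) :
    X + Z ∈ orbit ϖ x := by
  obtain ⟨γ, hγ, rfl⟩ := h
  have hγ' := inv_mem_Gamma0 hγ
  set S := repS ϖ x with hS
  set Z' := γ⁻¹ * Z * γ⁻¹ᵀ with hZ'
  have hpos : ∀ a, 0 < ‖ϖ‖ ^ x.2.1 a := fun a => zpow_pos hF.norm_pos _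
  have hsmall : ∀ a, EntryLT Z' (‖ϖ‖ ^ x.2.1 a) := fun a =>
    EntryLT.mul_one_right (hpos a) (EntryLT.mul_one_left (hpos a) hγ'.1 (hZ a)) (EntryLE.transpose hγ'.1)
  have hXY : Gamma0Equiv (γ * S * γᵀ + Z) (S + Z') := by
    refine ⟨γ⁻¹, hγ', ?_⟩
    rw [Matrix.mul_add, Matrix.add_mul, inv_mul_mul_inv_transpose hγ]
  have hsymm : (S + Z').IsSymm := by
    refine (isSymm_repS hx).add ?_
    exact Gamma0Equiv.isSymm (X := Z) ⟨γ⁻¹, hγ', rfl⟩ hZs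
  obtain ⟨y, hy, η, hη, hye⟩ := exists_gamma0Equiv_repS hF hsymm (det_repS_add_ne_zero hF hx hsmall)
  have hxy : x = y := NearEquiv.rep_eq (γ := η) (Z := η * Z' * ηᵀ) hF
    ⟨hη, by rw [hye, Matrix.mul_add, Matrix.add_mul], fun a =>
      EntryLT.mul_one_right (hpos a) (EntryLT.mul_one_left (hpos a) hη.1 (hsmall a))
        (EntryLE.transpose hη.1)⟩ hx hy
  rw [orbit, Set.mem_ofPred_eq]
  refine Gamma0Equiv.trans ?_ hXY.symm
  rw [hxy]
  exact Gamma0Equiv.symm ⟨η, hη, hye⟩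

theorem exists_mem_orbit (hF : LocalFieldData ϖ δ q) (hX : X.IsSymm) (hdet : X.det ≠ 0) :
    ∃ x ∈ Lam n δ, X ∈ orbit ϖ x := by
  obtain ⟨x, hx, h⟩ := exists_gamma0Equiv_repS hF hX hdet
  exact ⟨x, hx, h.symm⟩

end Representatives

end RamifiedSiegel

/-! ### Haar measure on the field. -/

namespace RamifiedSiegel

section Measure

variable {F : Type*} [NontriviallyNormedField F] [IsUltrametricDist F] [LocallyCompactSpace F]
  [ProperSpace F] [MeasurableSpace F] [BorelSpace F] {n : ℕ} {ϖ δ : F} {q : ℕ}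

instance isAddHaarMeasure_fieldHaar : (fieldHaar F).IsAddHaarMeasure := by
  unfold fieldHaar; infer_instance

instance sigmaFinite_fieldHaar : SigmaFinite (fieldHaar F) := by
  infer_instance

theorem fieldHaar_closedBall_one : fieldHaar F (Metric.closedBall 0 1) = 1 :=
  Measure.addHaarMeasure_self

/-- A ball is the disjoint union of q translates of the next smaller one, indexed by the residue
representatives. -/
theorem fieldHaar_closedBall_succ (hF : LocalFieldData ϖ δ q) (k : ℤ) :
    fieldHaar F (Metric.closedBall 0 (‖ϖ‖ ^ k)) =
      q * fieldHaar F (Metric.closedBall 0 (‖ϖ‖ ^ (k + 1))) := by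
  obtain ⟨R, hcard, hR1, hR2, hR3⟩ := hF.reps
  have hpos : 0 < ‖ϖ‖ ^ k := zpow_pos hF.norm_pos k
  have hϖk : ϖ ^ k ≠ 0 := zpow_ne_zero _ hF.ne_zero
  have hcover : Metric.closedBall (0 : F) (‖ϖ‖ ^ k) =
      ⋃ r ∈ R, (fun y => -(ϖ ^ k * r) + y) ⁻¹' Metric.closedBall 0 (‖ϖ‖ ^ (k + 1)) := by
    ext y
    simp only [mem_closedBall_zero_iff, Set.mem_iUnion, Set.mem_preimage, exists_prop]
    have hfac : ∀ r, -(ϖ ^ k * r) + y = ϖ ^ k * (y / ϖ ^ k - r) := fun r => by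
      field_simp; ring
    constructor
    · intro hy
      obtain ⟨r, hr, hyr⟩ := hR2 (y / ϖ ^ k) (by
        rw [norm_div, norm_zpow]; exact div_le_one_of_le₀ hy hpos.le)
      refine ⟨r, hr, ?_⟩
      rw [hfac, norm_mul, norm_zpow, zpow_add_one₀ hF.norm_pos.ne']
      exact mul_le_mul_of_nonneg_left (hF.norm_le_of_lt_one hyr) hpos.le
    · rintro ⟨r, hr, hyr⟩
      have h1 : y = (-(ϖ ^ k * r) + y) + ϖ ^ k * r := by ring
      rw [h1]
      refine norm_add_le_of_le (hyr.trans ?_) ?_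
      · rw [zpow_add_one₀ hF.norm_pos.ne']
        exact mul_le_of_le_one_right hpos.le hF.norm_lt_one.le
      · rw [norm_mul, norm_zpow]
        exact mul_le_of_le_one_right hpos.le (hR1 r hr)
  rw [hcover, measure_biUnion_finset]
  · simp only [measure_preimage_add, Finset.sum_const, hcard, nsmul_eq_mul]
  · intro r hr r' hr' hne
    refine Set.disjoint_left.mpr fun y hy hy' => hne (hR3 r hr r' hr' ?_)
    simp only [Set.mem_preimage, mem_closedBall_zero_iff] at hy hy'
    have h1 := norm_sub_le_of_le hy' hy
    have h2 : -(ϖ ^ k * r') + y - (-(ϖ ^ k * r) + y) = ϖ ^ k * (r - r') := by ring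
    rw [h2, norm_mul, norm_zpow, zpow_add_one₀ hF.norm_pos.ne'] at h1
    exact (le_of_mul_le_mul_left h1 hpos).trans_lt hF.norm_lt_one
  · intro r _
    exact (measurable_const_add _) Metric.isClosed_closedBall.measurableSet

theorem fieldHaar_closedBall (hF : LocalFieldData ϖ δ q) (k : ℤ) :
    fieldHaar F (Metric.closedBall 0 (‖ϖ‖ ^ k)) = ENNReal.ofReal (‖ϖ‖ ^ k) := by
  have hq : (0 : ℝ) < q := by exact_mod_cast zero_lt_one.trans hF.one_lt
  have hstep : ∀ k : ℤ, ENNReal.ofReal (‖ϖ‖ ^ k) = q * ENNReal.ofReal (‖ϖ‖ ^ (k + 1)) := by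
    intro k
    rw [← ENNReal.ofReal_natCast, ← ENNReal.ofReal_mul hq.le, zpow_add_one₀ hF.norm_pos.ne']
    congr 1
    nth_rewrite 3 [hF.norm_unif]
    field_simp
  have hq0 : (q : ENNReal) ≠ 0 := by exact_mod_cast (zero_lt_one.trans hF.one_lt).ne'
  induction k using Int.induction_on with
  | zero => simp [fieldHaar_closedBall_one]
  | succ k ih =>
    rw [fieldHaar_closedBall_succ hF, hstep] at ih
    exact (ENNReal.mul_right_inj hq0 (ENNReal.natCast_ne_top q)).mp ih
  | pred k ih =>
    rw [fieldHaar_closedBall_succ hF, hstep, sub_add_cancel, ih]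

theorem pi_fieldHaar_box (hF : LocalFieldData ϖ δ q) {ι : Type*} [Fintype ι] (k : ℤ) :
    Measure.pi (fun _ : ι => fieldHaar F) {x | ∀ i, ‖x i‖ ≤ ‖ϖ‖ ^ k} =
      ENNReal.ofReal (‖ϖ‖ ^ k) ^ Fintype.card ι := by
  have : {x : ι → F | ∀ i, ‖x i‖ ≤ ‖ϖ‖ ^ k} =
      Set.pi Set.univ fun _ => Metric.closedBall 0 (‖ϖ‖ ^ k) := by ext x; simp
  rw [this, Measure.pi_pi]
  simp [fieldHaar_closedBall hF]

/-- A Haar measure is preserved by an automorphism which preserves some compact open set. -/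
theorem map_eq_of_preserves_compact {G : Type*} [AddGroup G] [TopologicalSpace G]
    [IsTopologicalAddGroup G] [SecondCountableTopology G]
    [MeasurableSpace G] [BorelSpace G] (μ : Measure G) [SigmaFinite μ] [μ.IsAddHaarMeasure]
    (e : G ≃+ G) (he : Continuous e) (he' : Continuous e.symm) {K : Set G} (hK : IsCompact K)
    (hKo : IsOpen K) (hK0 : K.Nonempty) (hpre : e ⁻¹' K = K) : Measure.map e μ = μ := by
  let K₀ : TopologicalSpace.PositiveCompacts G := ⟨⟨K, hK⟩, by rwa [hKo.interior_eq]⟩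
  have h1 := e.isAddHaarMeasure_map μ he he'
  have h2 : SigmaFinite (Measure.map e μ) :=
    (Homeomorph.mk e.toEquiv he he').toMeasurableEquiv.sigmaFinite_map
  have h3 : Measure.map e μ K = μ K := by
    rw [Measure.map_apply he.measurable hKo.measurableSet, hpre]
  -- The image is again a Haar measure and agrees with μ on K, so uniqueness of Haar measure
  -- applies.
  have h4 := Measure.addHaarMeasure_unique (Measure.map e μ) K₀
  rw [show Measure.map e μ K₀ = μ K₀ from h3, ← Measure.addHaarMeasure_unique μ K₀] at h4
  exact h4

end Measure

end RamifiedSiegel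

/-! ### Symmetric coordinates, and the measure of Γ₀-orbits. -/

namespace RamifiedSiegel

section SymmetricCoordinates

variable {F : Type*} [NontriviallyNormedField F] [IsUltrametricDist F] {n : ℕ}

/-- Coordinates on the space of symmetric matrices: the entries on and above the diagonal. -/
abbrev UpperCoord (n : ℕ) (F : Type*) := {p : Fin n × Fin n // p.1 ≤ p.2} → F

/-- The entries on and above the diagonal. -/
def upper (X : Matrix (Fin n) (Fin n) F) : UpperCoord n F := fun p => X p.1.1 p.1.2

theorem symOfUpper_apply (x : UpperCoord n F) (i j : Fin n) :
    (symOfUpper x).1 i j = x ⟨(min i j, max i j), min_le_max⟩ := rfl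

theorem upper_symOfUpper (x : UpperCoord n F) : upper (symOfUpper x).1 = x := by
  ext ⟨⟨i, j⟩, hij⟩
  have hij' : i ≤ j := hij
  simp [upper, symOfUpper_apply, min_eq_left hij', max_eq_right hij']

theorem symOfUpper_upper {X : Matrix (Fin n) (Fin n) F} (hX : X.IsSymm) :
    (symOfUpper (upper X)).1 = X := by
  ext i j
  rw [symOfUpper_apply, upper]
  rcases le_total i j with h | h
  · simp [h]
  · simpa [h] using hX.apply i j

theorem symOfUpper_add (x y : UpperCoord n F) :
    (symOfUpper (x + y)).1 = (symOfUpper x).1 + (symOfUpper y).1 := rfl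

theorem symOfUpper_sub (x y : UpperCoord n F) :
    (symOfUpper (x - y)).1 = (symOfUpper x).1 - (symOfUpper y).1 := rfl

theorem entryLE_symOfUpper_iff {x : UpperCoord n F} {c : ℝ} :
    EntryLE (symOfUpper x).1 c ↔ ∀ p, ‖x p‖ ≤ c := by
  constructor
  · intro h p
    rw [← upper_symOfUpper x]
    exact h p.1.1 p.1.2
  · intro h i j
    exact h _

/-- The action `X ↦ γ X ᵗγ` in coordinates. -/
def act (γ : Matrix (Fin n) (Fin n) F) (x : UpperCoord n F) : UpperCoord n F :=
  upper (γ * (symOfUpper x).1 * γᵀ)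

theorem symOfUpper_act (γ : Matrix (Fin n) (Fin n) F) (x : UpperCoord n F) :
    (symOfUpper (act γ x)).1 = γ * (symOfUpper x).1 * γᵀ := by
  refine symOfUpper_upper ?_
  have h : (symOfUpper x).1ᵀ = (symOfUpper x).1 := (symOfUpper x).2
  rw [Matrix.IsSymm, Matrix.transpose_mul, Matrix.transpose_mul, Matrix.transpose_transpose, h,
    Matrix.mul_assoc]

theorem act_mul (γ η : Matrix (Fin n) (Fin n) F) (x : UpperCoord n F) :
    act (γ * η) x = act γ (act η x) := by
  rw [act, act, symOfUpper_act, Matrix.transpose_mul]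
  simp only [Matrix.mul_assoc]

theorem act_one (x : UpperCoord n F) : act 1 x = x := by
  rw [act, Matrix.one_mul, Matrix.transpose_one, Matrix.mul_one, upper_symOfUpper]

theorem act_add (γ : Matrix (Fin n) (Fin n) F) (x y : UpperCoord n F) :
    act γ (x + y) = act γ x + act γ y := by
  rw [act, symOfUpper_add, Matrix.mul_add, Matrix.add_mul]; rfl

theorem continuous_symOfUpper_val :
    Continuous fun x : UpperCoord n F => (symOfUpper x).1 :=
  continuous_matrix fun _ _ => continuous_apply _

theorem continuous_upper : Continuous (upper : Matrix (Fin n) (Fin n) F → UpperCoord n F) :=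
  continuous_pi fun p => continuous_id.matrix_elem p.1.1 p.1.2

theorem continuous_act :
    Continuous fun z : Matrix (Fin n) (Fin n) F × UpperCoord n F => act z.1 z.2 :=
  continuous_upper.comp ((continuous_fst.matrix_mul
    (continuous_symOfUpper_val.comp continuous_snd)).matrix_mul continuous_fst.matrix_transpose)

theorem continuous_act_right (γ : Matrix (Fin n) (Fin n) F) : Continuous (act γ) :=
  Continuous.comp (g := fun z : Matrix (Fin n) (Fin n) F × UpperCoord n F => act z.1 z.2)
    (f := fun y => (γ, y)) continuous_act (continuous_const.prodMk continuous_id)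

theorem continuous_act_left (y : UpperCoord n F) :
    Continuous fun γ : Matrix (Fin n) (Fin n) F => act γ y :=
  Continuous.comp (g := fun z : Matrix (Fin n) (Fin n) F × UpperCoord n F => act z.1 z.2)
    (f := fun γ => (γ, y)) continuous_act (continuous_id.prodMk continuous_const)

end SymmetricCoordinates

section Measure

variable {F : Type*} [NontriviallyNormedField F] [IsUltrametricDist F] [LocallyCompactSpace F]
  [ProperSpace F] [MeasurableSpace F] [BorelSpace F] {n : ℕ} {ϖ δ : F} {q : ℕ}
  {x : Equiv.Perm (Fin n) × (Fin n → ℤ) × (Fin n → F)}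

instance borelSpace_matrix : BorelSpace (Matrix (Fin n) (Fin n) F) :=
  inferInstanceAs (BorelSpace (Fin n → Fin n → F))

instance secondCountableTopology_matrix : SecondCountableTopology (Matrix (Fin n) (Fin n) F) :=
  inferInstanceAs (SecondCountableTopology (Fin n → Fin n → F))

instance sigmaFinite_matrixHaar : SigmaFinite (matrixHaar n F) :=
  inferInstanceAs (SigmaFinite (Measure.pi fun _ : Fin n => Measure.pi fun _ : Fin n =>
    fieldHaar F))

instance isAddHaarMeasure_matrixHaar : (matrixHaar n F).IsAddHaarMeasure := by
  have h : (Measure.pi fun _ : Fin n => Measure.pi fun _ : Fin n =>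
      fieldHaar F).IsAddHaarMeasure := by
    have : MeasurableAdd (Fin n → F) := inferInstance
    infer_instance
  exact h

/-- The Haar measure on the coordinate space of symmetric matrices. -/
noncomputable def coordHaar (n : ℕ) (F : Type*) [NontriviallyNormedField F]
    [LocallyCompactSpace F] [MeasurableSpace F] [BorelSpace F] : Measure (UpperCoord n F) :=
  Measure.pi fun _ => fieldHaar F

instance sigmaFinite_coordHaar : SigmaFinite (coordHaar n F) := by
  unfold coordHaar; infer_instance

instance isAddHaarMeasure_coordHaar : (coordHaar n F).IsAddHaarMeasure := by
  unfold coordHaar; infer_instance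

theorem setOf_entryLE_eq (c : ℝ) : {M : Matrix (Fin n) (Fin n) F | EntryLE M c} =
    Set.pi Set.univ fun _ => Set.pi Set.univ fun _ => Metric.closedBall 0 c :=
  Set.ext fun _ => ⟨fun h i _ j _ => mem_closedBall_zero_iff.mpr (h i j),
    fun h i j => mem_closedBall_zero_iff.mp (h i trivial j trivial)⟩

/-- The coordinate box of radius `c`. -/
def coordBox (n : ℕ) (F : Type*) [NontriviallyNormedField F] (c : ℝ) : Set (UpperCoord n F) :=
  Set.pi Set.univ fun _ => Metric.closedBall 0 c

theorem mem_coordBox {c : ℝ} {x : UpperCoord n F} : x ∈ coordBox n F c ↔ ∀ p, ‖x p‖ ≤ c :=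
  ⟨fun h p => mem_closedBall_zero_iff.mp (h p trivial),
    fun h p _ => mem_closedBall_zero_iff.mpr (h p)⟩

theorem entryLE_iff_mem_coordBox {c : ℝ} {x : UpperCoord n F} :
    EntryLE (symOfUpper x).1 c ↔ x ∈ coordBox n F c :=
  entryLE_symOfUpper_iff.trans mem_coordBox.symm

theorem isCompact_coordBox (c : ℝ) : IsCompact (coordBox n F c) :=
  isCompact_univ_pi fun _ => isCompact_closedBall 0 c

theorem isOpen_coordBox {c : ℝ} (hc : c ≠ 0) : IsOpen (coordBox n F c) :=
  isOpen_set_pi Set.finite_univ fun _ _ => IsUltrametricDist.isOpen_closedBall 0 hc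

theorem coordHaar_coordBox (hF : LocalFieldData ϖ δ q) (k : ℤ) :
    coordHaar n F (coordBox n F (‖ϖ‖ ^ k)) =
      ENNReal.ofReal (‖ϖ‖ ^ k) ^ Fintype.card {p : Fin n × Fin n // p.1 ≤ p.2} := by
  rw [← pi_fieldHaar_box hF]
  congr 1
  exact Set.ext fun _ => mem_coordBox

theorem isCompact_entryLE (c : ℝ) : IsCompact {M : Matrix (Fin n) (Fin n) F | EntryLE M c} := by
  rw [setOf_entryLE_eq]
  exact isCompact_univ_pi fun _ => isCompact_univ_pi fun _ => isCompact_closedBall 0 c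

theorem isOpen_entryLE {c : ℝ} (hc : c ≠ 0) :
    IsOpen {M : Matrix (Fin n) (Fin n) F | EntryLE M c} := by
  rw [setOf_entryLE_eq]
  exact isOpen_set_pi Set.finite_univ fun _ _ => isOpen_set_pi Set.finite_univ fun _ _ =>
    IsUltrametricDist.isOpen_closedBall 0 hc

theorem matrixHaar_entryLE (hF : LocalFieldData ϖ δ q) (k : ℤ) :
    matrixHaar n F {M | EntryLE M (‖ϖ‖ ^ k)} = ENNReal.ofReal (‖ϖ‖ ^ k) ^ (n ^ 2) := by
  have : {M : Matrix (Fin n) (Fin n) F | EntryLE M (‖ϖ‖ ^ k)} =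
      Set.pi Set.univ fun _ => {x : Fin n → F | ∀ j, ‖x j‖ ≤ ‖ϖ‖ ^ k} :=
    Set.ext fun _ => ⟨fun h i _ => h i, fun h i => h i trivial⟩
  rw [this, matrixHaar]
  change (Measure.pi fun _ : Fin n => Measure.pi fun _ : Fin n => fieldHaar F) _ = _
  rw [Measure.pi_pi]
  simp only [pi_fieldHaar_box hF, Finset.prod_const, Finset.card_univ, Fintype.card_fin]
  rw [← pow_mul, pow_two]

theorem isOpen_Gamma0 : IsOpen (Gamma0 n F) := by
  rw [isOpen_iff_mem_nhds]
  intro γ hγ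
  have h1 : {M : Matrix (Fin n) (Fin n) F | EntryLT M 1} =
      Set.pi Set.univ fun _ => Set.pi Set.univ fun _ => Metric.ball 0 1 :=
    Set.ext fun _ => ⟨fun h i _ j _ => mem_ball_zero_iff.mpr (h i j),
      fun h i j => mem_ball_zero_iff.mp (h i trivial j trivial)⟩
  have h2 : IsOpen {M : Matrix (Fin n) (Fin n) F | EntryLT M 1} := by
    rw [h1]
    exact isOpen_set_pi Set.finite_univ fun _ _ => isOpen_set_pi Set.finite_univ fun _ _ =>
      Metric.isOpen_ball
  have h3 : (fun M => -γ + M) ⁻¹' {M | EntryLT M 1} ∈ 𝓝 γ :=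
    (h2.preimage (continuous_const.add continuous_id)).mem_nhds
      (fun i j => by simp)
  filter_upwards [h3] with M hM
  have := add_mem_Gamma0 hγ hM
  rwa [add_neg_cancel_left] at this

theorem measurableSet_Gamma0 : MeasurableSet (Gamma0 n F) := isOpen_Gamma0.measurableSet

theorem matrixHaar_Gamma0_ne_top : matrixHaar n F (Gamma0 n F) ≠ ⊤ :=
  ((measure_mono fun _ h => h.1).trans_lt (isCompact_entryLE 1).measure_lt_top).ne

theorem matrixHaar_Gamma0_ne_zero : matrixHaar n F (Gamma0 n F) ≠ 0 :=
  (isOpen_Gamma0.measure_pos _ ⟨1, one_mem_Gamma0⟩).ne'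

theorem map_mul_right_matrixHaar {γ : Matrix (Fin n) (Fin n) F} (hγ : EntryLE γ 1)
    (hdet : ‖γ.det‖ = 1) : Measure.map (fun M => M * γ) (matrixHaar n F) = matrixHaar n F := by
  have hu := isUnit_det_of_norm hdet
  let e : Matrix (Fin n) (Fin n) F ≃+ Matrix (Fin n) (Fin n) F :=
    { toFun := fun M => M * γ
      invFun := fun M => M * γ⁻¹
      left_inv := fun M => Matrix.mul_nonsing_inv_cancel_right _ _ hu
      right_inv := fun M => Matrix.nonsing_inv_mul_cancel_right _ _ hu
      map_add' := fun M N => Matrix.add_mul M N γ }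
  refine map_eq_of_preserves_compact (matrixHaar n F) e (continuous_id.matrix_mul continuous_const)
    (continuous_id.matrix_mul continuous_const) (isCompact_entryLE 1) (isOpen_entryLE one_ne_zero)
    ⟨1, entryLE_one⟩ ?_
  ext M
  refine ⟨fun h => ?_, fun h => EntryLE.mul_one_right zero_le_one h hγ⟩
  have := EntryLE.mul_one_right zero_le_one (show EntryLE (M * γ) 1 from h) (hγ.inv hdet)
  rwa [Matrix.mul_nonsing_inv_cancel_right _ _ hu] at this

/-- Both γ and γ⁻¹ are integral, so the action preserves the compact open box of integral symmetric
matrices. -/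
theorem map_act_coordHaar {γ : Matrix (Fin n) (Fin n) F} (hγ : EntryLE γ 1)
    (hdet : ‖γ.det‖ = 1) : Measure.map (act γ) (coordHaar n F) = coordHaar n F := by
  have hu := isUnit_det_of_norm hdet
  let e : UpperCoord n F ≃+ UpperCoord n F :=
    { toFun := act γ
      invFun := act γ⁻¹
      left_inv := fun x => by rw [← act_mul, Matrix.nonsing_inv_mul _ hu, act_one]
      right_inv := fun x => by rw [← act_mul, Matrix.mul_nonsing_inv _ hu, act_one]
      map_add' := act_add γ }
  have hint : ∀ {γ : Matrix (Fin n) (Fin n) F} {x : UpperCoord n F}, EntryLE γ 1 →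
      x ∈ coordBox n F 1 → act γ x ∈ coordBox n F 1 := fun {γ x} h h' => by
    rw [← entryLE_iff_mem_coordBox, symOfUpper_act]
    exact EntryLE.mul_one_right zero_le_one (EntryLE.mul_one_right zero_le_one h
      (entryLE_iff_mem_coordBox.mpr h')) h.transpose
  refine map_eq_of_preserves_compact (coordHaar n F) e (continuous_act_right γ)
    (continuous_act_right γ⁻¹)
    (isCompact_coordBox 1) (isOpen_coordBox one_ne_zero) ⟨0, mem_coordBox.mpr (by simp)⟩ ?_
  ext x
  refine ⟨fun h => ?_, fun h => hint hγ h⟩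
  have := hint (hγ.inv hdet) (show act γ x ∈ coordBox n F 1 from h)
  rwa [← act_mul, Matrix.nonsing_inv_mul _ hu, act_one] at this

/-- The orbit of a representative in coordinates. -/
def coordOrbit (ϖ : F) (x : Equiv.Perm (Fin n) × (Fin n → ℤ) × (Fin n → F)) :
    Set (UpperCoord n F) := {y | (symOfUpper y).1 ∈ orbit ϖ x}

theorem exists_radius (hF : LocalFieldData ϖ δ q)
    (x : Equiv.Perm (Fin n) × (Fin n → ℤ) × (Fin n → F)) :
    ∀ᶠ l : ℕ in atTop, ∀ a, ‖ϖ‖ ^ l < ‖ϖ‖ ^ x.2.1 a := by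
  rw [eventually_all]
  intro a
  exact (tendsto_pow_atTop_nhds_zero_of_lt_one (norm_nonneg _) hF.norm_lt_one).eventually_lt_const
    (zpow_pos hF.norm_pos _)

theorem add_mem_coordOrbit (hF : LocalFieldData ϖ δ q) (hx : x ∈ Lam n δ) {y z : UpperCoord n F}
    (hy : y ∈ coordOrbit ϖ x) {l : ℕ} (hl : ∀ a, ‖ϖ‖ ^ l < ‖ϖ‖ ^ x.2.1 a)
    (hz : z ∈ coordBox n F (‖ϖ‖ ^ l)) : y + z ∈ coordOrbit ϖ x := by
  rw [coordOrbit, Set.mem_ofPred_eq, symOfUpper_add]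
  refine add_mem_orbit hF hx hy (symOfUpper z).2 fun a i j => ?_
  exact (entryLE_iff_mem_coordBox.mpr hz i j).trans_lt (hl a)

theorem isOpen_coordOrbit (hF : LocalFieldData ϖ δ q) (hx : x ∈ Lam n δ) :
    IsOpen (coordOrbit ϖ x) := by
  rw [isOpen_iff_mem_nhds]
  intro y hy
  obtain ⟨l, hl⟩ := (exists_radius hF x).exists
  have hc : Continuous fun z : UpperCoord n F => -y + z := continuous_const.add continuous_id
  filter_upwards [((isOpen_coordBox (pow_pos hF.norm_pos l).ne').preimage hc).mem_nhds
    (by simp [mem_coordBox])] with z hz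
  have := add_mem_coordOrbit hF hx hy hl hz
  rwa [add_neg_cancel_left] at this

theorem upper_repS_mem (hx : x ∈ Lam n δ) : upper (repS ϖ x) ∈ coordOrbit ϖ x := by
  rw [coordOrbit, Set.mem_ofPred_eq, symOfUpper_upper (isSymm_repS hx)]
  exact ⟨1, one_mem_Gamma0, by simp⟩

theorem mem_coordOrbit_iff (hx : x ∈ Lam n δ) {y : UpperCoord n F} :
    y ∈ coordOrbit ϖ x ↔ ∃ γ ∈ Gamma0 n F, y = act γ (upper (repS ϖ x)) := by
  constructor
  · rintro ⟨γ, hγ, h⟩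
    refine ⟨γ, hγ, ?_⟩
    rw [act, symOfUpper_upper (isSymm_repS hx), ← h, upper_symOfUpper]
  · rintro ⟨γ, hγ, rfl⟩
    refine ⟨γ, hγ, ?_⟩
    rw [symOfUpper_act, symOfUpper_upper (isSymm_repS hx)]

theorem act_mem_coordOrbit_iff (hx : x ∈ Lam n δ) {γ : Matrix (Fin n) (Fin n) F}
    (hγ : γ ∈ Gamma0 n F) {y : UpperCoord n F} :
    act γ y ∈ coordOrbit ϖ x ↔ y ∈ coordOrbit ϖ x := by
  have key : ∀ {γ : Matrix (Fin n) (Fin n) F} {y : UpperCoord n F}, γ ∈ Gamma0 n F →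
      y ∈ coordOrbit ϖ x → act γ y ∈ coordOrbit ϖ x := by
    intro γ y hγ hy
    obtain ⟨η, hη, rfl⟩ := (mem_coordOrbit_iff hx).mp hy
    exact (mem_coordOrbit_iff hx).mpr ⟨γ * η, mul_mem_Gamma0 hγ hη, (act_mul _ _ _).symm⟩
  refine ⟨fun h => ?_, key hγ⟩
  have := key (inv_mem_Gamma0 hγ) h
  rwa [← act_mul, Matrix.nonsing_inv_mul _ (isUnit_det_of_norm hγ.2.1), act_one] at this

theorem coordHaar_act_preimage_inter (hF : LocalFieldData ϖ δ q) (hx : x ∈ Lam n δ)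
    {s : Set (UpperCoord n F)} (hs : MeasurableSet s) {γ : Matrix (Fin n) (Fin n) F}
    (hγ : γ ∈ Gamma0 n F) :
    coordHaar n F (act γ ⁻¹' s ∩ coordOrbit ϖ x) = coordHaar n F (s ∩ coordOrbit ϖ x) := by
  have h3 : act γ ⁻¹' s ∩ coordOrbit ϖ x = act γ ⁻¹' (s ∩ coordOrbit ϖ x) := by
    ext y
    exact and_congr_right fun _ => (act_mem_coordOrbit_iff hx hγ).symm
  rw [h3, ← Measure.map_apply (continuous_act_right γ).measurable
    (hs.inter (isOpen_coordOrbit hF hx).measurableSet), map_act_coordHaar hγ.1 hγ.2.1]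

/-- Right multiplication by an element of Γ₀ carrying the representative to y preserves both Γ₀ and
its measure, so the base point in the orbit is irrelevant. -/
theorem matrixHaar_act_inter (hx : x ∈ Lam n δ)
    {s : Set (UpperCoord n F)} (hs : MeasurableSet s) {y : UpperCoord n F}
    (hy : y ∈ coordOrbit ϖ x) :
    matrixHaar n F ({γ | act γ y ∈ s} ∩ Gamma0 n F) =
      matrixHaar n F ({γ | act γ (upper (repS ϖ x)) ∈ s} ∩ Gamma0 n F) := by
  obtain ⟨η, hη, rfl⟩ := (mem_coordOrbit_iff hx).mp hy
  have hAm : MeasurableSet {γ | act γ (upper (repS ϖ x)) ∈ s} :=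
    (continuous_act_left _).measurable hs
  have hηc : Continuous fun γ : Matrix (Fin n) (Fin n) F => γ * η :=
    continuous_id.matrix_mul continuous_const
  have h4 : {γ | act γ (act η (upper (repS ϖ x))) ∈ s} ∩ Gamma0 n F =
      (fun γ => γ * η) ⁻¹' ({γ | act γ (upper (repS ϖ x)) ∈ s} ∩ Gamma0 n F) := by
    ext γ
    refine and_congr ?_ ⟨fun h => mul_mem_Gamma0 h hη, fun h => ?_⟩
    · change _ ∈ s ↔ act (γ * η) _ ∈ s
      rw [act_mul]
    · have := mul_mem_Gamma0 h (inv_mem_Gamma0 hη)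
      rwa [Matrix.mul_nonsing_inv_cancel_right _ _ (isUnit_det_of_norm hη.2.1)] at this
  rw [h4, ← Measure.map_apply hηc.measurable (hAm.inter measurableSet_Gamma0),
    map_mul_right_matrixHaar hη.1 hη.2.1]

/-- The Haar measure on an orbit is the image of the Haar measure on `Γ₀`, up to a constant. -/
theorem coordHaar_inter_coordOrbit_mul (hF : LocalFieldData ϖ δ q) (hx : x ∈ Lam n δ)
    {s : Set (UpperCoord n F)} (hs : MeasurableSet s) :
    coordHaar n F (s ∩ coordOrbit ϖ x) * matrixHaar n F (Gamma0 n F) =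
      coordHaar n F (coordOrbit ϖ x) *
        matrixHaar n F ({γ | act γ (upper (repS ϖ x)) ∈ s} ∩ Gamma0 n F) := by
  have hOm : MeasurableSet (coordOrbit ϖ x) := (isOpen_coordOrbit hF hx).measurableSet
  -- The product measure of {(γ, y) : γ·y ∈ s} inside Γ₀ × orbit is computed in both orders. Each
  -- inner measure is constant, by `coordHaar_act_preimage_inter` and `matrixHaar_act_inter`.
  let P : Set (Matrix (Fin n) (Fin n) F × UpperCoord n F) := {z | act z.1 z.2 ∈ s}
  have hP : MeasurableSet P := continuous_act.measurable hs
  have h1 := Measure.prod_apply (μ := (matrixHaar n F).restrict (Gamma0 n F))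
    (ν := (coordHaar n F).restrict (coordOrbit ϖ x)) hP
  have h2 := Measure.prod_apply_symm (μ := (matrixHaar n F).restrict (Gamma0 n F))
    (ν := (coordHaar n F).restrict (coordOrbit ϖ x)) hP
  have h3 : ∀ γ ∈ Gamma0 n F, (coordHaar n F).restrict (coordOrbit ϖ x) (Prod.mk γ ⁻¹' P) =
      coordHaar n F (s ∩ coordOrbit ϖ x) := fun γ hγ => by
    rw [Measure.restrict_apply (measurable_prodMk_left hP)]
    exact coordHaar_act_preimage_inter hF hx hs hγ
  have h4 : ∀ y ∈ coordOrbit ϖ x,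
      (matrixHaar n F).restrict (Gamma0 n F) ((fun γ => (γ, y)) ⁻¹' P) =
      matrixHaar n F ({γ | act γ (upper (repS ϖ x)) ∈ s} ∩ Gamma0 n F) := fun y hy => by
    rw [Measure.restrict_apply (measurable_prodMk_right hP)]
    exact matrixHaar_act_inter hx hs hy
  rw [setLIntegral_congr_fun measurableSet_Gamma0 h3, setLIntegral_const] at h1
  rw [setLIntegral_congr_fun hOm h4, setLIntegral_const] at h2
  rw [← h1, h2, mul_comm]

theorem entryLE_of_mem_orbit (hF : LocalFieldData ϖ δ q) (hx : x ∈ Lam n δ) {c : ℝ} (hc : 0 ≤ c)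
    (h : ∀ a, ‖ϖ‖ ^ x.2.1 a ≤ c) {X : Matrix (Fin n) (Fin n) F} (hX : X ∈ orbit ϖ x) :
    EntryLE X c := by
  obtain ⟨γ, hγ, rfl⟩ := hX
  refine EntryLE.mul_one_right hc (EntryLE.mul_one_left hc hγ.1 fun i j => ?_)
    (EntryLE.transpose hγ.1)
  rw [repS, Matrix.of_apply]
  split_ifs
  · rw [Lam.norm_coeff hF hx]; exact h i
  · simpa using hc

theorem coordHaar_coordOrbit_ne_top (hF : LocalFieldData ϖ δ q) (hx : x ∈ Lam n δ) :
    coordHaar n F (coordOrbit ϖ x) ≠ ⊤ := by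
  have hpos : ∀ a, 0 ≤ ‖ϖ‖ ^ x.2.1 a := fun a => (zpow_pos hF.norm_pos _).le
  set c := ∑ a, ‖ϖ‖ ^ x.2.1 a
  have hsub : coordOrbit ϖ x ⊆ coordBox n F c := fun y hy =>
    entryLE_iff_mem_coordBox.mp (entryLE_of_mem_orbit hF hx (Finset.sum_nonneg fun a _ => hpos a)
      (fun a => Finset.single_le_sum (f := fun a => ‖ϖ‖ ^ x.2.1 a) (fun a _ => hpos a)
        (Finset.mem_univ a)) hy)
  exact ((measure_mono hsub).trans_lt (isCompact_coordBox c).measure_lt_top).ne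

theorem coordHaar_coordOrbit_ne_zero (hF : LocalFieldData ϖ δ q) (hx : x ∈ Lam n δ) :
    coordHaar n F (coordOrbit ϖ x) ≠ 0 :=
  ((isOpen_coordOrbit hF hx).measure_pos _ ⟨_, upper_repS_mem hx⟩).ne'

/-- The integral over an orbit. -/
theorem setIntegral_coordOrbit (hF : LocalFieldData ϖ δ q) (hx : x ∈ Lam n δ)
    {φ : UpperCoord n F → ℂ} (hφ : StronglyMeasurable φ) :
    ∫ y in coordOrbit ϖ x, φ y ∂(coordHaar n F) =
      ((coordHaar n F).real (coordOrbit ϖ x) / (matrixHaar n F).real (Gamma0 n F) : ℝ) *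
        ∫ γ in Gamma0 n F, φ (act γ (upper (repS ϖ x))) ∂(matrixHaar n F) := by
  have hcont' := continuous_act_left (upper (repS ϖ x))
  -- The double count, read as an identity of measures: restricted Haar measure is a multiple of the
  -- image of Haar measure on Γ₀.
  have hmeas : (coordHaar n F).restrict (coordOrbit ϖ x) =
      (coordHaar n F (coordOrbit ϖ x) / matrixHaar n F (Gamma0 n F)) •
        Measure.map (fun γ => act γ (upper (repS ϖ x)))
          ((matrixHaar n F).restrict (Gamma0 n F)) := by
    ext s hs
    rw [Measure.restrict_apply hs, Measure.smul_apply, Measure.map_apply hcont'.measurable hs,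
      Measure.restrict_apply (hcont'.measurable hs), smul_eq_mul, ENNReal.div_eq_inv_mul,
      mul_assoc, Set.preimage, ← coordHaar_inter_coordOrbit_mul hF hx hs, mul_comm,
      ENNReal.mul_inv_cancel_right matrixHaar_Gamma0_ne_zero matrixHaar_Gamma0_ne_top]
  rw [hmeas, integral_smul_measure, integral_map hcont'.aemeasurable hφ.aestronglyMeasurable,
    ENNReal.toReal_div, Complex.real_smul]
  rfl

end Measure

end RamifiedSiegel

/-! ### Local densities as quotients of volumes. -/

namespace RamifiedSiegel

section Density

/-- The exponent n(n-1)/2 in the density is the dimension of all matrices minus that of the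
symmetric ones. -/
theorem card_upper_add_choose (n : ℕ) :
    Fintype.card {p : Fin n × Fin n // p.1 ≤ p.2} + n.choose 2 = n ^ 2 := by
  have h1 : Fintype.card {p : Fin n × Fin n // ¬ p.1 ≤ p.2} = n.choose 2 := by
    rw [Fintype.card_subtype]
    have : (Finset.univ.filter fun p : Fin n × Fin n => ¬ p.1 ≤ p.2) =
        Finset.univ.biUnion fun i : Fin n => (Finset.Iio i).image fun j => (i, j) := by
      ext ⟨i, j⟩; simp
    rw [this, Finset.card_biUnion]
    · simp only [Finset.card_image_of_injective _ (Prod.mk_right_injective _), Fin.card_Iio]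
      rw [Fin.sum_univ_eq_sum_range (fun i => i) n, Finset.sum_range_id, Nat.choose_two_right]
    · intro i _ j _ hij
      rw [Function.onFun, Finset.disjoint_left]
      simp only [Finset.mem_image]
      rintro _ ⟨a, -, rfl⟩ ⟨b, -, h⟩
      exact hij (congrArg Prod.fst h).symm
  rw [← h1, Fintype.card_subtype_compl, Fintype.card_prod, Fintype.card_fin, pow_two]
  have := Fintype.card_subtype_le fun p : Fin n × Fin n => p.1 ≤ p.2
  rw [Fintype.card_prod, Fintype.card_fin] at this
  omega

variable {F : Type*} [NontriviallyNormedField F] [IsUltrametricDist F] [LocallyCompactSpace F]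
  [ProperSpace F] [MeasurableSpace F] [BorelSpace F] {n : ℕ} {ϖ δ : F} {q : ℕ}
  {x : Equiv.Perm (Fin n) × (Fin n → ℤ) × (Fin n → F)}

theorem finite_image_mk_of_isOpen {L : AddSubgroup (Matrix (Fin n) (Fin n) F)}
    (hL : IsOpen (L : Set (Matrix (Fin n) (Fin n) F))) {A : Set (Matrix (Fin n) (Fin n) F)}
    (hA : ∀ M ∈ A, EntryLE M 1) :
    ((QuotientAddGroup.mk : _ → Matrix (Fin n) (Fin n) F ⧸ L) '' A).Finite := by
  have := QuotientAddGroup.discreteTopology hL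
  refine Set.Finite.subset ?_ (Set.image_mono (show A ⊆ {M | EntryLE M 1} from hA))
  exact ((isCompact_entryLE 1).image QuotientAddGroup.continuous_mk).finite_of_discrete

/-- A set stable under translation by an open subgroup is a union of cosets. -/
theorem matrixHaar_eq_ncard_mul {L : AddSubgroup (Matrix (Fin n) (Fin n) F)}
    (hL : IsOpen (L : Set (Matrix (Fin n) (Fin n) F))) {A : Set (Matrix (Fin n) (Fin n) F)}
    (hA : ∀ M ∈ A, EntryLE M 1) (hstable : ∀ M ∈ A, ∀ N ∈ L, M + N ∈ A) :
    matrixHaar n F A =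
      ((QuotientAddGroup.mk : _ → Matrix (Fin n) (Fin n) F ⧸ L) '' A).ncard *
        matrixHaar n F (L : Set (Matrix (Fin n) (Fin n) F)) := by
  classical
  have hfin := finite_image_mk_of_isOpen hL hA
  have hcover : A = ⋃ t ∈ hfin.toFinset,
      (QuotientAddGroup.mk : _ → Matrix (Fin n) (Fin n) F ⧸ L) ⁻¹' {t} := by
    ext M
    simp only [Set.Finite.mem_toFinset, Set.mem_iUnion, Set.mem_preimage, Set.mem_singleton_iff,
      exists_prop, exists_eq_right', Set.mem_image]
    refine ⟨fun h => ⟨M, h, rfl⟩, ?_⟩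
    rintro ⟨M', hM', h⟩
    have := hstable M' hM' _ (QuotientAddGroup.eq.mp h)
    rwa [add_neg_cancel_left] at this
  have hfib : ∀ M : Matrix (Fin n) (Fin n) F,
      (QuotientAddGroup.mk : _ → Matrix (Fin n) (Fin n) F ⧸ L) ⁻¹' {(M : _ ⧸ L)} =
        (fun N => -M + N) ⁻¹' (L : Set (Matrix (Fin n) (Fin n) F)) := fun M => by
    ext N
    rw [Set.mem_preimage, Set.mem_singleton_iff, eq_comm, QuotientAddGroup.eq]
    rfl
  have hc : ∀ M : Matrix (Fin n) (Fin n) F, Continuous fun N => -M + N := fun M =>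
    continuous_const.add continuous_id
  rw [Set.ncard_eq_toFinset_card _ hfin]
  conv_lhs => rw [hcover]
  rw [measure_biUnion_finset]
  · rw [Finset.sum_congr rfl (g := fun _ => matrixHaar n F (L : Set (Matrix (Fin n) (Fin n) F)))]
    · rw [Finset.sum_const, nsmul_eq_mul]
    · intro t _
      obtain ⟨M, rfl⟩ := QuotientAddGroup.mk_surjective t
      rw [hfib, measure_preimage_add]
  · intro t _ t' _ hne
    exact (Set.disjoint_singleton.mpr hne).preimage _
  · intro t _
    obtain ⟨M, rfl⟩ := QuotientAddGroup.mk_surjective t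
    rw [hfib]
    exact (hL.preimage (hc M)).measurableSet

theorem coe_congrLattice (k : ℕ) : (congrLattice n ϖ k : Set (Matrix (Fin n) (Fin n) F)) =
    {M | EntryLE M (‖ϖ‖ ^ k)} := rfl

theorem norm_pow_denExp_mul_le (hF : LocalFieldData ϖ δ q) (Y : Matrix (Fin n) (Fin n) F)
    (i j : Fin n) : ‖ϖ ^ denExp ϖ Y * Y i j‖ ≤ 1 := by
  have hne : {m : ℕ | ∀ i j, ‖ϖ ^ m * Y i j‖ ≤ 1}.Nonempty := by
    obtain ⟨c, hc, hY⟩ := exists_entryLE Y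
    obtain ⟨m, hm⟩ := exists_pow_lt_of_lt_one (inv_pos.mpr hc) hF.norm_lt_one
    refine ⟨m, fun i j => ?_⟩
    rw [norm_mul, norm_pow]
    calc ‖ϖ‖ ^ m * ‖Y i j‖ ≤ c⁻¹ * c := by gcongr; exact hY i j
      _ = 1 := inv_mul_cancel₀ hc.ne'
  exact Nat.sInf_mem hne i j

/-- In the expansion every term contains M Y or Y ᵗM, and multiplication by Y costs at most ‖ϖ‖^(-m)
for m the denominator exponent. Hence the congruence modulo 𝔭^l only sees γ modulo 𝔭^(l+m). -/
theorem entryLE_congr_diff (hF : LocalFieldData ϖ δ q) {γ M Y : Matrix (Fin n) (Fin n) F} {l : ℕ}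
    (hγ : EntryLE γ 1) (hM : EntryLE M (‖ϖ‖ ^ (l + denExp ϖ Y))) :
    EntryLE ((γ + M) * Y * (γ + M)ᵀ - γ * Y * γᵀ) (‖ϖ‖ ^ l) := by
  have hpos : 0 < ‖ϖ‖ ^ denExp ϖ Y := pow_pos hF.norm_pos _
  have hl0 : 0 ≤ ‖ϖ‖ ^ l := pow_nonneg (norm_nonneg _) _
  have hY : EntryLE Y (‖ϖ‖ ^ denExp ϖ Y)⁻¹ := fun i j => by
    have := norm_pow_denExp_mul_le hF Y i j
    rw [norm_mul, norm_pow] at this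
    rwa [← one_div, le_div_iff₀' hpos]
  have hM1 : EntryLE M 1 := fun i j =>
    (hM i j).trans (pow_le_one₀ (norm_nonneg _) hF.norm_lt_one.le)
  have hMY : EntryLE (M * Y) (‖ϖ‖ ^ l) := by
    have := EntryLE.mul (inv_nonneg.mpr hpos.le) (pow_nonneg (norm_nonneg _) _) hM hY
    rwa [pow_add, mul_inv_cancel_right₀ hpos.ne'] at this
  have hYM : EntryLE (Y * Mᵀ) (‖ϖ‖ ^ l) := by
    have := EntryLE.mul (pow_nonneg (norm_nonneg _) _) (inv_nonneg.mpr hpos.le) hY hM.transpose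
    rwa [pow_add, mul_comm, mul_inv_cancel_right₀ hpos.ne'] at this
  have heq : (γ + M) * Y * (γ + M)ᵀ - γ * Y * γᵀ = M * Y * (γ + M)ᵀ + γ * (Y * Mᵀ) := by
    rw [Matrix.transpose_add]; noncomm_ring
  rw [heq]
  exact (EntryLE.mul_one_right hl0 hMY (hγ.add hM1).transpose).add
    (EntryLE.mul_one_left hl0 hγ hYM)

/-- Once l is large, the ball of radius ‖ϖ‖^l around S lies in the orbit, and its preimage in Γ₀ is
the solution set A. The double count gives vol(ball)·vol(Γ₀) = vol(orbit)·vol(A), where vol(A) is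
the number of classes times q^(-(l+m)n²). Here l ≥ 1 ensures that translation by the lattice
preserves Γ₀. -/
theorem densitySeq_eq (hF : LocalFieldData ϖ δ (resCard F)) (hx : x ∈ Lam n δ) {l : ℕ}
    (hl : ∀ a, ‖ϖ‖ ^ l < ‖ϖ‖ ^ x.2.1 a) (hl1 : 1 ≤ l) :
    densitySeq ϖ (repS ϖ x) l =
      (matrixHaar n F).real (Gamma0 n F) / (coordHaar n F).real (coordOrbit ϖ x) := by
  set Y := repS ϖ x with hY
  set m := denExp ϖ Y with hm
  set A : Set (Matrix (Fin n) (Fin n) F) :=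
    {γ | γ ∈ Gamma0 n F ∧ γ * Y * γᵀ - Y ∈ congrLattice n ϖ l} with hA
  have hpos := hF.norm_pos
  have hcount := matrixHaar_eq_ncard_mul (L := congrLattice n ϖ (l + m)) (A := A)
    (isOpen_entryLE (pow_pos hpos _).ne') (fun M h => h.1.1) (fun M hM N hN => by
      have hN' : EntryLE N (‖ϖ‖ ^ (l + m)) := hN
      refine ⟨add_mem_Gamma0 hM.1 fun i j => (hN' i j).trans_lt
        (pow_lt_one₀ (norm_nonneg _) hF.norm_lt_one (by omega)), ?_⟩
      have h1 := entryLE_congr_diff hF hM.1.1 hN'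
      have h2 := (congrLattice n ϖ l).add_mem (show _ ∈ congrLattice n ϖ l from h1) hM.2
      rwa [sub_add_sub_cancel] at h2)
  have hbox : (fun z => -upper Y + z) ⁻¹' coordBox n F (‖ϖ‖ ^ l) ∩ coordOrbit ϖ x =
      (fun z => -upper Y + z) ⁻¹' coordBox n F (‖ϖ‖ ^ l) := by
    refine Set.inter_eq_left.mpr fun z hz => ?_
    have := add_mem_coordOrbit hF hx (upper_repS_mem hx) hl hz
    rwa [← hY, add_neg_cancel_left] at this
  have hs : MeasurableSet ((fun z => -upper Y + z) ⁻¹' coordBox n F (‖ϖ‖ ^ l)) :=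
    ((isOpen_coordBox (pow_pos hpos l).ne').preimage
      (continuous_const.add continuous_id)).measurableSet
  have hmeas := coordHaar_inter_coordOrbit_mul hF hx hs
  have hAeq : {γ | act γ (upper Y) ∈ (fun z => -upper Y + z) ⁻¹' coordBox n F (‖ϖ‖ ^ l)} ∩
      Gamma0 n F = A := by
    ext γ
    rw [hA, Set.inter_comm]
    refine and_congr_right fun _ => ?_
    change -upper Y + act γ (upper Y) ∈ coordBox n F (‖ϖ‖ ^ l) ↔
      EntryLE (γ * Y * γᵀ - Y) (‖ϖ‖ ^ l)
    rw [neg_add_eq_sub, ← entryLE_iff_mem_coordBox, symOfUpper_sub, symOfUpper_act,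
      symOfUpper_upper (isSymm_repS hx)]
  rw [hbox, ← hY, hAeq, measure_preimage_add, hcount, coe_congrLattice] at hmeas
  have hb1 := coordHaar_coordBox (n := n) hF l
  have hb2 := matrixHaar_entryLE (n := n) hF ((l + m : ℕ) : ℤ)
  rw [zpow_natCast] at hb1 hb2
  rw [hb1, hb2] at hmeas
  have hreal := congrArg ENNReal.toReal hmeas
  simp only [ENNReal.toReal_mul, ENNReal.toReal_pow, ENNReal.toReal_natCast,
    ENNReal.toReal_ofReal (pow_nonneg hpos.le _)] at hreal
  have hO : (coordHaar n F).real (coordOrbit ϖ x) ≠ 0 :=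
    ENNReal.toReal_ne_zero.mpr ⟨coordHaar_coordOrbit_ne_zero hF hx,
      coordHaar_coordOrbit_ne_top hF hx⟩
  rw [densitySeq, solCount, eq_div_iff hO, ← hm]
  change ((QuotientAddGroup.mk '' A).ncard : ℝ) / _ / _ * _ = _
  have hq0 : (resCard F : ℝ) ≠ 0 := by
    have := hF.one_lt; positivity
  rw [← Measure.real, ← Measure.real, hF.norm_unif] at hreal
  set N := ((QuotientAddGroup.mk : _ → Matrix (Fin n) (Fin n) F ⧸ congrLattice n ϖ (l + m)) ''
    A).ncard
  rw [← pow_mul, ← pow_mul, ← card_upper_add_choose n, inv_pow, inv_pow] at hreal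
  rw [← card_upper_add_choose n, div_div, div_mul_eq_mul_div, div_eq_iff (by positivity)]
  field_simp at hreal
  -- Of the exponent (l+m)n², the part l·n(n+1)/2 cancels the volume of the ball, m·n² is the weight
  -- in `solCount`, and l·n(n-1)/2 normalizes the density.
  have e1 : (l + m) * (Fintype.card {p : Fin n × Fin n // p.1 ≤ p.2} + n.choose 2) =
      l * Fintype.card {p : Fin n × Fin n // p.1 ≤ p.2} +
      (m * (Fintype.card {p : Fin n × Fin n // p.1 ≤ p.2} + n.choose 2) + l * n.choose 2) := by
    ring
  rw [e1, pow_add] at hreal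
  have hql : (resCard F : ℝ) ^ (l * Fintype.card {p : Fin n × Fin n // p.1 ≤ p.2}) ≠ 0 := by
    positivity
  refine mul_left_cancel₀ hql ?_
  rw [← pow_add]
  linear_combination -hreal

theorem tendsto_densitySeq (hF : LocalFieldData ϖ δ (resCard F)) (hx : x ∈ Lam n δ) :
    Tendsto (densitySeq ϖ (repS ϖ x)) atTop
      (𝓝 ((matrixHaar n F).real (Gamma0 n F) / (coordHaar n F).real (coordOrbit ϖ x))) := by
  refine tendsto_const_nhds.congr' ?_
  filter_upwards [exists_radius hF x, eventually_ge_atTop 1] with l hl hl1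
  exact (densitySeq_eq hF hx hl hl1).symm

theorem localDensity_eq (hF : LocalFieldData ϖ δ (resCard F)) (hx : x ∈ Lam n δ) :
    localDensity ϖ (repS ϖ x) =
      (matrixHaar n F).real (Gamma0 n F) / (coordHaar n F).real (coordOrbit ϖ x) :=
  (tendsto_densitySeq hF hx).limUnder_eq

theorem localDensity_pos (hF : LocalFieldData ϖ δ (resCard F)) (hx : x ∈ Lam n δ) :
    0 < localDensity ϖ (repS ϖ x) := by
  rw [localDensity_eq hF hx]
  exact div_pos (ENNReal.toReal_pos matrixHaar_Gamma0_ne_zero matrixHaar_Gamma0_ne_top)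
    (ENNReal.toReal_pos (coordHaar_coordOrbit_ne_zero hF hx) (coordHaar_coordOrbit_ne_top hF hx))

end Density

end RamifiedSiegel

/-! ### Existence of the standard section, supported on the open cell. -/

namespace RamifiedSiegel

section Character

variable {F : Type*} [NontriviallyNormedField F] [IsUltrametricDist F] {ϖ δ : F} {q : ℕ}
  {ω : MulChar F ℂ}

theorem quadratic_mul_self (hω : ω ^ 2 = 1) {a : F} (ha : a ≠ 0) : ω a * ω a = 1 := by
  have h := congrArg (fun χ : MulChar F ℂ => χ a) hω
  simp only [pow_two, MulChar.mul_apply] at h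
  rw [h, MulChar.one_apply ha.isUnit]

theorem quadratic_inv (hω : ω ^ 2 = 1) {a : F} (ha : a ≠ 0) : ω a⁻¹ = ω a := by
  have h1 : ω a⁻¹ * ω a = 1 := by rw [← map_mul, inv_mul_cancel₀ ha, map_one]
  have h2 := quadratic_mul_self hω ha
  have h3 : ω a ≠ 0 := fun h => by simp [h] at h2
  exact mul_right_cancel₀ h3 (h1.trans h2.symm)

/-- Elements of 1 + 𝔭 are squares, so a quadratic character is trivial on them. -/
theorem quadratic_eq_one (hF : LocalFieldData ϖ δ q) (hω : ω ^ 2 = 1) {u : F}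
    (hu : ‖u - 1‖ < 1) : ω u = 1 := by
  obtain ⟨r, hr, hr2⟩ := hF.sqrt (u - 1) hu
  have hr0 : r ≠ 0 := by rintro rfl; simp at hr
  have : u = r * r := by rw [← pow_two, hr2]; ring
  rw [this, map_mul, quadratic_mul_self hω hr0]

theorem quadratic_eq_of_sub_lt (hF : LocalFieldData ϖ δ q) (hω : ω ^ 2 = 1) {u v : F}
    (hv : ‖v‖ = 1) (hu : ‖u - v‖ < 1) : ω u = ω v := by
  have hv0 : v ≠ 0 := fun h => by simp [h] at hv
  have h1 : ω (u / v) = 1 := quadratic_eq_one hF hω (by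
    rw [div_sub_one hv0, norm_div, hv, div_one]; exact hu)
  rw [show u = u / v * v by field_simp, map_mul, h1, one_mul]

theorem norm_inv_cpow_neg {r : ℝ} (hr : 0 < r) (s : ℂ) : ((r⁻¹ : ℝ) : ℂ) ^ (-s) = (r : ℂ) ^ s := by
  rw [Complex.ofReal_inv, Complex.inv_cpow, Complex.cpow_neg, inv_inv]
  rw [Complex.arg_ofReal_of_nonneg hr.le]
  exact Real.pi_pos.ne

end Character

section Blocks

variable {F : Type*} [NontriviallyNormedField F] [IsUltrametricDist F] {n : ℕ}

/-- The upper right block. -/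
def blockB (g : Sp n F) : Matrix (Fin n) (Fin n) F :=
  (g : Matrix (Fin n ⊕ Fin n) (Fin n ⊕ Fin n) F).toBlocks₁₂

theorem eq_fromBlocks (g : Sp n F) :
    (g : Matrix (Fin n ⊕ Fin n) (Fin n ⊕ Fin n) F) =
      Matrix.fromBlocks (blockA g) (blockB g) (blockC g) (blockD g) :=
  (Matrix.fromBlocks_toBlocks _).symm

theorem block_relation (g : Sp n F) : (blockA g)ᵀ * blockD g - (blockC g)ᵀ * blockB g = 1 := by
  have h := g.2
  rw [eq_fromBlocks g, SymplecticGroup.fromBlocks_mem_iff] at h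
  exact h.2.2

theorem coe_mul_eq_fromBlocks (g h : Sp n F) :
    ((g * h : Sp n F) : Matrix (Fin n ⊕ Fin n) (Fin n ⊕ Fin n) F) =
      Matrix.fromBlocks (blockA g * blockA h + blockB g * blockC h)
        (blockA g * blockB h + blockB g * blockD h) (blockC g * blockA h + blockD g * blockC h)
        (blockC g * blockB h + blockD g * blockD h) := by
  rw [Submonoid.coe_mul, eq_fromBlocks g, eq_fromBlocks h, Matrix.fromBlocks_multiply]

theorem blockC_mul (g h : Sp n F) :
    blockC (g * h) = blockC g * blockA h + blockD g * blockC h := by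
  rw [blockC, coe_mul_eq_fromBlocks, Matrix.toBlocks_fromBlocks₂₁]

theorem blockD_mul (g h : Sp n F) :
    blockD (g * h) = blockC g * blockB h + blockD g * blockD h := by
  rw [blockD, coe_mul_eq_fromBlocks, Matrix.toBlocks_fromBlocks₂₂]

theorem coe_inv_eq_fromBlocks (g : Sp n F) :
    ((g⁻¹ : Sp n F) : Matrix (Fin n ⊕ Fin n) (Fin n ⊕ Fin n) F) =
      Matrix.fromBlocks (blockD g)ᵀ (-(blockB g)ᵀ) (-(blockC g)ᵀ) (blockA g)ᵀ := by
  rw [SymplecticGroup.coe_inv, eq_fromBlocks g, Matrix.J, Matrix.fromBlocks_transpose,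
    Matrix.fromBlocks_neg, Matrix.fromBlocks_multiply, Matrix.fromBlocks_multiply]
  simp

theorem siegelGamma_entry {k : Sp n F} (hk : k ∈ siegelGamma n F) :
    EntryLE (blockA k) 1 ∧ EntryLE (blockB k) 1 ∧ EntryLT (blockC k) 1 ∧ EntryLE (blockD k) 1 :=
  ⟨fun _ _ => hk.1 _ _, fun _ _ => hk.1 _ _, hk.2, fun _ _ => hk.1 _ _⟩

theorem mem_siegelGamma_of_coe_eq {k : Sp n F} {A B C D : Matrix (Fin n) (Fin n) F}
    (hk : (k : Matrix (Fin n ⊕ Fin n) (Fin n ⊕ Fin n) F) = Matrix.fromBlocks A B C D)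
    (hA : EntryLE A 1) (hB : EntryLE B 1) (hC : EntryLT C 1) (hD : EntryLE D 1) :
    k ∈ siegelGamma n F := by
  refine ⟨?_, fun i j => ?_⟩
  · rw [hk]
    rintro (i | i) (j | j)
    exacts [hA i j, hB i j, (hC i j).le, hD i j]
  · rw [blockC, hk, Matrix.toBlocks_fromBlocks₂₁]; exact hC i j

theorem inv_mem_siegelGamma {k : Sp n F} (hk : k ∈ siegelGamma n F) : k⁻¹ ∈ siegelGamma n F := by
  obtain ⟨hA, hB, hC, hD⟩ := siegelGamma_entry hk
  exact mem_siegelGamma_of_coe_eq (coe_inv_eq_fromBlocks k) hD.transpose hB.transpose.neg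
    hC.transpose.neg hA.transpose

/-- The symplectic relation gives ᵗA D = 1 + ᵗC B ≡ 1 mod 𝔭. So det A · det D is a unit while both
factors are integral. -/
theorem norm_det_blockD_eq_one {k : Sp n F} (hk : k ∈ siegelGamma n F) :
    ‖(blockD k).det‖ = 1 := by
  obtain ⟨hA, hB, hC, hD⟩ := siegelGamma_entry hk
  have h1 : (blockA k)ᵀ * blockD k = 1 + (blockC k)ᵀ * blockB k := by
    rw [← block_relation k, sub_add_cancel]
  have h2 : ‖((blockA k)ᵀ * blockD k).det‖ = 1 := by
    rw [h1, ← norm_one (α := F), ← Matrix.det_one (n := Fin n) (R := F)]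
    refine norm_eq_of_sub_lt ?_
    rw [Matrix.det_one, norm_one, ← Matrix.det_one (n := Fin n) (R := F)]
    exact norm_det_add_sub_det_lt_one entryLE_one
      (EntryLT.mul_one_right one_pos hC.transpose hB)
  rw [Matrix.det_mul, Matrix.det_transpose, norm_mul] at h2
  refine le_antisymm (norm_det_le_one hD) ?_
  rw [← h2]
  exact mul_le_of_le_one_left (norm_nonneg _) (norm_det_le_one hA)

theorem det_blockD_parabolic {p : Sp n F} (hp : p ∈ siegelParabolic n F) :
    (blockD p).det = (blockA p).det⁻¹ ∧ (blockA p).det ≠ 0 := by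
  have h := block_relation p
  rw [show blockC p = 0 from hp, Matrix.transpose_zero, Matrix.zero_mul, sub_zero] at h
  have h' := congrArg Matrix.det h
  rw [Matrix.det_mul, Matrix.det_transpose, Matrix.det_one] at h'
  exact ⟨eq_inv_of_mul_eq_one_right h', left_ne_zero_of_mul_eq_one h'⟩

end Blocks

section Existence

variable {F : Type*} [NontriviallyNormedField F] [IsUltrametricDist F] {n : ℕ} {ϖ δ : F} {q : ℕ}
  {ω : MulChar F ℂ}

/-- The open cell `P Γ` of `Sp_n(F)`. -/
def openCell (n : ℕ) (F : Type*) [NontriviallyNormedField F] : Set (Sp n F) :=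
  {g | (blockD g).det ≠ 0 ∧ EntryLT ((blockD g)⁻¹ * blockC g) 1}

/-- Left multiplication by P multiplies C and D by the same invertible matrix, leaving D⁻¹C
unchanged. -/
theorem parabolic_mul_mem_openCell_iff {p : Sp n F} (hp : p ∈ siegelParabolic n F) (g : Sp n F) :
    p * g ∈ openCell n F ↔ g ∈ openCell n F := by
  obtain ⟨h1, h2⟩ := det_blockD_parabolic hp
  have hu : IsUnit (blockD p).det := by rw [h1]; exact (inv_ne_zero h2).isUnit
  have hC : blockC (p * g) = blockD p * blockC g := by
    rw [blockC_mul, show blockC p = 0 from hp, Matrix.zero_mul, zero_add]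
  have hD : blockD (p * g) = blockD p * blockD g := by
    rw [blockD_mul, show blockC p = 0 from hp, Matrix.zero_mul, zero_add]
  rw [openCell, Set.mem_ofPred_eq, Set.mem_ofPred_eq, hC, hD, Matrix.det_mul, Matrix.mul_inv_rev,
    Matrix.mul_assoc, Matrix.nonsing_inv_mul_cancel_left _ _ hu]
  simp [h1, h2]

/-- With D_g factored out, what remains is congruent to D_k modulo 𝔭. This governs both the
stability of the cell under Γ and the value of `ω` there. -/
theorem blockD_mul_gamma {g k : Sp n F} (hg : g ∈ openCell n F) :
    blockD (g * k) = blockD g * (blockD k + (blockD g)⁻¹ * blockC g * blockB k) := by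
  rw [blockD_mul, Matrix.mul_add, ← Matrix.mul_assoc, ← Matrix.mul_assoc,
    Matrix.mul_nonsing_inv _ hg.1.isUnit, Matrix.one_mul, add_comm]

theorem norm_det_add_sub_lt {g k : Sp n F} (hg : g ∈ openCell n F) (hk : k ∈ siegelGamma n F) :
    ‖(blockD k + (blockD g)⁻¹ * blockC g * blockB k).det - (blockD k).det‖ < 1 := by
  obtain ⟨hA, hB, hC, hD⟩ := siegelGamma_entry hk
  exact norm_det_add_sub_det_lt_one hD (EntryLT.mul_one_right one_pos hg.2 hB)

theorem norm_det_add_eq_one {g k : Sp n F} (hg : g ∈ openCell n F) (hk : k ∈ siegelGamma n F) :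
    ‖(blockD k + (blockD g)⁻¹ * blockC g * blockB k).det‖ = 1 := by
  rw [← norm_det_blockD_eq_one hk]
  refine norm_eq_of_sub_lt ?_
  rw [norm_det_blockD_eq_one hk]
  exact norm_det_add_sub_lt hg hk

theorem mul_gamma_mem_openCell {g k : Sp n F} (hg : g ∈ openCell n F)
    (hk : k ∈ siegelGamma n F) : g * k ∈ openCell n F := by
  obtain ⟨hA, hB, hC, hD⟩ := siegelGamma_entry hk
  have hu := hg.1.isUnit
  set E := (blockD g)⁻¹ * blockC g with hE
  have hCg : blockC g = blockD g * E := by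
    rw [hE, Matrix.mul_nonsing_inv_cancel_left _ _ hu]
  have hDu := norm_det_add_eq_one hg hk
  have hDk := blockD_mul_gamma (k := k) hg
  rw [← hE] at hDu hDk
  refine ⟨?_, ?_⟩
  · rw [hDk, Matrix.det_mul]
    exact mul_ne_zero hg.1 (norm_ne_zero_iff.mp (by rw [hDu]; exact one_ne_zero))
  · have hCk : blockC (g * k) = blockD g * (E * blockA k + blockC k) := by
      rw [blockC_mul, Matrix.mul_add, ← Matrix.mul_assoc, ← hCg]
    rw [hDk, hCk, Matrix.mul_inv_rev, Matrix.mul_assoc, Matrix.nonsing_inv_mul_cancel_left _ _ hu]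
    exact EntryLT.mul_one_left one_pos
      (EntryLE.inv (hD.add (EntryLT.mul_one_right one_pos hg.2 hB).le) hDu)
      ((EntryLT.mul_one_right one_pos hg.2 hA).add hC)

theorem mul_gamma_mem_openCell_iff {k : Sp n F} (hk : k ∈ siegelGamma n F) (g : Sp n F) :
    g * k ∈ openCell n F ↔ g ∈ openCell n F := by
  refine ⟨fun h => ?_, fun h => mul_gamma_mem_openCell h hk⟩
  have := mul_gamma_mem_openCell h (inv_mem_siegelGamma hk)
  rwa [mul_inv_cancel_right] at this

open Classical in
/-- The section supported on the open cell. -/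
noncomputable def cellSection (ω : MulChar F ℂ) (s : ℂ) (g : Sp n F) : ℂ :=
  if g ∈ openCell n F then
    ω (blockD g).det * ((‖(blockD g).det‖ : ℝ) : ℂ) ^ (-s) else 0

/-- On P one has det D = (det A)⁻¹; the inverse is invisible to the quadratic `ω` and reverses the
sign of the exponent -s. -/
theorem cellSection_left (hω : ω ^ 2 = 1) (s : ℂ) {p : Sp n F} (hp : p ∈ siegelParabolic n F)
    (g : Sp n F) : cellSection ω s (p * g) =
      ω (blockA p).det * ((‖(blockA p).det‖ : ℝ) : ℂ) ^ s * cellSection ω s g := by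
  obtain ⟨h1, h2⟩ := det_blockD_parabolic hp
  by_cases hg : g ∈ openCell n F
  · rw [cellSection, if_pos ((parabolic_mul_mem_openCell_iff hp g).mpr hg), cellSection,
      if_pos hg, blockD_mul, show blockC p = 0 from hp, Matrix.zero_mul, zero_add, Matrix.det_mul,
      map_mul, h1, quadratic_inv hω h2, norm_mul, norm_inv, Complex.ofReal_mul,
      Complex.mul_cpow_ofReal_nonneg (inv_nonneg.mpr (norm_nonneg _)) (norm_nonneg _),
      norm_inv_cpow_neg (norm_pos_iff.mpr h2)]
    ring
  · rw [cellSection, if_neg fun h => hg ((parabolic_mul_mem_openCell_iff hp g).mp h), cellSection,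
      if_neg hg, mul_zero]

theorem cellSection_right (hF : LocalFieldData ϖ δ q) (hω : ω ^ 2 = 1) (s : ℂ) {k : Sp n F}
    (hk : k ∈ siegelGamma n F) (g : Sp n F) :
    cellSection ω s (g * k) = ω (blockD k).det * cellSection ω s g := by
  by_cases hg : g ∈ openCell n F
  · rw [cellSection, if_pos ((mul_gamma_mem_openCell_iff hk g).mpr hg), cellSection, if_pos hg,
      blockD_mul_gamma hg, Matrix.det_mul, map_mul, norm_mul, norm_det_add_eq_one hg hk, mul_one,
      quadratic_eq_of_sub_lt hF hω (norm_det_blockD_eq_one hk) (norm_det_add_sub_lt hg hk)]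
    ring
  · rw [cellSection, if_neg fun h => hg ((mul_gamma_mem_openCell_iff hk g).mp h), cellSection,
      if_neg hg, mul_zero]

/-- Every h close to g is g k with k ≡ 1 mod 𝔭. Such k lies in Γ, and det D_k lies in 1 + 𝔭, where
`ω` is trivial. -/
theorem isLocallyConstant_cellSection (hF : LocalFieldData ϖ δ q) (hω : ω ^ 2 = 1) (s : ℂ) :
    IsLocallyConstant (cellSection ω s : Sp n F → ℂ) := by
  rw [IsLocallyConstant.iff_eventually_eq]
  intro g
  have hc : Continuous fun h : Sp n F =>
      ((g⁻¹ * h : Sp n F) : Matrix (Fin n ⊕ Fin n) (Fin n ⊕ Fin n) F) := by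
    simp only [Submonoid.coe_mul]
    exact continuous_const.matrix_mul continuous_subtype_val
  have hopen : ∀ᶠ h in 𝓝 g, ∀ i j, ‖((g⁻¹ * h : Sp n F) :
      Matrix (Fin n ⊕ Fin n) (Fin n ⊕ Fin n) F) i j -
        (1 : Matrix (Fin n ⊕ Fin n) (Fin n ⊕ Fin n) F) i j‖ < 1 := by
    rw [eventually_all]; intro i
    rw [eventually_all]; intro j
    refine ((((hc.matrix_elem i j).sub continuous_const).norm).tendsto g).eventually_lt_const ?_
    change ‖((g⁻¹ * g : Sp n F) : Matrix (Fin n ⊕ Fin n) (Fin n ⊕ Fin n) F) i j -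
      (1 : Matrix (Fin n ⊕ Fin n) (Fin n ⊕ Fin n) F) i j‖ < 1
    rw [inv_mul_cancel, Submonoid.coe_one, sub_self, norm_zero]
    exact one_pos
  filter_upwards [hopen] with h hh
  set k : Sp n F := g⁻¹ * h with hk
  have hle : ∀ i j, ‖(k : Matrix (Fin n ⊕ Fin n) (Fin n ⊕ Fin n) F) i j‖ ≤ 1 := fun i j => by
    rw [← sub_add_cancel ((k : Matrix (Fin n ⊕ Fin n) (Fin n ⊕ Fin n) F) i j)
      ((1 : Matrix (Fin n ⊕ Fin n) (Fin n ⊕ Fin n) F) i j)]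
    refine norm_add_le_of_le (hh i j).le ?_
    rw [Matrix.one_apply]; split_ifs <;> simp
  have hkΓ : k ∈ siegelGamma n F := ⟨hle, fun i j => by
    have h1 := hh (Sum.inr i) (Sum.inl j)
    rw [Matrix.one_apply_ne (by simp), sub_zero] at h1
    exact h1⟩
  have hdet : ‖(blockD k).det - 1‖ < 1 := by
    have h1 := norm_det_add_sub_det_lt_one (M := (1 : Matrix (Fin n) (Fin n) F))
      (N := blockD k - 1) entryLE_one (fun i j => by
        have h1 := hh (Sum.inr i) (Sum.inr j)
        have h2 : (1 : Matrix (Fin n ⊕ Fin n) (Fin n ⊕ Fin n) F) (Sum.inr i) (Sum.inr j) =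
            (1 : Matrix (Fin n) (Fin n) F) i j := by simp [Matrix.one_apply]
        rw [h2] at h1
        exact h1)
    rwa [add_sub_cancel, Matrix.det_one] at h1
  have : h = g * k := by rw [hk, mul_inv_cancel_left]
  rw [this, cellSection_right hF hω s hkΓ, quadratic_eq_one hF hω hdet, one_mul]

theorem isStandardSection_cellSection (hF : LocalFieldData ϖ δ q) (hω : ω ^ 2 = 1) (s : ℂ) :
    IsStandardSection ω s 0 (cellSection ω s : Sp n F → ℂ) := by
  refine ⟨⟨isLocallyConstant_cellSection hF hω s, fun p hp g => ?_,
    fun k hk g => cellSection_right hF hω s hk g⟩, fun i hi => ?_⟩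
  · rw [cellSection_left hω s hp, sub_add_cancel]
  · have hD : blockD (weyl n i F) = lowIdem n i F := Matrix.toBlocks_fromBlocks₂₂ _ _ _ _
    have hC : blockC (weyl n i F) = highIdem n i F := Matrix.toBlocks_fromBlocks₂₁ _ _ _ _
    split_ifs with h0
    · subst h0
      have hD1 : lowIdem n 0 F = 1 := by simp [lowIdem]
      have hC0 : highIdem n 0 F = 0 := by simp [highIdem]
      have hmem : weyl n 0 F ∈ openCell n F := by
        refine ⟨by rw [hD, hD1]; simp, fun a b => ?_⟩
        rw [hC, hC0, Matrix.mul_zero]; simp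
      rw [cellSection, if_pos hmem, hD, hD1]
      simp
    -- For i ≥ 1 the diagonal entry at the 0-based index n - i vanishes, so the D block of w_i is
    -- singular and w_i is outside the cell.
    · have hlow : (lowIdem n i F).det = 0 := by
        rw [lowIdem, Matrix.det_diagonal, Finset.prod_eq_zero (Finset.mem_univ
          (⟨n - i, by omega⟩ : Fin n))]
        simp [hi]
      rw [cellSection, if_neg fun h => h.1 (by rw [hD, hlow])]

end Existence

end RamifiedSiegel

/-! ### Equivariance of sections and their values at monomial matrices. -/

namespace RamifiedSiegel

section Values

variable {F : Type*} [NontriviallyNormedField F] [IsUltrametricDist F] {n : ℕ} {ϖ δ : F} {q : ℕ}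
  {ω : MulChar F ℂ} {s : ℂ} {f : Sp n F → ℂ}

theorem coe_weyl_mul_unipotent (X : SymMat n F) :
    ((weyl n n F * unipotent X : Sp n F) : Matrix (Fin n ⊕ Fin n) (Fin n ⊕ Fin n) F) =
      Matrix.fromBlocks 0 (-1) 1 X.1 := by
  have h1 : lowIdem n n F = 0 := by simp [lowIdem]
  have h2 : highIdem n n F = 1 := by simp [highIdem]
  rw [Submonoid.coe_mul, weyl, unipotent, Matrix.fromBlocks_multiply, h1, h2]
  simp

/-- The element `(γ, 0; 0, ᵗγ⁻¹)`. -/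
noncomputable def levi {γ : Matrix (Fin n) (Fin n) F} (hγ : IsUnit γ.det) : Sp n F :=
  ⟨Matrix.fromBlocks γ 0 0 γ⁻¹ᵀ, by
    rw [SymplecticGroup.fromBlocks_mem_iff]
    simp [← Matrix.transpose_mul, Matrix.nonsing_inv_mul _ hγ]⟩

/-- The element `(1, 0; W, 1)`. -/
def lowerUnipotent (W : SymMat n F) : Sp n F :=
  ⟨Matrix.fromBlocks 1 0 W.1 1, by
    rw [SymplecticGroup.fromBlocks_mem_iff]
    have h : W.1ᵀ = W.1 := W.2
    simp [h]⟩

theorem section_left (hf : IsStandardSection ω s 0 f) {p : Sp n F}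
    (hp : p ∈ siegelParabolic n F) (g : Sp n F) :
    f (p * g) = ω (blockA p).det * ((‖(blockA p).det‖ : ℝ) : ℂ) ^ s * f g := by
  rw [hf.1.left p hp, sub_add_cancel]

/-- Invariance of `X ↦ f(w_n (1, X; 0, 1))` under the action of `GL_n(𝔬)`. -/
theorem section_congr (hf : IsStandardSection ω s 0 f)
    {γ : Matrix (Fin n) (Fin n) F} (hγ : EntryLE γ 1) (hdet : ‖γ.det‖ = 1) (X Y : SymMat n F) (hY : Y.1 = γ * X.1 * γᵀ) :
    f (weyl n n F * unipotent Y) = f (weyl n n F * unipotent X) := by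
  have hu := isUnit_det_of_norm hdet
  have hui : IsUnit γ⁻¹.det := by
    exact Matrix.isUnit_nonsing_inv_det _ hu
  have hut : IsUnit γ⁻¹ᵀ.det := by rwa [Matrix.det_transpose]
  have hdi : γ⁻¹.det = γ.det⁻¹ := by rw [Matrix.det_nonsing_inv, Ring.inverse_eq_inv']
  -- The identity w_n n(γ X ᵗγ) = m(ᵗγ⁻¹) w_n n(X) m(γ⁻¹). The left factor contributes ω(det γ)⁻¹,
  -- the right one ω(det γ).
  have heq : weyl n n F * unipotent Y =
      levi hut * ((weyl n n F * unipotent X) * levi hui) := by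
    apply Subtype.ext
    rw [coe_weyl_mul_unipotent, Submonoid.coe_mul, Submonoid.coe_mul, coe_weyl_mul_unipotent, levi, levi, Matrix.fromBlocks_multiply, Matrix.fromBlocks_multiply,
      hY]
    have e1 : γ⁻¹ᵀ⁻¹ᵀ = γ := by
      rw [Matrix.transpose_nonsing_inv, Matrix.transpose_transpose, Matrix.nonsing_inv_nonsing_inv _ hu]
    have e2 : γ⁻¹ᵀ * γᵀ = 1 := by
      rw [← Matrix.transpose_mul, Matrix.mul_nonsing_inv _ hu, Matrix.transpose_one]
    simp [e1, Matrix.nonsing_inv_nonsing_inv _ hu, e2, Matrix.mul_nonsing_inv _ hu,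
      Matrix.mul_assoc]
  have hA : blockA (levi hut) = γ⁻¹ᵀ := Matrix.toBlocks_fromBlocks₁₁ _ _ _ _
  have hD : blockD (levi hui) = γᵀ := by
    refine (Matrix.toBlocks_fromBlocks₂₂ _ _ _ _).trans ?_
    rw [Matrix.nonsing_inv_nonsing_inv _ hu]
  have hP : levi hut ∈ siegelParabolic n F := Matrix.toBlocks_fromBlocks₂₁ _ _ _ _
  have hΓ : levi hui ∈ siegelGamma n F := by
    refine mem_siegelGamma_of_coe_eq rfl (hγ.inv hdet) (fun i j => by simp) (fun i j => by simp) ?_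
    rw [Matrix.nonsing_inv_nonsing_inv _ hu]
    exact hγ.transpose
  rw [heq, section_left hf hP, hf.1.right _ hΓ, hA, hD, Matrix.det_transpose, Matrix.det_transpose,
    hdi, norm_inv, hdet, inv_one, Complex.ofReal_one, Complex.one_cpow, mul_one, ← mul_assoc,
    ← map_mul, inv_mul_cancel₀ hu.ne_zero, map_one, one_mul]

/-- The monomial matrix with entries `c i` at `(i, σ⁻¹ i)`. -/
def monomial (σ : Equiv.Perm (Fin n)) (c : Fin n → F) : Matrix (Fin n) (Fin n) F :=
  Matrix.of fun i j => if i = σ j then c i else 0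

theorem monomial_mul_monomial {σ : Equiv.Perm (Fin n)} (hσ : ∀ k, σ (σ k) = k) (c d : Fin n → F) :
    monomial σ c * monomial σ d = Matrix.diagonal fun k => c k * d (σ k) := by
  ext i j
  have : ∀ k, i = σ k ↔ σ i = k := fun k => ⟨fun h => by rw [h, hσ], fun h => by rw [← h, hσ]⟩
  rw [Matrix.mul_apply, Finset.sum_eq_single (σ i), Matrix.diagonal_apply]
  · simp only [monomial, Matrix.of_apply, hσ, if_true, σ.injective.eq_iff, mul_ite, mul_zero]
  · intro k _ hk
    simp [monomial, this, hk.symm]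
  · simp

theorem diagonal_mul_monomial (σ : Equiv.Perm (Fin n)) (c d : Fin n → F) :
    Matrix.diagonal d * monomial σ c = monomial σ fun k => d k * c k := by
  ext i j
  simp [monomial]

theorem monomial_add (σ : Equiv.Perm (Fin n)) (c d : Fin n → F) :
    monomial σ c + monomial σ d = monomial σ fun k => c k + d k := by
  ext i j
  simp only [monomial, Matrix.add_apply, Matrix.of_apply]
  split_ifs <;> simp

theorem isSymm_monomial {σ : Equiv.Perm (Fin n)} (hσ : ∀ k, σ (σ k) = k) {c : Fin n → F}
    (hc : ∀ k, c (σ k) = c k) : (monomial σ c).IsSymm := by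
  refine Matrix.IsSymm.ext fun i j => ?_
  simp only [monomial, Matrix.of_apply]
  have : j = σ i ↔ i = σ j := ⟨fun h => by rw [h, hσ], fun h => by rw [h, hσ]⟩
  rw [if_congr this rfl rfl]
  split_ifs with h
  · rw [h, hc]
  · rfl

/-- The value of a standard section at a monomial matrix whose large entries come first. -/
theorem section_monomial (hf : IsStandardSection ω s 0 f) {σ : Equiv.Perm (Fin n)}
    (hσ : ∀ k, σ (σ k) = k) {d : Fin n → F} (hd : ∀ k, d (σ k) = d k) {i : ℕ}
    (hlow : ∀ k : Fin n, (k : ℕ) + i < n ↔ 1 < ‖d k‖) (X : SymMat n F)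
    (hX : X.1 = monomial σ d) :
    ∃ M : Matrix (Fin n) (Fin n) F, f (weyl n n F * unipotent X) =
      ω M.det * ((‖M.det‖ : ℝ) : ℂ) ^ s * f (weyl n i F) ∧ (i = 0 → M * X.1 = 1) := by
  classical
  -- Indicators of the first n - i indices, where the entries of d are non-integral, and of the last
  -- i, where they are integral.
  let e : Fin n → F := fun k => if (k : ℕ) + i < n then 1 else 0
  let h : Fin n → F := fun k => if (k : ℕ) + i < n then 0 else 1
  have hE : lowIdem n i F = Matrix.diagonal e := rfl
  have hH : highIdem n i F = Matrix.diagonal h := rfl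
  have hlowσ : ∀ k, ((σ k : Fin n) : ℕ) + i < n ↔ (k : ℕ) + i < n := fun k => by
    rw [hlow, hlow, hd]
  have heσ : ∀ k, e (σ k) = e k := fun k => if_congr (hlowσ k) rfl rfl
  have hhσ : ∀ k, h (σ k) = h k := fun k => if_congr (hlowσ k) rfl rfl
  have hd0 : ∀ k : Fin n, (k : ℕ) + i < n → d k ≠ 0 := fun k hk =>
    norm_pos_iff.mp (one_pos.trans ((hlow k).mp hk))
  have heh : ∀ k, e k + h k = 1 := fun k => by simp only [e, h]; split_ifs <;> simp
  have heh0 : ∀ k, e k * h k = 0 := fun k => by simp only [e, h]; split_ifs <;> simp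
  have hee : ∀ k, e k * e k = e k := fun k => by simp only [e]; split_ifs <;> simp
  have hhh : ∀ k, h k * h k = h k := fun k => by simp only [h]; split_ifs <;> simp
  have hed : ∀ k, e k * (d k)⁻¹ * (e k * d k) = e k := fun k => by
    simp only [e]
    split_ifs with hk
    · simp [hd0 k hk]
    · simp
  -- X splits into its non-integral part Q and its integral part R; W inverts Q on the first block
  -- and has entries in 𝔭.
  let Q : SymMat n F := ⟨monomial σ fun k => e k * d k,
    isSymm_monomial hσ fun k => by rw [heσ, hd]⟩
  let R : SymMat n F := ⟨monomial σ fun k => h k * d k,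
    isSymm_monomial hσ fun k => by rw [hhσ, hd]⟩
  let W : SymMat n F := ⟨monomial σ fun k => e k * (d k)⁻¹,
    isSymm_monomial hσ fun k => by rw [heσ, hd]⟩
  have hQt : Q.1ᵀ = Q.1 := Q.2
  have hWt : W.1ᵀ = W.1 := W.2
  have hWQ : W.1 * Q.1 = lowIdem n i F := by
    rw [hE]
    simp only [Q, W, monomial_mul_monomial hσ, heσ, hd, hed]
  have hQW : Q.1 * W.1 = lowIdem n i F := by
    rw [← hQt, ← hWt, ← Matrix.transpose_mul, hWQ, lowIdem, Matrix.diagonal_transpose]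
  have hHQ : highIdem n i F * Q.1 = 0 := by
    rw [hH]
    simp only [Q, diagonal_mul_monomial, ← mul_assoc, mul_comm (h _) (e _), heh0, zero_mul]
    ext; simp [monomial]
  have hHW : highIdem n i F * W.1 = 0 := by
    rw [hH]
    simp only [W, diagonal_mul_monomial, ← mul_assoc, mul_comm (h _) (e _), heh0, zero_mul]
    ext; simp [monomial]
  have hHt : (highIdem n i F)ᵀ = highIdem n i F := Matrix.diagonal_transpose _
  have hEt : (lowIdem n i F)ᵀ = lowIdem n i F := Matrix.diagonal_transpose _
  have hQH : Q.1 * highIdem n i F = 0 := by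
    rw [← hQt, ← hHt, ← Matrix.transpose_mul, hHQ, Matrix.transpose_zero]
  have hWH : W.1 * highIdem n i F = 0 := by
    rw [← hWt, ← hHt, ← Matrix.transpose_mul, hHW, Matrix.transpose_zero]
  have hEQ : lowIdem n i F * Q.1 = Q.1 := by
    rw [hE]
    simp only [Q, diagonal_mul_monomial, ← mul_assoc, hee]
  have hQE : Q.1 * lowIdem n i F = Q.1 := by
    conv_rhs => rw [← hQt, ← hEQ, Matrix.transpose_mul, hEt, hQt]
  have hEW : lowIdem n i F * W.1 = W.1 := by
    rw [hE]
    simp only [W, diagonal_mul_monomial, ← mul_assoc, hee]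
  have hWE : W.1 * lowIdem n i F = W.1 := by
    conv_rhs => rw [← hWt, ← hEW, Matrix.transpose_mul, hEt, hWt]
  have hEH0 : lowIdem n i F * highIdem n i F = 0 := by
    rw [hE, hH, Matrix.diagonal_mul_diagonal]
    simp only [heh0, Matrix.diagonal_zero]
  have hHE0 : highIdem n i F * lowIdem n i F = 0 := by
    rw [hE, hH, Matrix.diagonal_mul_diagonal]
    simp only [mul_comm (h _), heh0, Matrix.diagonal_zero]
  have hHH : highIdem n i F * highIdem n i F = highIdem n i F := by
    rw [hH, Matrix.diagonal_mul_diagonal]; simp only [hhh]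
  have hEE : lowIdem n i F * lowIdem n i F = lowIdem n i F := by
    rw [hE, Matrix.diagonal_mul_diagonal]; simp only [hee]
  have hEH : lowIdem n i F + highIdem n i F = 1 := by
    rw [hE, hH, Matrix.diagonal_add]; simp only [heh, Matrix.diagonal_one]
  have hQR : X.1 = Q.1 + R.1 := by
    rw [hX]
    simp only [Q, R, monomial_add, ← add_mul, heh, one_mul]
  let p : Sp n F := ⟨Matrix.fromBlocks (W.1 + highIdem n i F) (-lowIdem n i F) 0
      (highIdem n i F + Q.1), by
    rw [SymplecticGroup.fromBlocks_mem_iff]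
    refine ⟨by simp, ?_, ?_⟩
    · simp only [Matrix.transpose_neg, Matrix.transpose_add, hEt, hHt, hQt, Matrix.neg_mul,
        Matrix.mul_neg, Matrix.mul_add, Matrix.add_mul, hEH0, hHE0, hEQ, hQE, zero_add, neg_zero]
    · simp only [Matrix.transpose_add, hWt, hHt, Matrix.transpose_zero, Matrix.zero_mul, sub_zero,
        Matrix.add_mul, Matrix.mul_add, hWH, hWQ, hHH, hHQ, add_zero, zero_add]
      rw [add_comm, hEH]⟩
  -- Only the non-integral part of X is inverted: w_n n(X) = p · w_i · (1, 0; W, 1) · n(R). The last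
  -- two factors lie in Γ with D = 1, so only p and w_i affect the value.
  have hfac : weyl n n F * unipotent X =
      p * (weyl n i F * lowerUnipotent W) * unipotent R := by
    apply Subtype.ext
    rw [coe_weyl_mul_unipotent, Submonoid.coe_mul, Submonoid.coe_mul, Submonoid.coe_mul]
    simp only [p, weyl, lowerUnipotent, unipotent, Matrix.fromBlocks_multiply, hQR]
    rw [Matrix.fromBlocks_inj]
    simp only [Matrix.mul_one, Matrix.mul_zero, Matrix.zero_mul, Matrix.add_mul, Matrix.mul_add,
      Matrix.neg_mul, Matrix.mul_neg, hWE, hWH, hHE0, hHH, hEH0, hEE, hQH, hQE, add_zero,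
      zero_add, hHW, hEW, hQW, neg_zero, add_neg_cancel, true_and]
    have hHE : highIdem n i F + lowIdem n i F = 1 := by rw [add_comm, hEH]
    have e1 : -highIdem n i F + -lowIdem n i F = -1 := by rw [← neg_add, hHE]
    simp [e1, hHE, add_comm, ← Matrix.add_mul]
  have hP : p ∈ siegelParabolic n F := Matrix.toBlocks_fromBlocks₂₁ _ _ _ _
  have hpA : blockA p = W.1 + highIdem n i F := Matrix.toBlocks_fromBlocks₁₁ _ _ _ _
  have hRΓ : unipotent R ∈ siegelGamma n F := by
    refine mem_siegelGamma_of_coe_eq rfl entryLE_one (fun a b => ?_) (fun a b => by simp)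
      entryLE_one
    simp only [R, monomial, Matrix.of_apply]
    split_ifs
    · simp only [h]
      split_ifs with hk
      · simp
      · rw [one_mul]; exact not_lt.mp fun h' => hk ((hlow a).mpr h')
    · simp
  have hWΓ : lowerUnipotent W ∈ siegelGamma n F := by
    refine mem_siegelGamma_of_coe_eq rfl entryLE_one (fun a b => by simp) (fun a b => ?_)
      entryLE_one
    simp only [W, monomial, Matrix.of_apply]
    split_ifs
    · simp only [e]
      split_ifs with hk
      · rw [one_mul, norm_inv]; exact inv_lt_one_of_one_lt₀ ((hlow a).mp hk)
      · simp
    · simp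
  have hRD : blockD (unipotent R) = 1 := Matrix.toBlocks_fromBlocks₂₂ _ _ _ _
  have hWD : blockD (lowerUnipotent W) = 1 := Matrix.toBlocks_fromBlocks₂₂ _ _ _ _
  refine ⟨W.1 + highIdem n i F, ?_, fun hi => ?_⟩
  · rw [hfac, hf.1.right _ hRΓ, section_left hf hP, hf.1.right _ hWΓ, hRD, hWD, hpA]
    simp
  · have hE1 : lowIdem n i F = 1 := by simp [hi, lowIdem]
    have hH0 : highIdem n i F = 0 := by simp [hi, highIdem]
    have hR0 : R.1 = 0 := by
      ext a b
      simp [R, monomial, h, hi]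
    rw [hH0, add_zero, hQR, hR0, add_zero, hWQ, hE1]

end Values

end RamifiedSiegel

/-! ### Values of the section on orbits and on degenerate matrices. -/

namespace RamifiedSiegel

section OrbitValues

variable {F : Type*} [NontriviallyNormedField F] [IsUltrametricDist F] {n : ℕ} {ϖ δ : F} {q : ℕ}
  {ω : MulChar F ℂ} {s : ℂ} {f : Sp n F → ℂ}
  {x : Equiv.Perm (Fin n) × (Fin n → ℤ) × (Fin n → F)}

theorem Lam.coeff_perm (hx : x ∈ Lam n δ) (k : Fin n) :
    x.2.2 (x.1 k) * ϖ ^ x.2.1 (x.1 k) = x.2.2 k * ϖ ^ x.2.1 k := by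
  by_cases hk : x.1 k = k
  · rw [hk]
  · rw [hx.2.1, hx.2.2.2 k hk, hx.2.2.2 (x.1 k) (by rw [Lam.involutive hx]; exact Ne.symm hk)]

theorem one_lt_norm_zpow_iff (hF : LocalFieldData ϖ δ q) (h : ℤ) : 1 < ‖ϖ‖ ^ h ↔ h ≤ -1 := by
  rw [one_lt_zpow_iff_right_of_lt_one₀ hF.norm_pos hF.norm_lt_one]
  omega

theorem section_orbit (hf : IsStandardSection ω s 0 f) (hx : x ∈ Lam n δ) (X : SymMat n F)
    (hX : X.1 ∈ orbit ϖ x) :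
    f (weyl n n F * unipotent X) = f (weyl n n F * unipotent ⟨repS ϖ x, isSymm_repS hx⟩) := by
  obtain ⟨γ, hγ, h⟩ := hX
  exact section_congr hf hγ.1 hγ.2.1 _ _ h

/-- All coefficients are non-integral, so `section_monomial` applies with i = 0 and M = S⁻¹; since
`ω` is quadratic, only |det S| is inverted. -/
theorem section_orbit_of_mem (hF : LocalFieldData ϖ δ q) (hω : ω ^ 2 = 1)
    (hf : IsStandardSection ω s 0 f) (hx : x ∈ LamNeg n δ) (X : SymMat n F)
    (hX : X.1 ∈ orbit ϖ x) :
    f (weyl n n F * unipotent X) =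
      ω (repS ϖ x).det * ((‖(repS ϖ x).det‖ : ℝ) : ℂ) ^ (-s) := by
  rw [section_orbit hf hx.1 X hX]
  obtain ⟨M, hM, hM1⟩ := section_monomial hf (Lam.involutive hx.1)
    (d := fun k => x.2.2 k * ϖ ^ x.2.1 k) (Lam.coeff_perm hx.1) (i := 0)
    (fun k => by
      rw [Lam.norm_coeff hF hx.1, one_lt_norm_zpow_iff hF]
      simp [hx.2 k]) ⟨repS ϖ x, isSymm_repS hx.1⟩ rfl
  have hdet := congrArg Matrix.det (hM1 rfl)
  rw [Matrix.det_mul, Matrix.det_one] at hdet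
  have hS := det_repS_ne_zero hF hx.1
  rw [hM, eq_inv_of_mul_eq_one_left hdet, quadratic_inv hω hS, norm_inv, hf.2 0 (Nat.zero_le n),
    if_pos rfl, mul_one, ← norm_inv_cpow_neg (inv_pos.mpr (norm_pos_iff.mpr hS)), inv_inv]

theorem card_last (n i : ℕ) (hi : i ≤ n) :
    Fintype.card {k : Fin n // ¬ (k : ℕ) + i < n} = i := by
  refine (Fintype.card_congr (β := Fin i) ⟨fun k => ⟨k.1 - (n - i), by have := k.1.2; omega⟩,
    fun j => ⟨⟨j + (n - i), by have := j.2; omega⟩, by simp only; omega⟩, fun k => ?_,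
    fun j => ?_⟩).trans (Fintype.card_fin i)
  · have := k.2
    ext; simp only; omega
  · ext; simp

theorem permMat_mul_monomial_mul (ρ σ : Equiv.Perm (Fin n)) (d : Fin n → F) :
    (permMat F ρ)ᵀ * monomial σ d * (permMat F ρ)ᵀᵀ =
      monomial (ρ⁻¹ * σ * ρ) fun k => d (ρ k) := by
  ext k l
  rw [Matrix.transpose_transpose]
  simp only [permMat, Matrix.transpose_submatrix, Matrix.transpose_one]
  have h1 : ∀ Y : Matrix (Fin n) (Fin n) F,
      (1 : Matrix (Fin n) (Fin n) F).submatrix ρ id * Y = Y.submatrix ρ id := fun Y => by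
    ext a b; simp [Matrix.mul_apply, Matrix.one_apply]
  have h2 : ∀ Y : Matrix (Fin n) (Fin n) F,
      Y * (1 : Matrix (Fin n) (Fin n) F).submatrix id ρ = Y.submatrix id ρ := fun Y => by
    ext a b; simp [Matrix.mul_apply, Matrix.one_apply]
  rw [h1, h2]
  simp only [monomial, Matrix.submatrix_apply, id, Matrix.of_apply, Equiv.Perm.mul_apply]
  exact if_congr Equiv.Perm.eq_inv_iff_eq.symm rfl rfl

/-- Let i ≥ 1 count the non-negative exponents. Conjugation by a permutation matrix, which is
integral with unit determinant though not necessarily in Γ₀, moves the negative exponents to the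
front; the value is then a multiple of f(w_i) = 0. -/
theorem section_orbit_of_notMem (hF : LocalFieldData ϖ δ q)
    (hf : IsStandardSection ω s 0 f) (hx : x ∈ Lam n δ) (hx' : x ∉ LamNeg n δ) (X : SymMat n F)
    (hX : X.1 ∈ orbit ϖ x) : f (weyl n n F * unipotent X) = 0 := by
  classical
  rw [section_orbit hf hx X hX]
  set i := Fintype.card {k : Fin n // 0 ≤ x.2.1 k} with hi
  have hin : i ≤ n := (Fintype.card_subtype_le _).trans_eq (Fintype.card_fin n)
  have hi0 : i ≠ 0 := by
    obtain ⟨k, hk⟩ : ∃ k, ¬ x.2.1 k ≤ -1 := by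
      by_contra! h; exact hx' ⟨hx, h⟩
    have : Nonempty {k : Fin n // 0 ≤ x.2.1 k} := ⟨⟨k, by omega⟩⟩
    exact Fintype.card_ne_zero
  -- Any bijection from the last i positions to the indices with non-negative exponent, extended to
  -- a permutation.
  let e : {k : Fin n // ¬ (k : ℕ) + i < n} ≃ {k : Fin n // 0 ≤ x.2.1 k} :=
    Fintype.equivOfCardEq ((card_last n i hin).trans hi)
  let ρ : Equiv.Perm (Fin n) := e.extendSubtype
  have hρ : ∀ k : Fin n, (k : ℕ) + i < n ↔ x.2.1 (ρ k) ≤ -1 := by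
    intro k
    constructor
    · intro hk
      have := e.extendSubtype_not_mem k (not_not.mpr hk)
      change ¬ 0 ≤ x.2.1 (ρ k) at this
      omega
    · intro hk
      by_contra hk'
      have := e.extendSubtype_mem k hk'
      change 0 ≤ x.2.1 (ρ k) at this
      omega
  let d : Fin n → F := fun k => x.2.2 k * ϖ ^ x.2.1 k
  let σ := ρ⁻¹ * x.1 * ρ
  have hσ : ∀ k, σ (σ k) = k := fun k => by
    simp [σ, Equiv.Perm.mul_apply, Lam.involutive hx]
  have hdσ : ∀ k, d (ρ (σ k)) = d (ρ k) := fun k => by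
    have : ρ (σ k) = x.1 (ρ k) := ρ.apply_symm_apply _
    rw [this]
    exact Lam.coeff_perm hx (ρ k)
  let Y : SymMat n F := ⟨monomial σ fun k => d (ρ k), isSymm_monomial hσ hdσ⟩
  have hcongr := section_congr hf (γ := (permMat F ρ)ᵀ) (entryLE_permMat ρ).transpose
    (by rw [Matrix.det_transpose, norm_det_permMat]) ⟨repS ϖ x, isSymm_repS hx⟩ Y
    (permMat_mul_monomial_mul ρ x.1 d).symm
  obtain ⟨M, hM, -⟩ := section_monomial hf hσ hdσ (i := i) (fun k => by
    rw [hρ, Lam.norm_coeff hF hx, one_lt_norm_zpow_iff hF]) Y rfl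
  rw [← hcongr, hM, hf.2 i hin, if_neg hi0.symm, mul_zero]

theorem continuous_weyl_mul_unipotent :
    Continuous fun X : SymMat n F => weyl n n F * unipotent X := by
  refine continuous_induced_rng.mpr ?_
  have : (Subtype.val ∘ fun X : SymMat n F => weyl n n F * unipotent X) =
      fun X => Matrix.fromBlocks 0 (-1) 1 X.1 := funext coe_weyl_mul_unipotent
  rw [this]
  exact continuous_const.matrix_fromBlocks continuous_const continuous_const
    continuous_subtype_val

theorem one_le_norm_det_repS (hF : LocalFieldData ϖ δ q) (hx : x ∈ LamNeg n δ) :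
    1 ≤ ‖(repS ϖ x).det‖ := by
  rw [norm_det_repS hF hx.1]
  exact Finset.prod_induction _ (1 ≤ ·) (fun _ _ => one_le_mul_of_one_le_of_one_le) le_rfl
    fun i _ => ((one_lt_norm_zpow_iff hF _).mpr (hx.2 i)).le

/-- A standard section vanishes at degenerate symmetric matrices. -/
theorem section_degenerate (hF : LocalFieldData ϖ δ q)
    (hf : IsStandardSection ω s 0 f) (X : SymMat n F) (hdet : X.1.det = 0) :
    f (weyl n n F * unipotent X) = 0 := by
  -- For small t ≠ 0 the matrix X + t·1 is non-degenerate, has determinant of norm below 1, and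
  -- gives the same value of f. Orbits with all exponents negative have determinant of norm at least
  -- 1, so f vanishes there.
  let T : F → SymMat n F := fun t => ⟨X.1 + t • 1, X.2.add (Matrix.isSymm_one.smul t)⟩
  have hTc : Continuous T := by
    refine continuous_induced_rng.mpr ?_
    exact continuous_const.add (continuous_id.smul continuous_const)
  have hT0 : T 0 = X := Subtype.ext (by simp [T])
  have h1 : ∀ᶠ t in 𝓝 (0 : F), f (weyl n n F * unipotent (T t)) =
      f (weyl n n F * unipotent X) := by
    have h := (IsLocallyConstant.iff_eventually_eq f).mp hf.1.smooth (weyl n n F * unipotent X)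
    have hc := (continuous_weyl_mul_unipotent.comp hTc).tendsto 0
    rw [Function.comp_apply, hT0] at hc
    exact hc.eventually h
  have h2 : ∀ᶠ t in 𝓝 (0 : F), ‖(T t).1.det‖ < 1 := by
    have hc : Continuous fun t => ‖(T t).1.det‖ :=
      (Continuous.matrix_det (continuous_subtype_val.comp hTc)).norm
    refine (hc.tendsto 0).eventually_lt_const ?_
    rw [hT0, hdet, norm_zero]; exact one_pos
  have h3 : ∀ᶠ t in 𝓝[≠] (0 : F), (T t).1.det ≠ 0 := by
    -- det(X + t) is the characteristic polynomial of -X at t, so it has only finitely many zeros.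
    have hpoly : ∀ t, (T t).1.det = (-X.1).charpoly.eval t := fun t => by
      rw [Matrix.eval_charpoly, sub_neg_eq_add, add_comm]
      simp [T, Matrix.smul_one_eq_diagonal, Matrix.scalar_apply]
    have hne : (-X.1).charpoly ≠ 0 := (Matrix.charpoly_monic _).ne_zero
    have hfin : {t | (-X.1).charpoly.IsRoot t}.Finite :=
      Polynomial.finite_setOfPred_isRoot hne
    have hopen := (hfin.subset (Set.sdiff_subset (t := {0}))).isClosed.isOpen_compl
    filter_upwards [nhdsWithin_le_nhds (hopen.mem_nhds (by simp)), self_mem_nhdsWithin]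
      with t ht ht0 h0
    exact ht ⟨by rw [Set.mem_ofPred_eq, Polynomial.IsRoot, ← hpoly, h0], ht0⟩
  have h4 := (h1.and h2).filter_mono (nhdsWithin_le_nhds (s := {0}ᶜ))
  obtain ⟨t, ⟨ht1, ht2⟩, ht3⟩ := (h4.and h3).exists
  obtain ⟨x, hx, hxt⟩ := exists_mem_orbit hF (T t).2 ht3
  have hneg : x ∉ LamNeg n δ := fun hneg => by
    have hn := Gamma0Equiv.norm_det hxt
    rw [hn] at ht2
    exact not_lt.mpr (one_le_norm_det_repS hF hneg) ht2
  rw [← ht1, section_orbit_of_notMem hF hf hx hneg _ hxt]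

end OrbitValues

end RamifiedSiegel

/-! ### Vanishing of character sums by oscillation. -/

namespace RamifiedSiegel

section Translation

variable {F : Type*} [NontriviallyNormedField F] [IsUltrametricDist F] [LocallyCompactSpace F]
  [ProperSpace F] [MeasurableSpace F] [BorelSpace F] {n : ℕ}

theorem setIntegral_add_right {A : Set (Matrix (Fin n) (Fin n) F)} (hA : MeasurableSet A)
    (φ : Matrix (Fin n) (Fin n) F → ℂ) {M : Matrix (Fin n) (Fin n) F}
    (hM : ∀ γ, γ + M ∈ A ↔ γ ∈ A) :
    ∫ γ in A, φ (γ + M) ∂(matrixHaar n F) = ∫ γ in A, φ γ ∂(matrixHaar n F) := by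
  rw [← integral_indicator hA, ← integral_indicator hA,
    ← integral_add_right_eq_self (A.indicator φ) M]
  refine integral_congr_ae (Eventually.of_forall fun γ => ?_)
  change A.indicator (fun γ => φ (γ + M)) γ = A.indicator φ (γ + M)
  by_cases h : γ ∈ A
  · rw [Set.indicator_of_mem h, Set.indicator_of_mem ((hM γ).mpr h)]
  · rw [Set.indicator_of_notMem h, Set.indicator_of_notMem (mt (hM γ).mp h)]

theorem HasOrderZero.continuous {ϖ : 𝒪[F]} {ψ : AddChar F Circle} (hψ : HasOrderZero ϖ ψ) :
    Continuous fun x : F => (ψ x : ℂ) := by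
  refine continuous_iff_continuousAt.mpr fun x => ?_
  have hev : (fun y : F => (ψ y : ℂ)) =ᶠ[𝓝 x] fun _ => (ψ x : ℂ) := by
    filter_upwards [Metric.closedBall_mem_nhds x one_pos] with y hy
    have h1 : ψ (y - x) = 1 := hψ.eq_one (by rwa [← dist_eq_norm])
    rw [← sub_add_cancel y x, AddChar.map_add_eq_mul, h1, one_mul]
  exact continuousAt_const.congr hev.symm

/-- A quadratic exponential integral vanishes if it oscillates along a lattice. -/
theorem setIntegral_eq_zero_of_oscillation {A L : Set (Matrix (Fin n) (Fin n) F)}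
    (hA : MeasurableSet A) (hL : MeasurableSet L) (hAfin : matrixHaar n F A ≠ ⊤)
    (hLfin : matrixHaar n F L ≠ ⊤) (hL0 : matrixHaar n F L ≠ 0)
    (hAL : ∀ M ∈ L, ∀ γ, γ + M ∈ A ↔ γ ∈ A)
    (hLL : ∀ M ∈ L, ∀ γ, γ + M ∈ L ↔ γ ∈ L) {φ : Matrix (Fin n) (Fin n) F → ℂ}
    (hφ : Continuous φ) (hφ1 : ∀ γ, ‖φ γ‖ ≤ 1)
    (hosc : ∀ γ ∈ A, ∃ M₀ ∈ L, ∃ c : ℂ, c ≠ 1 ∧ ∀ M ∈ L, φ (γ + (M + M₀)) = c * φ (γ + M)) :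
    ∫ γ in A, φ γ ∂(matrixHaar n F) = 0 := by
  have : IsFiniteMeasure ((matrixHaar n F).restrict A) := isFiniteMeasure_restrict.mpr hAfin
  have : IsFiniteMeasure ((matrixHaar n F).restrict L) := isFiniteMeasure_restrict.mpr hLfin
  -- Translation by M₀ multiplies the inner integral by c ≠ 1 without changing it.
  have hinner : ∀ γ ∈ A, ∫ M in L, φ (γ + M) ∂(matrixHaar n F) = 0 := by
    intro γ hγ
    obtain ⟨M₀, hM₀, c, hc, hφc⟩ := hosc γ hγ
    have h1 := setIntegral_add_right hL (fun M => φ (γ + M)) (hLL M₀ hM₀)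
    rw [setIntegral_congr_fun hL (fun M hM => hφc M hM), integral_const_mul] at h1
    have h2 : (c - 1) * ∫ M in L, φ (γ + M) ∂(matrixHaar n F) = 0 := by
      linear_combination h1
    exact (mul_eq_zero.mp h2).resolve_left (sub_ne_zero.mpr hc)
  have hint : Integrable (Function.uncurry fun γ M : Matrix (Fin n) (Fin n) F => φ (γ + M))
      (((matrixHaar n F).restrict A).prod ((matrixHaar n F).restrict L)) := by
    refine Integrable.of_bound ?_ 1 (Eventually.of_forall fun z => hφ1 _)
    exact (hφ.comp (continuous_fst.add continuous_snd)).measurable.aestronglyMeasurable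
  -- In the other order the inner integral over A does not depend on M, so the double integral is
  -- vol(L) times the integral sought.
  have hswap := integral_integral_swap hint
  rw [setIntegral_congr_fun hA hinner, setIntegral_congr_fun hL (fun M hM =>
    setIntegral_add_right hA φ (hAL M hM)), integral_zero, setIntegral_const] at hswap
  have hreal : (matrixHaar n F).real L ≠ 0 := ENNReal.toReal_ne_zero.mpr ⟨hL0, hLfin⟩
  exact (smul_eq_zero.mp hswap.symm).resolve_left hreal

end Translation

section Finiteness

variable {F : Type*} [NontriviallyNormedField F] [IsUltrametricDist F] [LocallyCompactSpace F]
  [ProperSpace F] [MeasurableSpace F] [BorelSpace F] {n : ℕ} {ϖ : 𝒪[F]} {δ : F} {q : ℕ}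
  {ψ : AddChar F Circle} {B : Matrix (Fin n) (Fin n) F}
  {x : Equiv.Perm (Fin n) × (Fin n → ℤ) × (Fin n → F)}

theorem norm_trace_le {M : Matrix (Fin n) (Fin n) F} {c : ℝ} (hc : 0 ≤ c) (hM : EntryLE M c) :
    ‖M.trace‖ ≤ c :=
  norm_sum_le_of_le hc fun i _ => hM i i

theorem exists_pow_entryLE {ϖ : F} (hF : LocalFieldData ϖ δ q) (M : Matrix (Fin n) (Fin n) F) :
    ∃ b : ℕ, ∀ b' : ℕ, b ≤ b' → EntryLE M (‖ϖ‖ ^ (-(b' : ℤ))) := by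
  obtain ⟨c, hc, hM⟩ := exists_entryLE M
  obtain ⟨b, hb⟩ := exists_pow_lt_of_lt_one (inv_pos.mpr hc) hF.norm_lt_one
  refine ⟨b, fun b' hb' i j => (hM i j).trans ?_⟩
  rw [_root_.zpow_neg, zpow_natCast, le_inv_comm₀ hc (pow_pos hF.norm_pos _)]
  exact (pow_le_pow_of_le_one (norm_nonneg _) hF.norm_lt_one.le hb').trans hb.le

theorem trace_quadratic_add (S B γ M : Matrix (Fin n) (Fin n) F) (hS : S.IsSymm) (hB : B.IsSymm) :
    (S * ((γ + M)ᵀ * B * (γ + M))).trace =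
      (S * (γᵀ * B * γ)).trace + 2 * (S * γᵀ * B * M).trace + (S * (Mᵀ * B * M)).trace := by
  have h1 : (S * (Mᵀ * B * γ)).trace = (S * γᵀ * B * M).trace := by
    rw [← Matrix.trace_transpose, Matrix.transpose_mul, Matrix.transpose_mul, Matrix.transpose_mul,
      Matrix.transpose_transpose, hS.eq, hB.eq, Matrix.trace_mul_comm]
    simp only [Matrix.mul_assoc]
  have h2 : S * ((γ + M)ᵀ * B * (γ + M)) = S * (γᵀ * B * γ) + S * (Mᵀ * B * γ) +
      S * γᵀ * B * M + S * (Mᵀ * B * M) := by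
    rw [Matrix.transpose_add]; noncomm_ring
  rw [h2, Matrix.trace_add, Matrix.trace_add, Matrix.trace_add, h1]
  ring

/-- S is the product of S ᵗγ B with B⁻¹ ᵗγ⁻¹, whose entries are bounded by ‖ϖ‖^(-b). If S ᵗγ B had
only smaller entries, the entry of S in row a would be too small. -/
theorem exists_large_entry (hF : LocalFieldData (ϖ : F) δ q) (hx : x ∈ Lam n δ) {b : ℕ}
    (hdet : B.det ≠ 0) (hb : EntryLE B⁻¹ (‖(ϖ : F)‖ ^ (-(b : ℤ)))) {γ : Matrix (Fin n) (Fin n) F}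
    (hγ : γ ∈ Gamma0 n F) (a : Fin n) :
    ∃ i j, ‖(ϖ : F)‖ ^ (x.2.1 a + b) ≤ ‖(repS (ϖ : F) x * γᵀ * B) i j‖ := by
  by_contra! hlt
  have hpos : ∀ k : ℤ, 0 < ‖(ϖ : F)‖ ^ k := zpow_pos hF.norm_pos
  set S := repS (ϖ : F) x with hS
  have hu := isUnit_det_of_norm hγ.2.1
  have hut : IsUnit γᵀ.det := by rwa [Matrix.det_transpose]
  have hSe : S = S * γᵀ * B * (B⁻¹ * γᵀ⁻¹) := by
    rw [← Matrix.mul_assoc, Matrix.mul_nonsing_inv_cancel_right _ _ hdet.isUnit,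
      Matrix.mul_nonsing_inv_cancel_right _ _ hut]
  have hinv : EntryLE (B⁻¹ * γᵀ⁻¹) (‖(ϖ : F)‖ ^ (-(b : ℤ))) := by
    refine EntryLE.mul_one_right (hpos _).le hb ?_
    rw [← Matrix.transpose_nonsing_inv]
    exact EntryLE.transpose (inv_mem_Gamma0 hγ).1
  have hsmall : EntryLT S (‖(ϖ : F)‖ ^ x.2.1 a) := by
    rw [hSe]
    intro i j
    rw [Matrix.mul_apply]
    refine norm_sum_lt_of_lt (hpos _) fun k _ => ?_
    rw [norm_mul]
    calc _ ≤ ‖(S * γᵀ * B) i k‖ * ‖(ϖ : F)‖ ^ (-(b : ℤ)) := by gcongr; exact hinv k j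
      _ < ‖(ϖ : F)‖ ^ (x.2.1 a + b) * ‖(ϖ : F)‖ ^ (-(b : ℤ)) :=
        mul_lt_mul_of_pos_right (hlt i k) (hpos _)
      _ = ‖(ϖ : F)‖ ^ x.2.1 a := by
        rw [← zpow_add₀ hF.norm_pos.ne', add_neg_cancel_right]
  have h1 := hsmall a (x.1 a)
  rw [hS, repS, Matrix.of_apply, Lam.involutive hx, if_pos rfl, Lam.norm_coeff hF hx] at h1
  exact lt_irrefl _ h1

/-- Under a shift of γ by M in a suitable lattice 𝔭^r the quadratic term in M is integral and drops
out of ψ, while the linear term 2 tr(S ᵗγ B M) is not integral for all M. -/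
theorem charSum_eq_zero (hF : LocalFieldData (ϖ : F) δ q) (hψ : HasOrderZero ϖ ψ)
    (hx : x ∈ LamNeg n δ) (hB : B.IsSymm) (hdet : B.det ≠ 0) {b : ℕ}
    (hb : EntryLE B (‖(ϖ : F)‖ ^ (-(b : ℤ)))) (hb' : EntryLE B⁻¹ (‖(ϖ : F)‖ ^ (-(b : ℤ))))
    {a : Fin n} (ha : ∀ i, x.2.1 a ≤ x.2.1 i) (hlarge : x.2.1 a < -(3 * b + 1 : ℤ)) :
    charSum ψ (repS (ϖ : F) x) B = 0 := by
  set S := repS (ϖ : F) x with hS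
  have hϖ1 := hF.norm_lt_one
  have hpos : ∀ k : ℤ, 0 < ‖(ϖ : F)‖ ^ k := zpow_pos hF.norm_pos
  have hSs : S.IsSymm := isSymm_repS hx.1
  have hSle : EntryLE S (‖(ϖ : F)‖ ^ x.2.1 a) := by
    intro i j
    rw [hS, repS, Matrix.of_apply]
    split_ifs
    · rw [Lam.norm_coeff hF hx.1]
      exact zpow_le_zpow_right_of_le_one₀ hF.norm_pos hϖ1.le (ha i)
    · simpa using (hpos _).le
  -- With h = x.2.1 a the least exponent, 2r ≥ b - h makes the quadratic term integral and h + b + r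
  -- < 0 makes the linear term oscillate. Taking r as (b - h)/2 rounded up satisfies both because h
  -- < -(3b + 1).
  obtain ⟨r, hr1, hr2, hr3⟩ : ∃ r : ℕ, 1 ≤ r ∧ -x.2.1 a + b ≤ 2 * r ∧ x.2.1 a + b + r < 0 :=
    ⟨((-x.2.1 a + b + 1) / 2).toNat, by omega, by omega, by omega⟩
  have hrpos : 0 < ‖(ϖ : F)‖ ^ r := pow_pos hF.norm_pos r
  have hr_lt : ‖(ϖ : F)‖ ^ r < 1 := pow_lt_one₀ (norm_nonneg _) hϖ1 (by omega)
  set L : Set (Matrix (Fin n) (Fin n) F) := {M | EntryLE M (‖(ϖ : F)‖ ^ r)} with hL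
  have hLo : IsOpen L := isOpen_entryLE hrpos.ne'
  have hneg : ∀ {M}, M ∈ L → -M ∈ L := fun h => EntryLE.neg h
  have hadd : ∀ {M N}, M ∈ L → N ∈ L → M + N ∈ L := fun h h' => EntryLE.add h h'
  let φ : Matrix (Fin n) (Fin n) F → ℂ := fun γ => (ψ (-(S * (γᵀ * B * γ)).trace) : ℂ)
  have hφc : Continuous φ := by
    refine hψ.continuous.comp (Continuous.neg (Continuous.matrix_trace ?_))
    exact continuous_const.matrix_mul
      ((continuous_id.matrix_transpose.matrix_mul continuous_const).matrix_mul continuous_id)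
  have hquad : ∀ γ M, M ∈ L → φ (γ + M) = φ γ * (ψ (-(2 * (S * γᵀ * B * M).trace)) : ℂ) := by
    intro γ M hM
    have hM' : EntryLE M (‖(ϖ : F)‖ ^ r) := hM
    have h1 : ‖(S * (Mᵀ * B * M)).trace‖ ≤ 1 := by
      have h2 := EntryLE.mul (by positivity) (hpos _).le hSle (EntryLE.mul hrpos.le (by positivity)
        (EntryLE.mul (hpos _).le hrpos.le hM'.transpose hb) hM')
      refine (norm_trace_le (by positivity) h2).trans ?_
      rw [← zpow_natCast, ← zpow_add₀ hF.norm_pos.ne', ← zpow_add₀ hF.norm_pos.ne',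
        ← zpow_add₀ hF.norm_pos.ne']
      exact zpow_le_one₀ hF.norm_pos hϖ1.le (by omega)
    simp only [φ]
    rw [trace_quadratic_add S B γ M hSs hB, neg_add, neg_add, AddChar.map_add_eq_mul,
      AddChar.map_add_eq_mul, hψ.eq_one (x := -(S * (Mᵀ * B * M)).trace) (by rwa [norm_neg]),
      mul_one, Circle.coe_mul]
  refine setIntegral_eq_zero_of_oscillation (L := L) (φ := φ) measurableSet_Gamma0 hLo.measurableSet
    matrixHaar_Gamma0_ne_top (isCompact_entryLE _).measure_lt_top.ne
    (hLo.measure_pos _ ⟨0, fun i j => by simp⟩).ne' ?_ ?_ hφc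
    (fun γ => (Circle.norm_coe _).le) ?_
  · intro M hM γ
    have hlt : ∀ {M}, M ∈ L → EntryLT M 1 := fun h i j => (h i j).trans_lt hr_lt
    refine ⟨fun h => ?_, fun h => add_mem_Gamma0 h (hlt hM)⟩
    have := add_mem_Gamma0 h (hlt (hneg hM))
    rwa [add_neg_cancel_right] at this
  · intro M hM γ
    refine ⟨fun h => ?_, fun h => hadd h hM⟩
    have := hadd h (hneg hM)
    rwa [add_neg_cancel_right] at this
  · intro γ hγ
    obtain ⟨i, j, hij⟩ := exists_large_entry hF hx.1 hdet hb' hγ a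
    rw [← hS] at hij
    set N := S * γᵀ * B with hN
    have hy : 1 < ‖-(2 * (N i j * (ϖ : F) ^ r))‖ := by
      rw [norm_neg, norm_mul, hF.norm_two, one_mul, norm_mul, norm_pow]
      calc (1 : ℝ) < ‖(ϖ : F)‖ ^ (x.2.1 a + b + r) :=
            (one_lt_norm_zpow_iff hF _).mpr (by omega)
        _ = ‖(ϖ : F)‖ ^ (x.2.1 a + b) * ‖(ϖ : F)‖ ^ r := by
            rw [zpow_add₀ hF.norm_pos.ne', zpow_natCast]
        _ ≤ _ := by gcongr
    obtain ⟨z, hz, hψz⟩ := hψ.exists_ne_one hF hy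
    -- A matrix supported at (j, i) isolates the large entry N i j in the trace.
    refine ⟨Matrix.single j i ((ϖ : F) ^ r * z), ?_, (ψ (-(2 * (N i j * (ϖ : F) ^ r)) * z) : ℂ),
      by rwa [Ne, Circle.coe_eq_one], fun M hM => ?_⟩
    · intro k l
      rw [Matrix.single_apply]
      split_ifs
      · rw [norm_mul, norm_pow]; exact mul_le_of_le_one_right hrpos.le hz
      · simp
    · have hM0 : Matrix.single j i ((ϖ : F) ^ r * z) ∈ L := by
        intro k l
        rw [Matrix.single_apply]
        split_ifs
        · rw [norm_mul, norm_pow]; exact mul_le_of_le_one_right hrpos.le hz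
        · simp
      have htr : -(2 * (N * Matrix.single j i ((ϖ : F) ^ r * z)).trace) =
          -(2 * (N i j * (ϖ : F) ^ r)) * z := by
        rw [Matrix.trace_mul_single, op_smul_eq_mul]; ring
      rw [hquad γ _ (hadd hM hM0), hquad γ M hM, ← hN, Matrix.mul_add, Matrix.trace_add, mul_add,
        neg_add, htr, AddChar.map_add_eq_mul, Circle.coe_mul]
      ring

theorem finite_charSum_ne_zero (hF : LocalFieldData (ϖ : F) δ q) (hψ : HasOrderZero ϖ ψ)
    (hB : B.IsSymm) (hdet : B.det ≠ 0) :
    {x ∈ LamNeg n δ | charSum ψ (repS (ϖ : F) x) B ≠ 0}.Finite := by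
  obtain ⟨b₁, hb₁⟩ := exists_pow_entryLE hF B
  obtain ⟨b₂, hb₂⟩ := exists_pow_entryLE hF B⁻¹
  set b := max b₁ b₂
  -- A nonzero character sum confines every exponent to [-(3b + 1), -1], leaving finitely many
  -- triples.
  have hfin : (Set.univ ×ˢ ((Set.pi Set.univ fun _ => Set.Icc (-(3 * b + 1 : ℤ)) (-1)) ×ˢ
      (Set.pi Set.univ fun _ => {1, δ})) :
      Set (Equiv.Perm (Fin n) × (Fin n → ℤ) × (Fin n → F))).Finite :=
    Set.finite_univ.prod ((Set.Finite.pi fun _ => Set.finite_Icc _ _).prod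
      (Set.Finite.pi fun _ => Set.toFinite _))
  refine hfin.subset ?_
  rintro x ⟨hx, hne⟩
  refine ⟨trivial, fun i _ => ⟨?_, hx.2 i⟩, fun i _ => hx.1.2.2.1 i⟩
  by_contra! hlt
  obtain ⟨a, -, ha⟩ := Finset.exists_min_image Finset.univ x.2.1 ⟨i, Finset.mem_univ i⟩
  exact hne (charSum_eq_zero hF hψ hx hB hdet (hb₁ b (le_max_left _ _)) (hb₂ b (le_max_right _ _))
    (fun i => ha i (Finset.mem_univ i)) ((ha i (Finset.mem_univ i)).trans_lt hlt))

end Finiteness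

end RamifiedSiegel

/-! ### Summation over orbits, convergence and continuation. -/

namespace RamifiedSiegel

section SiegelSeries

variable {F : Type*} [NontriviallyNormedField F] [IsUltrametricDist F] [LocallyCompactSpace F]
  [ProperSpace F] [MeasurableSpace F] [BorelSpace F] {n : ℕ} {ϖ : 𝒪[F]} {δ : F} {q : ℕ}
  {ψ : AddChar F Circle} {B : Matrix (Fin n) (Fin n) F} {ω : MulChar F ℂ} {s : ℂ}
  {f : Sp n F → ℂ} {x : Equiv.Perm (Fin n) × (Fin n → ℤ) × (Fin n → F)}

/-- The Siegel integrand in terms of the entries on and above the diagonal. -/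
noncomputable def coordIntegrand (ψ : AddChar F Circle) (B : Matrix (Fin n) (Fin n) F)
    (f : Sp n F → ℂ) (y : UpperCoord n F) : ℂ :=
  siegelIntegrand ψ B f (symOfUpper y)

theorem continuous_symOfUpper : Continuous (symOfUpper : UpperCoord n F → SymMat n F) :=
  continuous_induced_rng.mpr continuous_symOfUpper_val

theorem continuous_siegelIntegrand (hψ : HasOrderZero ϖ ψ) (hf : IsStandardSection ω s 0 f) :
    Continuous (siegelIntegrand ψ B f) := by
  refine (hf.1.smooth.continuous.comp continuous_weyl_mul_unipotent).mul ?_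
  refine hψ.continuous.comp (Continuous.neg (Continuous.matrix_trace ?_))
  exact continuous_const.matrix_mul continuous_subtype_val

theorem continuous_coordIntegrand (hψ : HasOrderZero ϖ ψ) (hf : IsStandardSection ω s 0 f) :
    Continuous (coordIntegrand ψ B f) :=
  (continuous_siegelIntegrand hψ hf).comp continuous_symOfUpper

theorem integral_siegelIntegrand (hψ : HasOrderZero ϖ ψ) (hf : IsStandardSection ω s 0 f) :
    ∫ X, siegelIntegrand ψ B f X ∂(symHaar n F) = ∫ y, coordIntegrand ψ B f y ∂(coordHaar n F) :=
  integral_map continuous_symOfUpper.measurable.aemeasurable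
    (continuous_siegelIntegrand hψ hf).measurable.aestronglyMeasurable

theorem integrable_siegelIntegrand_iff (hψ : HasOrderZero ϖ ψ) (hf : IsStandardSection ω s 0 f) :
    Integrable (siegelIntegrand ψ B f) (symHaar n F) ↔
      Integrable (coordIntegrand ψ B f) (coordHaar n F) :=
  integrable_map_measure (continuous_siegelIntegrand hψ hf).measurable.aestronglyMeasurable
    continuous_symOfUpper.measurable.aemeasurable

theorem coordIntegrand_of_mem (hF : LocalFieldData (ϖ : F) δ q) (hω : ω ^ 2 = 1)
    (hf : IsStandardSection ω s 0 f) (hx : x ∈ LamNeg n δ) {y : UpperCoord n F}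
    (hy : y ∈ coordOrbit (ϖ : F) x) :
    coordIntegrand ψ B f y = ω (repS (ϖ : F) x).det * ((‖(repS (ϖ : F) x).det‖ : ℝ) : ℂ) ^ (-s) *
      (ψ (-(B * (symOfUpper y).1).trace) : ℂ) := by
  rw [coordIntegrand, siegelIntegrand,
    section_orbit_of_mem hF hω hf hx (symOfUpper y) hy]

theorem coordIntegrand_of_notMem (hF : LocalFieldData (ϖ : F) δ q)
    (hf : IsStandardSection ω s 0 f) {y : UpperCoord n F}
    (hy : ∀ x ∈ LamNeg n δ, y ∉ coordOrbit (ϖ : F) x) : coordIntegrand ψ B f y = 0 := by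
  rw [coordIntegrand, siegelIntegrand]
  by_cases hdet : (symOfUpper y).1.det = 0
  · rw [section_degenerate hF hf _ hdet, zero_mul]
  · obtain ⟨x, hx, hxy⟩ := exists_mem_orbit hF (symOfUpper y).2 hdet
    rw [section_orbit_of_notMem hF hf hx (fun h => hy x h hxy) _ hxy,
      zero_mul]

theorem trace_congr (S γ B : Matrix (Fin n) (Fin n) F) :
    (B * (γ * S * γᵀ)).trace = (S * (γᵀ * B * γ)).trace := by
  rw [Matrix.trace_mul_comm, Matrix.mul_assoc, Matrix.mul_assoc, Matrix.trace_mul_comm]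
  simp only [Matrix.mul_assoc]

/-- The contribution of one `Γ₀`-orbit to the Siegel series. -/
theorem setIntegral_coordIntegrand (hF : LocalFieldData (ϖ : F) δ (resCard F)) (hω : ω ^ 2 = 1)
    (hψ : HasOrderZero ϖ ψ) (hf : IsStandardSection ω s 0 f) (hx : x ∈ LamNeg n δ) :
    ∫ y in coordOrbit (ϖ : F) x, coordIntegrand ψ B f y ∂(coordHaar n F) =
      ω (repS (ϖ : F) x).det * ((‖(repS (ϖ : F) x).det‖ : ℝ) : ℂ) ^ (-s) *
        (charSum ψ (repS (ϖ : F) x) B / (localDensity (ϖ : F) (repS (ϖ : F) x) : ℂ)) := by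
  have hψc : Continuous fun y : UpperCoord n F => (ψ (-(B * (symOfUpper y).1).trace) : ℂ) :=
    hψ.continuous.comp (Continuous.neg (Continuous.matrix_trace
      (continuous_const.matrix_mul continuous_symOfUpper_val)))
  rw [setIntegral_congr_fun (isOpen_coordOrbit hF hx.1).measurableSet fun y hy =>
      coordIntegrand_of_mem hF hω hf hx hy, integral_const_mul,
    setIntegral_coordOrbit hF hx.1 hψc.measurable.stronglyMeasurable, localDensity_eq hF hx.1,
    charSum]
  have h : ∀ γ : Matrix (Fin n) (Fin n) F,
      (B * (symOfUpper (act γ (upper (repS (ϖ : F) x)))).1).trace =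
        (repS (ϖ : F) x * (γᵀ * B * γ)).trace := fun γ => by
    rw [symOfUpper_act, symOfUpper_upper (isSymm_repS hx.1), trace_congr]
  simp only [h]
  push_cast
  rw [div_div_eq_mul_div, div_mul_eq_mul_div, mul_comm (_ : ℂ) (∫ γ in _, _ ∂_ )]

theorem countable_LamNeg : (LamNeg n δ).Countable := by
  have hc : (Set.univ ×ˢ (Set.univ ×ˢ (Set.pi Set.univ fun _ => {1, δ})) :
      Set (Equiv.Perm (Fin n) × (Fin n → ℤ) × (Fin n → F))).Countable :=
    Set.countable_univ.prod (Set.countable_univ.prod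
      (Set.Finite.pi fun _ => Set.toFinite _).countable)
  exact hc.mono fun x hx => show _ ∧ _ from ⟨trivial, trivial, fun i _ => hx.1.2.2.1 i⟩

/-- The integrand is supported on a countable disjoint union of open orbits, so absolute convergence
permits summing the orbit contributions. -/
theorem integral_siegelIntegrand_eq_orbitSum (hF : LocalFieldData (ϖ : F) δ (resCard F))
    (hω : ω ^ 2 = 1) (hψ : HasOrderZero ϖ ψ) (hB : B.IsSymm) (hdet : B.det ≠ 0)
    (hf : IsStandardSection ω s 0 f)
    (hint : Integrable (siegelIntegrand ψ B f) (symHaar n F)) :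
    ∫ X, siegelIntegrand ψ B f X ∂(symHaar n F) = orbitSum (ϖ : F) δ ψ ω B s := by
  rw [integrable_siegelIntegrand_iff hψ hf] at hint
  rw [integral_siegelIntegrand hψ hf]
  have : Countable (LamNeg n δ) := countable_LamNeg
  have hdisj : Pairwise (Function.onFun Disjoint
      fun x : LamNeg n δ => coordOrbit (ϖ : F) x.1) := by
    intro x y hxy
    refine Set.disjoint_left.mpr fun z hz hz' => hxy (Subtype.ext ?_)
    exact orbit_unique hF x.2.1 y.2.1 hz hz'
  have hsum := hasSum_integral_iUnion (μ := coordHaar n F)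
    (fun x : LamNeg n δ => (isOpen_coordOrbit hF x.2.1).measurableSet) hdisj hint.integrableOn
  rw [setIntegral_eq_integral_of_forall_compl_eq_zero fun y hy =>
    coordIntegrand_of_notMem hF hf fun x hx hxy => hy (Set.mem_iUnion.mpr ⟨⟨x, hx⟩, hxy⟩)] at hsum
  rw [← hsum.tsum_eq, tsum_congr fun x : LamNeg n δ =>
    setIntegral_coordIntegrand hF hω hψ hf x.2, orbitSum]
  -- Only finitely many character sums are nonzero, so the infinite sum is a finite one.
  rw [← finsum_set_coe_eq_finsum_mem, tsum_eq_finsum]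
  · refine Set.Finite.of_finite_image (f := Subtype.val) ?_ Subtype.val_injective.injOn
    refine (finite_charSum_ne_zero hF hψ hB hdet).subset ?_
    rintro _ ⟨x, hx, rfl⟩
    refine ⟨x.2, fun h => hx ?_⟩
    simp [h]

theorem orbitSum_eq_sum (hF : LocalFieldData (ϖ : F) δ q) (hψ : HasOrderZero ϖ ψ)
    (hB : B.IsSymm) (hdet : B.det ≠ 0) :
    orbitSum (ϖ : F) δ ψ ω B = fun s => ∑ x ∈ (finite_charSum_ne_zero hF hψ hB hdet).toFinset,
      ω (repS (ϖ : F) x).det * ((‖(repS (ϖ : F) x).det‖ : ℝ) : ℂ) ^ (-s) *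
        (charSum ψ (repS (ϖ : F) x) B / (localDensity (ϖ : F) (repS (ϖ : F) x) : ℂ)) := by
  funext s
  refine finsum_mem_eq_sum_of_inter_support_eq _ ?_
  ext x
  simp only [Set.Finite.coe_toFinset, Set.mem_inter_iff, Function.mem_support]
  refine ⟨fun ⟨h1, h2⟩ => ⟨⟨h1, fun h => h2 (by simp [h])⟩, h2⟩, fun ⟨h1, h2⟩ => ⟨h1.1, h2⟩⟩

theorem differentiable_orbitSum (hF : LocalFieldData (ϖ : F) δ q) (hψ : HasOrderZero ϖ ψ)
    (hB : B.IsSymm) (hdet : B.det ≠ 0) : Differentiable ℂ (orbitSum (ϖ : F) δ ψ ω B) := by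
  rw [orbitSum_eq_sum hF hψ hB hdet]
  refine Differentiable.fun_sum fun x hx => ?_
  have hx' : x ∈ LamNeg n δ := ((Set.Finite.mem_toFinset _).mp hx).1
  refine Differentiable.mul_const (Differentiable.const_mul ?_ _) _
  refine differentiable_id.neg.const_cpow (Or.inl ?_)
  exact_mod_cast (zero_lt_one.trans_le (one_le_norm_det_repS hF hx')).ne'

/-- An orbit with all exponents negative lies in a box whose size is given by its determinant. -/
theorem coordOrbit_subset_coordBox (hF : LocalFieldData (ϖ : F) δ q) (hx : x ∈ LamNeg n δ) :
    ∃ k : ℕ, ‖(repS (ϖ : F) x).det‖ = (‖(ϖ : F)‖ ^ k)⁻¹ ∧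
      coordOrbit (ϖ : F) x ⊆ coordBox n F (‖(ϖ : F)‖ ^ (-(k : ℤ))) := by
  have hnn : ∀ i, 0 ≤ -x.2.1 i := fun i => by have := hx.2 i; omega
  refine ⟨∑ i, (-x.2.1 i).toNat, ?_, fun y hy => ?_⟩
  · rw [norm_det_repS hF hx.1, ← Finset.prod_pow_eq_pow_sum, ← Finset.prod_inv_distrib]
    refine Finset.prod_congr rfl fun i _ => ?_
    rw [← zpow_natCast, Int.toNat_of_nonneg (hnn i), _root_.zpow_neg, inv_inv]
  · rw [← entryLE_iff_mem_coordBox]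
    refine entryLE_of_mem_orbit hF hx.1 (zpow_nonneg (norm_nonneg _) _) (fun a => ?_)
      hy
    refine zpow_le_zpow_right_of_le_one₀ hF.norm_pos hF.norm_lt_one.le ?_
    have h1 := Finset.single_le_sum (f := fun i => (-x.2.1 i).toNat) (fun i _ => Nat.zero_le _)
      (Finset.mem_univ a)
    have h2 := Int.toNat_of_nonneg (hnn a)
    omega

theorem norm_quadratic (hω : ω ^ 2 = 1) {a : F} (ha : a ≠ 0) : ‖ω a‖ = 1 := by
  have h := congrArg norm (quadratic_mul_self hω ha)
  rw [norm_mul, norm_one] at h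
  nlinarith [norm_nonneg (ω a)]

/-- On an orbit with |det S| = q^k the integrand has absolute value q^(-k Re s), and the orbit lies
in the box of radius q^k. So the k-th summand alone dominates. -/
theorem enorm_coordIntegrand_le (hF : LocalFieldData (ϖ : F) δ q) (hω : ω ^ 2 = 1)
    (hf : IsStandardSection ω s 0 f) (y : UpperCoord n F) :
    ‖coordIntegrand ψ B f y‖ₑ ≤ ∑' k : ℕ, (coordBox n F (‖(ϖ : F)‖ ^ (-(k : ℤ)))).indicator
      (fun _ => ENNReal.ofReal ((‖(ϖ : F)‖ ^ k) ^ s.re)) y := by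
  by_cases hy : ∃ x ∈ LamNeg n δ, y ∈ coordOrbit (ϖ : F) x
  · obtain ⟨x, hx, hxy⟩ := hy
    obtain ⟨k, hk, hbox⟩ := coordOrbit_subset_coordBox hF hx
    refine le_trans ?_ (ENNReal.le_tsum k)
    rw [Set.indicator_of_mem (hbox hxy), coordIntegrand_of_mem hF hω hf hx hxy,
      ← ofReal_norm]
    refine (congrArg ENNReal.ofReal ?_).le
    rw [norm_mul, norm_mul, Circle.norm_coe, mul_one, norm_quadratic hω (det_repS_ne_zero hF hx.1),
      one_mul, hk, norm_inv_cpow_neg (pow_pos hF.norm_pos k),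
      Complex.norm_cpow_eq_rpow_re_of_pos (pow_pos hF.norm_pos k)]
  · push Not at hy
    rw [coordIntegrand_of_notMem hF hf hy, enorm_zero]
    exact zero_le

/-- The box of radius q^k has volume q^(kN) with N = n(n+1)/2, so the dominating series is geometric
with ratio q^(N - Re s). -/
theorem integrable_siegelIntegrand (hF : LocalFieldData (ϖ : F) δ q) (hω : ω ^ 2 = 1)
    (hψ : HasOrderZero ϖ ψ) (hf : IsStandardSection ω s 0 f)
    (hs : (Fintype.card {p : Fin n × Fin n // p.1 ≤ p.2} : ℝ) < s.re) :
    Integrable (siegelIntegrand ψ B f) (symHaar n F) := by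
  rw [integrable_siegelIntegrand_iff hψ hf]
  refine ⟨(continuous_coordIntegrand hψ hf).measurable.aestronglyMeasurable, ?_⟩
  set N := Fintype.card {p : Fin n × Fin n // p.1 ≤ p.2} with hN
  have hpos := hF.norm_pos
  refine (lintegral_mono (enorm_coordIntegrand_le hF hω hf)).trans_lt ?_
  have hmeas : ∀ k : ℕ, MeasurableSet (coordBox n F (‖(ϖ : F)‖ ^ (-(k : ℤ)))) := fun k =>
    (isOpen_coordBox (zpow_pos hpos _).ne').measurableSet
  rw [lintegral_tsum fun k => (measurable_const.indicator (hmeas k)).aemeasurable]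
  set t := ‖(ϖ : F)‖ ^ (s.re - N) with ht
  have ht1 : t < 1 := Real.rpow_lt_one hpos.le hF.norm_lt_one (by linarith)
  have hterm : ∀ k : ℕ, ∫⁻ y, (coordBox n F (‖(ϖ : F)‖ ^ (-(k : ℤ)))).indicator
      (fun _ => ENNReal.ofReal ((‖(ϖ : F)‖ ^ k) ^ s.re)) y ∂(coordHaar n F) =
        ENNReal.ofReal t ^ k := by
    intro k
    rw [lintegral_indicator_const (hmeas k), coordHaar_coordBox hF, ← hN,
      ← ENNReal.ofReal_pow (zpow_pos hpos _).le,
      ← ENNReal.ofReal_mul (by positivity), ← ENNReal.ofReal_pow (by positivity)]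
    congr 1
    rw [ht, ← Real.rpow_natCast, ← Real.rpow_natCast, ← Real.rpow_natCast, ← Real.rpow_intCast,
      ← Real.rpow_mul hpos.le, ← Real.rpow_mul hpos.le, ← Real.rpow_mul hpos.le,
      ← Real.rpow_add hpos]
    congr 1
    push_cast
    ring
  rw [tsum_congr hterm, ENNReal.tsum_geometric]
  refine ENNReal.inv_lt_top.mpr (tsub_pos_of_lt ?_)
  rwa [← ENNReal.ofReal_one, ENNReal.ofReal_lt_ofReal_iff one_pos]

end SiegelSeries

/-- Two meromorphic functions in normal form that agree on a right half-plane are equal. -/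
theorem eq_of_eq_on_halfPlane {f g : ℂ → ℂ} (hf : MeromorphicNFOn f Set.univ)
    (hg : MeromorphicNFOn g Set.univ) {a : ℝ} (h : ∀ s : ℂ, a < s.re → f s = g s) : f = g := by
  have hfg : MeromorphicOn (f - g) Set.univ := hf.meromorphicOn.sub hg.meromorphicOn
  -- Identity theorem: on the connected plane, infinite order of the difference at one point
  -- propagates to all points. Normal form then upgrades agreement on punctured neighbourhoods to
  -- equality of values.
  have htop : ∀ s : ℂ, meromorphicOrderAt (f - g) s = ⊤ := by
    by_contra! hne
    obtain ⟨s, hs⟩ := hne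
    refine (hfg.exists_meromorphicOrderAt_ne_top_iff_forall isConnected_univ).mp
      ⟨⟨s, trivial⟩, hs⟩ ⟨((a + 1 : ℝ) : ℂ), trivial⟩ ?_
    rw [meromorphicOrderAt_eq_top_iff]
    refine Filter.Eventually.filter_mono nhdsWithin_le_nhds ?_
    have hopen : IsOpen {s : ℂ | a < s.re} := isOpen_lt continuous_const Complex.continuous_re
    filter_upwards [hopen.mem_nhds (show a < ((a + 1 : ℝ) : ℂ).re by simp)] with s hs
    rw [Pi.sub_apply, h s hs, sub_self]
  funext s
  refine Filter.EventuallyEq.eq_of_nhds (x := s) ?_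
  rw [← (hf (Set.mem_univ s)).eventuallyEq_nhdsNE_iff_eventuallyEq_nhds (hg (Set.mem_univ s))]
  filter_upwards [meromorphicOrderAt_eq_top_iff.mp (htop s)] with z hz
  exact sub_eq_zero.mp hz

end RamifiedSiegel

/-! ### Assembly of the theorem. -/

theorem theorem3p5
    {F : Type*} [NontriviallyNormedField F] [IsUltrametricDist F] [LocallyCompactSpace F]
    [CharZero F] [MeasurableSpace F] [BorelSpace F]
    (hq : Odd (RamifiedSiegel.resCard F))
    (ϖ : 𝒪[F]) (hϖ : Irreducible ϖ)
    (hnorm : ‖(ϖ : F)‖ = ((RamifiedSiegel.resCard F : ℕ) : ℝ)⁻¹)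
    (δ : 𝒪[F]ˣ) (hδ : ¬ IsSquare δ)
    (ψ : AddChar F Circle) (hψ : RamifiedSiegel.HasOrderZero ϖ ψ)
    (ω : MulChar F ℂ) (hω : ω ^ 2 = 1)
    (n : ℕ) (B : Matrix (Fin n) (Fin n) F) (hB : B.IsSymm) (hdet : B.det ≠ 0) :
    -- `f_0` exists for every `s`
    (∀ s : ℂ, ∃ f : RamifiedSiegel.Sp n F → ℂ, RamifiedSiegel.IsStandardSection ω s 0 f) ∧
    -- the local densities exist and are positive
    (∀ x ∈ RamifiedSiegel.LamNeg n ((δ : 𝒪[F]) : F),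
      Tendsto (RamifiedSiegel.densitySeq (ϖ : F) (RamifiedSiegel.repS (ϖ : F) x)) atTop
        (𝓝 (RamifiedSiegel.localDensity (ϖ : F) (RamifiedSiegel.repS (ϖ : F) x))) ∧
      0 < RamifiedSiegel.localDensity (ϖ : F) (RamifiedSiegel.repS (ϖ : F) x)) ∧
    -- the sum is finite
    {x ∈ RamifiedSiegel.LamNeg n ((δ : 𝒪[F]) : F) |
      RamifiedSiegel.charSum ψ (RamifiedSiegel.repS (ϖ : F) x) B ≠ 0}.Finite ∧
    ∀ f : ℂ → RamifiedSiegel.Sp n F → ℂ,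
      (∀ s : ℂ, RamifiedSiegel.IsStandardSection ω s 0 (f s)) →
      -- the formula holds wherever the integral converges absolutely
      (∀ s : ℂ,
        Integrable (RamifiedSiegel.siegelIntegrand ψ B (f s)) (RamifiedSiegel.symHaar n F) →
        ∫ X, RamifiedSiegel.siegelIntegrand ψ B (f s) X ∂(RamifiedSiegel.symHaar n F) =
          RamifiedSiegel.orbitSum (ϖ : F) ((δ : 𝒪[F]) : F) ψ ω B s) ∧
      -- the Siegel series exists as a meromorphic function, and equals the sum for every `s`
      (∃ Z : ℂ → ℂ, RamifiedSiegel.IsSiegelSeries ψ B f Z) ∧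
      ∀ Z : ℂ → ℂ, RamifiedSiegel.IsSiegelSeries ψ B f Z →
        ∀ s : ℂ, Z s = RamifiedSiegel.orbitSum (ϖ : F) ((δ : 𝒪[F]) : F) ψ ω B s := by

  have : ProperSpace F := ProperSpace.of_locallyCompactSpace F
  have hF := RamifiedSiegel.localFieldData hq ϖ hϖ hnorm δ hδ
  refine ⟨fun s => ⟨_, RamifiedSiegel.isStandardSection_cellSection hF hω s⟩,
    fun x hx => ⟨?_, RamifiedSiegel.localDensity_pos hF hx.1⟩,
    RamifiedSiegel.finite_charSum_ne_zero hF hψ hB hdet, fun f hf => ?_⟩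
  · rw [RamifiedSiegel.localDensity_eq hF hx.1]
    exact RamifiedSiegel.tendsto_densitySeq hF hx.1
  have hformula := fun s =>
    RamifiedSiegel.integral_siegelIntegrand_eq_orbitSum hF hω hψ hB hdet (hf s)
  -- The orbit sum is entire, so it serves as the continuation itself.
  have hNF : MeromorphicNFOn (RamifiedSiegel.orbitSum (ϖ : F) ((δ : 𝒪[F]) : F) ψ ω B) Set.univ :=
    fun s _ => ((RamifiedSiegel.differentiable_orbitSum hF hψ hB hdet).analyticAt s).meromorphicNFAt
  have hint := fun s => RamifiedSiegel.integrable_siegelIntegrand (B := B) hF hω hψ (hf s)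
  refine ⟨hformula, ⟨_, hNF, _, fun s hs => ⟨hint s hs, (hformula s (hint s hs)).symm⟩⟩, ?_⟩
  rintro Z ⟨hZ, a, ha⟩ s
  refine congrFun (RamifiedSiegel.eq_of_eq_on_halfPlane hZ hNF (a := a) fun s hs => ?_) s
  rw [(ha s hs).2, hformula s (ha s hs).1]
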